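/- A \emph{(vacuum) graph of the quartic model} is a finite non-empty connected $4$-colored graph $\mathcal G$ (each node is incident to exactly one edge of each color $0,1,2,3$; multiple edges of different colors are allowed, bipartiteness is not required) such that every connected component of the subgraph with colors $1,2,3$ (a \emph{bubble}) has exactly four nodes. Thus each bubble is either a tetrahedron (the properly $3$-edge-colored $K_4$) or one of the three pillows (two colors give the same perfect matching, the third one a different one). The edges of color $0$ are called \emph{lines}; a \emph{face} of color $\ell\in\{1,2,3\}$ is a cycle alternating between lines and edges of color $\ell$. If $\mathcal G$ has $L$ lines and $F$ faces, its degree is $$\omega(\mathcal G)=3+\tfrac32 L-\sum_{b}\bigl(\tfrac32-\rho(b)\bigr)-F,\qquad \rho(b)=\tfrac12\sum_{\ell=1}^3 (C_b^\ell-1),$$ where $b$ runs over the bubbles of $\mathcal G$ and $C_b^\ell$ is the number of connected components of $b$ after deletion of its edges of color $\ell$ (so $\rho=0$ for the tetrahedron and $\rho=\frac12$ for the pillows). $\mathcal G$ is \emph{NLO} if $\omega(\mathcal G)=\frac12$. Graphs are considered up to isomorphism preserving the edge colors. Cutting a line of a vacuum graph gives a $2$-point graph; a $2$-point graph can be inserted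 in a line $\{x,x'\}$ of another graph by replacing this line by two lines joining $x$ and $x'$ to the two external legs. The \emph{elementary melonic vacuum graphs} are: (type I) two tetrahedra, each node of the first being joined by a line to the corresponding node of the second; (type II) one pillow, with two lines parallel to its two double edges (one such graph for each of the three pillows). The \emph{vacuum melonic graphs} are those obtained from an elementary melonic vacuum graph by finitely many insertions, in lines, of elementary melonic vacuum graphs with one line cut. A \emph{melonic $2$-point graph} is a $2$-point graph whose closure (obtained by joining its two external legs into a line) is a vacuum melonic graph. A $2$-point subgraph of $\mathcal G$ consists of a non-empty set of bubbles of $\mathcal G$ with all the lines of $\mathcal G$ between their nodes, such that exactly two nodes $x\neq y$ of these bubbles are joined by lines to other bubbles of $\mathcal G$ (the external legs are then attached at $x$ and $y$), or of all the bubbles of $\mathcal G$, with one line $\{x,y\}$ cut. A graph is a \emph{core graph} if it has no melonic $2$-point subgraph. For $\ell\in\{1,2,3\}$, the \emph{infinity graph} of color $\ell$ is the graph with a single bubble, a tetrahedron, and two lines parallel to its two edges of color $\ell$. \textbf{Proposition.} The NLO core graphs of the quartic model are exactly the three infinity graphs, which are pairwise non-isomorphic. Consequently, the NLO graphs of the quartic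 model are exactly the graphs obtained from an infinity graph by a finite (possibly empty) sequence of insertions of melonic $2$-point graphs in lines. -/

import Mathlib

universe u v

/-- A finite `4`-colored graph (not necessarily bipartite): for each color `c` in `{0, 1, 2, 3}`
every node lies on exactly one edge of color `c`, and `nb c x` is the other end of the edge of
color `c` at `x`. The edges of color `0` are the lines (propagators). Multiple edges of different
colors are allowed. Having no external legs, such a graph is a vacuum graph. -/
structure ColoredGraph where
  Node : Type u
  finite_node : Finite Node
  nb : Fin 4 → Node → Node
  nb_nb : ∀ c x, nb c (nb c x) = x
  nb_ne : ∀ c x, nb c x ≠ x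

namespace ColoredGraph

/-- The connected components of the subgraph that has all the nodes of `G` and
only the edges whose color lies in `S`. -/
def Component (G : ColoredGraph.{u}) (S : Set (Fin 4)) : Type u :=
  Quot (fun x y : G.Node => ∃ c ∈ S, G.nb c x = y)

/-- The component with colors in `S` of the node `x`. -/
def component (G : ColoredGraph.{u}) (S : Set (Fin 4)) (x : G.Node) : G.Component S :=
  Quot.mk _ x

/-- `G` is connected (in particular non-empty). -/
def Connected (G : ColoredGraph.{u}) : Prop :=
  Nat.card (G.Component Set.univ) = 1

/-- The bubbles (interaction vertices): components of the subgraph with colors `1, 2, 3`. -/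
abbrev Bubble (G : ColoredGraph.{u}) : Type u :=
  G.Component {c | c ≠ 0}

/-- The number of nodes of a bubble. -/
noncomputable def valency (G : ColoredGraph.{u}) (b : G.Bubble) : ℕ :=
  Set.ncard {x : G.Node | G.component {c | c ≠ 0} x = b}

/-- The graphs of the quartic model: all bubbles are connected `3`-colored graphs on four nodes.
Up to isomorphism these are the tetrahedron (three different perfect matchings) and the three
pillows (exactly two equal matchings). -/
def IsQuartic (G : ColoredGraph.{u}) : Prop :=
  ∀ b : G.Bubble, G.valency b = 4

/-- The number of lines (edges of color `0`). -/
noncomputable def numLines (G : ColoredGraph.{u}) : ℕ :=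
  Nat.card (G.Component {0})

/-- The number of faces: a face of color `ℓ ∈ {1, 2, 3}` is a cycle that alternates between
lines and edges of color `ℓ`. Here and below, `ℓ : Fin 3` stands for the color `ℓ.succ`. -/
noncomputable def numFaces (G : ColoredGraph.{u}) : ℕ :=
  ∑ ℓ : Fin 3, Nat.card (G.Component {0, ℓ.succ})

/-- The number of connected components of the bubble `b` after deletion of its edges of
color `ℓ`. -/
noncomputable def bubbleComponents (G : ColoredGraph.{u}) (b : G.Bubble) (ℓ : Fin 3) : ℕ :=
  Set.ncard {k : G.Component {c | c ≠ 0 ∧ c ≠ ℓ.succ} |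
    ∃ x : G.Node, G.component {c | c ≠ 0 ∧ c ≠ ℓ.succ} x = k ∧ G.component {c | c ≠ 0} x = b}

/-- The scaling exponent `ρ(b) = (1/2) ∑_ℓ δ_ℓ(b)`, where `δ_ℓ(b) + 1` is the number of components
of `b` after deletion of the color `ℓ`. It is `0` for a tetrahedron and `1/2` for a pillow. -/
noncomputable def rho (G : ColoredGraph.{u}) (b : G.Bubble) : ℚ :=
  1 / 2 * ∑ ℓ : Fin 3, ((G.bubbleComponents b ℓ : ℚ) - 1)

/-- The degree `ω = 3 + (3/2) L - ∑_b (3/2 - ρ(b)) - F` of a graph all of whose bubbles have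
more than two nodes. -/
noncomputable def degree (G : ColoredGraph.{u}) : ℚ :=
  3 + 3 / 2 * (G.numLines : ℚ) - ∑ᶠ b : G.Bubble, (3 / 2 - G.rho b) - (G.numFaces : ℚ)

/-- Next-to-leading order vacuum graphs of the quartic model. -/
def IsNLO (G : ColoredGraph.{u}) : Prop :=
  G.IsQuartic ∧ G.Connected ∧ G.degree = 1 / 2

/-- Isomorphism of colored graphs: a bijection of the nodes that preserves the colored edges. -/
def Isomorphic (G : ColoredGraph.{u}) (H : ColoredGraph.{v}) : Prop :=
  ∃ e : G.Node ≃ H.Node, ∀ c x, e (G.nb c x) = H.nb c (e x)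

/-- The three perfect matchings of a set of four nodes. -/
def flip : Fin 3 → Bool × Bool → Bool × Bool
  | 0, p => (!p.1, p.2)
  | 1, p => (p.1, !p.2)
  | 2, p => (!p.1, !p.2)

theorem flip_flip : ∀ ℓ p, flip ℓ (flip ℓ p) = p := by decide

theorem flip_ne : ∀ ℓ p, flip ℓ p ≠ p := by decide

/-- The infinity graph of color `ℓ`: one tetrahedron, and two tadpole lines parallel to its
edges of color `ℓ`. -/
def infinityGraph (ℓ : Fin 3) : ColoredGraph.{0} where
  Node := Bool × Bool
  finite_node := inferInstance
  nb c := Fin.cases (flip ℓ) flip c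
  nb_nb c x := by cases c using Fin.cases <;> simp [flip_flip]
  nb_ne c x := by cases c using Fin.cases <;> simp [flip_ne]

/-- The elementary melonic vacuum graph of type I: two tetrahedra, each node of the first being
joined by a line to the corresponding node of the second. -/
def melonI : ColoredGraph.{0} where
  Node := Bool × (Bool × Bool)
  finite_node := inferInstance
  nb c x := Fin.cases (!x.1, x.2) (fun k => (x.1, flip k x.2)) c
  nb_nb c x := by cases c using Fin.cases <;> simp [flip_flip]
  nb_ne c x e := by
    cases c using Fin.cases with
    | zero => simpa using congrArg Prod.fst e
    | succ k => exact flip_ne k x.2 (congrArg Prod.snd e)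

/-- The elementary melonic vacuum graph of type II and color `ℓ`: one pillow, in which the single
edges have color `ℓ`, with two lines parallel to the double edges. -/
def melonII (ℓ : Fin 3) : ColoredGraph.{0} where
  Node := Bool × Bool
  finite_node := inferInstance
  nb c := Fin.cases (flip 1) (fun k => if k = ℓ then flip 0 else flip 1) c
  nb_nb c x := by
    cases c using Fin.cases with
    | zero => simp [flip_flip]
    | succ k => by_cases h : k = ℓ <;> simp [h, flip_flip]
  nb_ne c x := by
    cases c using Fin.cases with
    | zero => simp [flip_ne]
    | succ k => by_cases h : k = ℓ <;> simp [h, flip_ne]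

open Classical in
/-- The color-`c` neighbor in the graph obtained from `G` by insertion of a `2`-point graph. -/
noncomputable def insertNb (G : ColoredGraph.{u}) (x : G.Node) (H : ColoredGraph.{v}) (h : H.Node)
    (c : Fin 4) : G.Node ⊕ H.Node → G.Node ⊕ H.Node
  | .inl z =>
      if c = 0 ∧ z = x then .inr h
      else if c = 0 ∧ z = G.nb 0 x then .inr (H.nb 0 h)
      else .inl (G.nb c z)
  | .inr w =>
      if c = 0 ∧ w = h then .inl x
      else if c = 0 ∧ w = H.nb 0 h then .inl (G.nb 0 x)
      else .inr (H.nb c w)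

theorem insertNb_insertNb (G : ColoredGraph.{u}) (x : G.Node) (H : ColoredGraph.{v}) (h : H.Node)
    (c : Fin 4) (z : G.Node ⊕ H.Node) :
    insertNb G x H h c (insertNb G x H h c z) = z := by
  by_cases hc : c = 0
  · subst hc
    rcases z with z | w
    · by_cases h1 : z = x
      · simp [insertNb, h1]
      · by_cases h2 : z = G.nb 0 x
        · simp [insertNb, h2, G.nb_ne, H.nb_ne]
        · have h3 : G.nb 0 z ≠ x := fun e => h2 (by rw [← e, G.nb_nb])
          have h4 : G.nb 0 z ≠ G.nb 0 x := fun e => h1 (by rw [← G.nb_nb 0 z, e, G.nb_nb])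
          simp [insertNb, h1, h2, h3, h4, G.nb_nb]
    · by_cases h1 : w = h
      · simp [insertNb, h1]
      · by_cases h2 : w = H.nb 0 h
        · simp [insertNb, h2, G.nb_ne, H.nb_ne]
        · have h3 : H.nb 0 w ≠ h := fun e => h2 (by rw [← e, H.nb_nb])
          have h4 : H.nb 0 w ≠ H.nb 0 h := fun e => h1 (by rw [← H.nb_nb 0 w, e, H.nb_nb])
          simp [insertNb, h1, h2, h3, h4, H.nb_nb]
  · rcases z with z | w
    · simp [insertNb, hc, G.nb_nb]
    · simp [insertNb, hc, H.nb_nb]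

theorem insertNb_ne (G : ColoredGraph.{u}) (x : G.Node) (H : ColoredGraph.{v}) (h : H.Node)
    (c : Fin 4) (z : G.Node ⊕ H.Node) : insertNb G x H h c z ≠ z := by
  rcases z with z | w
  · simp only [insertNb]
    split_ifs <;> simp [G.nb_ne]
  · simp only [insertNb]
    split_ifs <;> simp [H.nb_ne]

/-- Cutting the line `{h, h'}` of the vacuum graph `H` yields a `2`-point graph; `G.insert x H h`
is the result of inserting it in the line `{x, x'}` of `G`: the lines `{x, x'}` and `{h, h'}` are
replaced by the lines `{x, h}` and `{x', h'}`. -/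
noncomputable def insert (G : ColoredGraph.{u}) (x : G.Node) (H : ColoredGraph.{v}) (h : H.Node) :
    ColoredGraph.{max u v} where
  Node := G.Node ⊕ H.Node
  finite_node := by
    have := G.finite_node
    have := H.finite_node
    infer_instance
  nb := insertNb G x H h
  nb_nb := insertNb_insertNb G x H h
  nb_ne := insertNb_ne G x H h

/-- The vacuum melonic graphs: the graphs generated from the elementary melonic vacuum graphs of
type I and II by melonic insertions of type I and II. -/
inductive IsMelonic : ColoredGraph.{u} → Prop
  | baseI {G : ColoredGraph.{u}} (e : G.Isomorphic melonI) : IsMelonic G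
  | baseII {G : ColoredGraph.{u}} (ℓ : Fin 3) (e : G.Isomorphic (melonII ℓ)) : IsMelonic G
  | stepI {G G' : ColoredGraph.{u}} (hG : IsMelonic G) (x : G.Node) (h : melonI.Node)
      (e : G'.Isomorphic (G.insert x melonI h)) : IsMelonic G'
  | stepII {G G' : ColoredGraph.{u}} (hG : IsMelonic G) (ℓ : Fin 3) (x : G.Node)
      (h : (melonII ℓ).Node) (e : G'.Isomorphic (G.insert x (melonII ℓ) h)) : IsMelonic G'

/-- `S`, `x`, `y` define a `2`-point subgraph of `G`: the set `S` of nodes is a union of bubbles,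
`x` and `y` are two distinct nodes of `S` at which the external legs are attached, and the other
nodes of `S` are joined to each other by lines of `G`. The nodes `x`, `y` may be joined to nodes
outside of `S`, or to each other by a line of `G` (which is then cut). -/
structure IsTwoPoint (G : ColoredGraph.{u}) (S : Set G.Node) (x y : G.Node) : Prop where
  left_mem : x ∈ S
  right_mem : y ∈ S
  ne : x ≠ y
  bubble_mem : ∀ c, c ≠ 0 → ∀ z ∈ S, G.nb c z ∈ S
  line_mem : ∀ z ∈ S, z ≠ x → z ≠ y → G.nb 0 z ∈ S ∧ G.nb 0 z ≠ x ∧ G.nb 0 z ≠ y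

open Classical in
/-- The color-`c` neighbor in the closure of a `2`-point subgraph, as a node of `G`. -/
noncomputable def closureNb (G : ColoredGraph.{u}) (x y : G.Node) (c : Fin 4) (z : G.Node) :
    G.Node :=
  if c = 0 ∧ z = x then y
  else if c = 0 ∧ z = y then x
  else G.nb c z

theorem closureNb_mem {G : ColoredGraph.{u}} {S : Set G.Node} {x y : G.Node}
    (h : G.IsTwoPoint S x y) (c : Fin 4) {z : G.Node} (hz : z ∈ S) :
    closureNb G x y c z ∈ S := by
  unfold closureNb
  split_ifs with h1 h2
  · exact h.right_mem
  · exact h.left_mem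
  · by_cases hc : c = 0
    · subst hc
      exact (h.line_mem z hz (fun e => h1 ⟨rfl, e⟩) (fun e => h2 ⟨rfl, e⟩)).1
    · exact h.bubble_mem c hc z hz

theorem closureNb_closureNb {G : ColoredGraph.{u}} {S : Set G.Node} {x y : G.Node}
    (h : G.IsTwoPoint S x y) (c : Fin 4) {z : G.Node} (hz : z ∈ S) :
    closureNb G x y c (closureNb G x y c z) = z := by
  by_cases hc : c = 0
  · subst hc
    by_cases h1 : z = x
    · simp [closureNb, h1, h.ne.symm]
    · by_cases h2 : z = y
      · simp [closureNb, h2, h.ne.symm]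
      · obtain ⟨-, h3, h4⟩ := h.line_mem z hz h1 h2
        simp [closureNb, h1, h2, h3, h4, G.nb_nb]
  · simp [closureNb, hc, G.nb_nb]

theorem closureNb_ne {G : ColoredGraph.{u}} {S : Set G.Node} {x y : G.Node}
    (h : G.IsTwoPoint S x y) (c : Fin 4) (z : G.Node) : closureNb G x y c z ≠ z := by
  unfold closureNb
  split_ifs with h1 h2
  · rw [h1.2]; exact h.ne.symm
  · rw [h2.2]; exact h.ne
  · exact G.nb_ne c z

/-- The closure of a `2`-point subgraph: the vacuum graph obtained by joining its two external
legs into a line. -/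
noncomputable def closure (G : ColoredGraph.{u}) (S : Set G.Node) (x y : G.Node)
    (h : G.IsTwoPoint S x y) : ColoredGraph.{u} where
  Node := S
  finite_node := by
    have := G.finite_node
    infer_instance
  nb c z := ⟨closureNb G x y c z, closureNb_mem h c z.2⟩
  nb_nb c z := Subtype.ext (closureNb_closureNb h c z.2)
  nb_ne c z := fun e => closureNb_ne h c z.1 (congrArg Subtype.val e)

/-- `G` contains no (non-trivial) melonic `2`-point subgraph, that is, no `2`-point subgraph
that closes into a vacuum melonic graph. -/
def IsCore (G : ColoredGraph.{u}) : Prop :=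
  ¬ ∃ (S : Set G.Node) (x y : G.Node) (h : G.IsTwoPoint S x y), (G.closure S x y h).IsMelonic

/-- The graphs obtained from an infinity graph by successive insertions of melonic `2`-point
graphs, a melonic `2`-point graph being a vacuum melonic graph with one line cut. -/
inductive IsMelonicInfinity : ColoredGraph.{u} → Prop
  | base {G : ColoredGraph.{u}} (ℓ : Fin 3) (e : G.Isomorphic (infinityGraph ℓ)) :
      IsMelonicInfinity G
  | step {G G' H : ColoredGraph.{u}} (hG : IsMelonicInfinity G) (x : G.Node) (hH : H.IsMelonic)
      (h : H.Node) (e : G'.Isomorphic (G.insert x H h)) : IsMelonicInfinity G'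

end ColoredGraph

universe w

/-! ### Components, closed sets of nodes and connectedness -/

namespace ColoredGraph

/-! Let N be the number of nodes, F the number of faces, and P the number of nodes with two parallel
bubble edges, summed over the pairs of bubble colors. Bubble colors commute in a quartic graph, so
their two-colored components can be counted, and the degree becomes 3 + (3N + P)/8 - F
(`degree_eq`). Components are counted as dimensions of spaces of invariant functions over the field
with two elements; the effect of a surgery on the faces then follows by rank-nullity.

A proper 2-point subgraph exhibits the graph as an insertion (`IsTwoPoint.isomorphic_insert`), and
the degree is additive under insertion (`degree_insert`). This reduces the study of small degrees to
irreducible graphs, where a bubble either is the whole graph or sends all its lines to other bubbles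
(`lines_at_bubble`). A pillow of the latter kind can be removed, and the degree drops by at least 1
(`exists_remove_pillow`). If all bubbles are tetrahedra, each jacket (the surface with colors 0, i,
j) is connected and has Euler characteristic at most 2; adding the three bounds gives a nonnegative
degree. Induction yields `degree_nonneg`.

Consider now an irreducible graph of degree less than 1. If it has a pillow, positivity forbids the
removal, so the graph is a single pillow and a direct count identifies it. If all bubbles are
tetrahedra, at least two jackets are spheres, hence bipartite. Comparing the two bipartitions shows
that, without a face having exactly two lines, the faces of two colors would all have at least four
lines, and there would be too few of them. A short face at a line with both ends in one tetrahedron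
leads to an infinity graph. Otherwise it joins two tetrahedra, which are replaced by a pillow
without raising the degree or destroying irreducibility; the result is a single pillow, so the graph
is `melonI`. This is `classification_of_irreducible`.

Degrees are half-integers, and degree 0 means melonic, by induction and closure of melonic graphs
under insertion (`IsMelonic.insert`). A splitting of degree 1/2 has a part of degree 0, so an NLO
core graph is irreducible, hence an infinity graph. Any other NLO graph is reached by removing
melonic 2-point subgraphs one at a time. -/

instance (G : ColoredGraph.{u}) : Finite G.Node := G.finite_node

noncomputable instance (G : ColoredGraph.{u}) : Fintype G.Node := Fintype.ofFinite _

instance (G : ColoredGraph.{u}) (S : Set (Fin 4)) : Finite (G.Component S) :=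
  Finite.of_surjective (G.component S) Quot.mk_surjective

theorem nb_injective (G : ColoredGraph.{u}) (c : Fin 4) : Function.Injective (G.nb c) :=
  Function.LeftInverse.injective (G.nb_nb c)

theorem nb_eq_comm (G : ColoredGraph.{u}) (c : Fin 4) {x y : G.Node} :
    G.nb c x = y ↔ x = G.nb c y :=
  ⟨fun h => by rw [← h, G.nb_nb], fun h => by rw [h, G.nb_nb]⟩

/-- The number of components of the subgraph with colors in `S`. -/
noncomputable def numComp (G : ColoredGraph.{u}) (S : Set (Fin 4)) : ℕ :=
  Nat.card (G.Component S)

theorem component_nb (G : ColoredGraph.{u}) {S : Set (Fin 4)} {c : Fin 4} (hc : c ∈ S)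
    (x : G.Node) : G.component S (G.nb c x) = G.component S x :=
  (Quot.sound ⟨c, hc, rfl⟩).symm

/-- A set of nodes closed under the colors of `S` is a union of components. -/
theorem mem_of_component_eq (G : ColoredGraph.{u}) {S : Set (Fin 4)} {A : Set G.Node}
    (hA : ∀ c ∈ S, ∀ z ∈ A, G.nb c z ∈ A) {x y : G.Node}
    (h : G.component S y = G.component S x) (hx : x ∈ A) : y ∈ A := by
  let f : G.Component S → Prop := Quot.lift (fun z => z ∈ A) (by
    rintro a b ⟨c, hc, rfl⟩
    refine propext ⟨hA c hc a, fun hb => ?_⟩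
    simpa [G.nb_nb] using hA c hc _ hb)
  have h2 : f (G.component S y) = f (G.component S x) := by rw [h]
  exact h2.mpr hx

/-- Connectedness in terms of closed sets of nodes. -/
theorem connected_iff (G : ColoredGraph.{u}) :
    G.Connected ↔ Nonempty G.Node ∧
      ∀ A : Set G.Node, (∀ c, ∀ z ∈ A, G.nb c z ∈ A) → A.Nonempty → A = Set.univ := by
  unfold Connected
  rw [Nat.card_eq_one_iff_unique]
  constructor
  · rintro ⟨h1, ⟨k⟩⟩
    obtain ⟨x, -⟩ := Quot.exists_rep k
    refine ⟨⟨x⟩, fun A hA ⟨a, ha⟩ => Set.eq_univ_of_forall fun z => ?_⟩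
    exact G.mem_of_component_eq (S := Set.univ) (fun c _ => hA c) (Subsingleton.elim _ _) ha
  · rintro ⟨⟨x⟩, h⟩
    refine ⟨⟨fun k k' => ?_⟩, ⟨G.component _ x⟩⟩
    induction k using Quot.ind with | _ a
    induction k' using Quot.ind with | _ b
    have := h {z | G.component Set.univ z = G.component Set.univ b}
      (fun c z hz => by
        simp only [Set.mem_ofPred_eq] at hz ⊢
        rw [G.component_nb (Set.mem_univ c), hz]) ⟨b, rfl⟩
    exact (Set.eq_univ_iff_forall.mp this a)

theorem Connected.eq_univ {G : ColoredGraph.{u}} (h : G.Connected) {A : Set G.Node}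
    (hA : ∀ c, ∀ z ∈ A, G.nb c z ∈ A) (hne : A.Nonempty) : A = Set.univ :=
  ((G.connected_iff).mp h).2 A hA hne

theorem Connected.nonempty {G : ColoredGraph.{u}} (h : G.Connected) : Nonempty G.Node :=
  ((G.connected_iff).mp h).1

/-! ### Invariant functions -/

/-- The functions with values in the field with two elements that are constant on the
components with colors in `S`. -/
def inv (G : ColoredGraph.{u}) (S : Set (Fin 4)) : Submodule (ZMod 2) (G.Node → ZMod 2) where
  carrier := {f | ∀ c ∈ S, ∀ z, f (G.nb c z) = f z}
  add_mem' hf hg c hc z := by simp [hf c hc z, hg c hc z]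
  zero_mem' c _ z := rfl
  smul_mem' a f hf c hc z := by simp [hf c hc z]

theorem inv_anti (G : ColoredGraph.{u}) {S T : Set (Fin 4)} (h : S ⊆ T) : G.inv T ≤ G.inv S :=
  fun _ hf c hc => hf c (h hc)

/-- Invariant functions are functions on the set of components. -/
def invEquiv (G : ColoredGraph.{u}) (S : Set (Fin 4)) :
    G.inv S ≃ₗ[ZMod 2] (G.Component S → ZMod 2) where
  toFun f := Quot.lift f.1 (by rintro a b ⟨c, hc, rfl⟩; exact (f.2 c hc a).symm)
  map_add' f g := by ext k; induction k using Quot.ind; rfl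
  map_smul' a f := by ext k; induction k using Quot.ind; rfl
  invFun g := ⟨fun z => g (G.component S z), fun c hc z => by simp only [G.component_nb hc]⟩
  left_inv f := rfl
  right_inv g := by ext k; induction k using Quot.ind; rfl

/-- Turns the count of components into a dimension, so that merging or losing faces is controlled by
the rank of linear maps. -/
theorem finrank_inv (G : ColoredGraph.{u}) (S : Set (Fin 4)) :
    Module.finrank (ZMod 2) (G.inv S) = G.numComp S := by
  have : Fintype (G.Component S) := Fintype.ofFinite _
  rw [(G.invEquiv S).finrank_eq, Module.finrank_fintype_fun_eq_card, numComp,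
    Nat.card_eq_fintype_card]

/-! ### Counting components -/

open Classical in
/-- If a weight has the sum `k` on each component, then its total sum is `k` times the number of
components. -/
theorem sum_eq_mul_numComp (G : ColoredGraph.{u}) (S : Set (Fin 4)) (w : G.Node → ℕ) (k : ℕ)
    (h : ∀ x, ∑ z with G.component S z = G.component S x, w z = k) :
    ∑ z, w z = k * G.numComp S := by
  have : Fintype (G.Component S) := Fintype.ofFinite _
  rw [← Finset.sum_fiberwise (g := G.component S) Finset.univ w]
  rw [Finset.sum_congr rfl (g := fun _ => k)]
  · rw [Finset.sum_const, numComp, Nat.card_eq_fintype_card, Finset.card_univ, smul_eq_mul,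
      mul_comm]
  · intro q _
    induction q using Quot.ind with | _ a
    exact h a

open Classical in
theorem mul_numComp_le (G : ColoredGraph.{u}) (S : Set (Fin 4)) (k : ℕ)
    (h : ∀ x, k ≤ ({z | G.component S z = G.component S x} : Finset G.Node).card) :
    k * G.numComp S ≤ Nat.card G.Node := by
  have : Fintype (G.Component S) := Fintype.ofFinite _
  rw [Nat.card_eq_fintype_card, ← Finset.card_univ,
    Finset.card_eq_sum_card_fiberwise (f := G.component S) (t := Finset.univ) (by simp),
    numComp, Nat.card_eq_fintype_card, mul_comm, ← smul_eq_mul, ← Finset.card_univ,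
    ← Finset.sum_const]
  refine Finset.sum_le_sum fun q _ => ?_
  induction q using Quot.ind with | _ a
  exact h a

open Classical in
theorem filter_component_eq (G : ColoredGraph.{u}) {S : Set (Fin 4)} (x : G.Node)
    (A : Finset G.Node) (hx : x ∈ A) (hA : ∀ c ∈ S, ∀ z ∈ A, G.nb c z ∈ A)
    (hA' : ∀ z ∈ A, G.component S z = G.component S x) :
    ({z | G.component S z = G.component S x} : Finset G.Node) = A := by
  ext z
  simp only [Finset.mem_filter, Finset.mem_univ, true_and]
  exact ⟨fun h => G.mem_of_component_eq (A := A) hA h hx, hA' z⟩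

open Classical in
theorem two_mul_numComp_singleton (G : ColoredGraph.{u}) (c : Fin 4) :
    2 * G.numComp {c} = Nat.card G.Node := by
  rw [← G.sum_eq_mul_numComp {c} (fun _ => 1) 2]
  · simp
  · intro x
    rw [G.filter_component_eq x {x, G.nb c x} (by simp)]
    · rw [Finset.sum_const, Finset.card_pair (G.nb_ne c x).symm, smul_eq_mul]
    · rintro d rfl z hz
      simp only [Finset.mem_insert, Finset.mem_singleton] at hz ⊢
      rcases hz with rfl | rfl <;> simp [G.nb_nb]
    · intro z hz
      simp only [Finset.mem_insert, Finset.mem_singleton] at hz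
      rcases hz with rfl | rfl
      · rfl
      · exact G.component_nb (Set.mem_singleton c) x

/-- The number of nodes at which the edges of colors `c` and `d` are parallel. -/
noncomputable def numPar (G : ColoredGraph.{u}) (c d : Fin 4) : ℕ :=
  Nat.card {z : G.Node // G.nb c z = G.nb d z}

theorem numPar_comm (G : ColoredGraph.{u}) (c d : Fin 4) : G.numPar c d = G.numPar d c := by
  unfold numPar
  simp only [eq_comm]

open Classical in
theorem numPar_eq_sum (G : ColoredGraph.{u}) (c d : Fin 4) :
    G.numPar c d = ∑ z, if G.nb c z = G.nb d z then 1 else 0 := by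
  rw [numPar, Nat.card_eq_fintype_card, Fintype.card_subtype, Finset.card_filter]

open Classical in
/-- Count of the components with two commuting colors. -/
theorem four_mul_numComp_pair (G : ColoredGraph.{u}) (c d : Fin 4)
    (h : ∀ z, G.nb c (G.nb d z) = G.nb d (G.nb c z)) :
    4 * G.numComp {c, d} = Nat.card G.Node + G.numPar c d := by
  -- Orbits of two commuting fixed-point-free involutions have two nodes (a double edge) or four.
  -- The weight is 2 per node in the first case and 1 in the second, so every orbit has weight 4.
  rw [← G.sum_eq_mul_numComp {c, d} (fun z => 1 + if G.nb c z = G.nb d z then 1 else 0) 4]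
  · rw [Finset.sum_add_distrib, numPar_eq_sum]; simp
  · intro x
    have hc : ∀ z, G.component {c, d} (G.nb c z) = G.component {c, d} z :=
      G.component_nb (by simp)
    have hd : ∀ z, G.component {c, d} (G.nb d z) = G.component {c, d} z :=
      G.component_nb (by simp)
    by_cases hx : G.nb c x = G.nb d x
    · rw [G.filter_component_eq x {x, G.nb c x} (by simp)]
      · rw [Finset.sum_pair (G.nb_ne c x).symm]
        simp [hx, G.nb_nb, h]
      · rintro e he z hz
        simp only [Finset.mem_insert, Finset.mem_singleton, Set.mem_insert_iff,
          Set.mem_singleton_iff] at hz he ⊢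
        rcases hz with rfl | rfl <;> rcases he with rfl | rfl <;> simp [G.nb_nb, hx]
        rw [← hx, G.nb_nb]; simp
      · intro z hz
        simp only [Finset.mem_insert, Finset.mem_singleton] at hz
        rcases hz with rfl | rfl
        · rfl
        · exact hc x
    · have h1 : G.nb c (G.nb d x) ≠ x := fun e => hx (by rw [← (G.nb_eq_comm c).mp e])
      rw [G.filter_component_eq x {x, G.nb c x, G.nb d x, G.nb c (G.nb d x)} (by simp)]
      · rw [Finset.sum_insert, Finset.sum_insert, Finset.sum_pair]
        · have h2 : G.nb d (G.nb c x) ≠ x := by rwa [← h]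
          have h3 : G.nb d (G.nb c (G.nb d x)) = G.nb c x := by rw [h, G.nb_nb]
          simp [hx, G.nb_nb, h1, h2.symm, h3, Ne.symm hx]
        · exact (G.nb_ne c _).symm
        · simp only [Finset.mem_insert, Finset.mem_singleton, not_or]
          exact ⟨hx, fun e => G.nb_ne d x (G.nb_injective c e).symm⟩
        · simp only [Finset.mem_insert, Finset.mem_singleton, not_or]
          exact ⟨(G.nb_ne c x).symm, (G.nb_ne d x).symm, h1.symm⟩
      · rintro e he z hz
        simp only [Finset.mem_insert, Finset.mem_singleton, Set.mem_insert_iff,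
          Set.mem_singleton_iff] at hz he ⊢
        rcases he with rfl | rfl
        · rcases hz with rfl | rfl | rfl | rfl <;> simp [G.nb_nb]
        · rcases hz with rfl | rfl | rfl | rfl <;> simp [G.nb_nb, ← h]
      · intro z hz
        simp only [Finset.mem_insert, Finset.mem_singleton] at hz
        rcases hz with rfl | rfl | rfl | rfl
        · rfl
        · exact hc _
        · exact hd _
        · rw [hc, hd]

/-! ### A local form of the quartic condition -/

/-- A local form of `IsQuartic`: the colors of the bubbles commute, and each node `z` has two
different neighbors `c z`, `d z` such that its bubble consists of `z`, `c z`, `d z`, `c (d z)`. -/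
structure IsLocallyQuartic (G : ColoredGraph.{u}) : Prop where
  comm : ∀ c d : Fin 4, c ≠ 0 → d ≠ 0 → ∀ z, G.nb c (G.nb d z) = G.nb d (G.nb c z)
  exists_ne : ∀ z, ∃ c d : Fin 4, c ≠ 0 ∧ d ≠ 0 ∧ G.nb c z ≠ G.nb d z
  mem : ∀ c d k : Fin 4, c ≠ 0 → d ≠ 0 → k ≠ 0 → ∀ z, G.nb c z ≠ G.nb d z →
    G.nb k z = G.nb c z ∨ G.nb k z = G.nb d z ∨ G.nb k z = G.nb c (G.nb d z)

open Classical in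
theorem card_square (G : ColoredGraph.{u}) {c d : Fin 4} {z : G.Node}
    (h : G.nb c z ≠ G.nb d z) :
    ({z, G.nb c z, G.nb d z, G.nb c (G.nb d z)} : Finset G.Node).card = 4 := by
  have h1 : G.nb c (G.nb d z) ≠ z := fun e => h (by rw [← (G.nb_eq_comm c).mp e])
  rw [Finset.card_insert_of_notMem, Finset.card_insert_of_notMem, Finset.card_pair]
  · exact (G.nb_ne c _).symm
  · simp only [Finset.mem_insert, Finset.mem_singleton, not_or]
    exact ⟨h, fun e => G.nb_ne d z (G.nb_injective c e).symm⟩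
  · simp only [Finset.mem_insert, Finset.mem_singleton, not_or]
    exact ⟨(G.nb_ne c z).symm, (G.nb_ne d z).symm, h1.symm⟩

open Classical in
theorem ncard_component (G : ColoredGraph.{u}) {S : Set (Fin 4)} (x : G.Node) :
    Set.ncard {z : G.Node | G.component S z = G.component S x} =
      ({z | G.component S z = G.component S x} : Finset G.Node).card := by
  rw [← Set.ncard_coe_finset]; simp

-- The four nodes on the right are distinct and lie in the bubble of `z`, which has no more than
-- four.
open Classical in
theorem IsQuartic.filter_eq {G : ColoredGraph.{u}} (h : G.IsQuartic) {c d : Fin 4}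
    (hc : c ≠ 0) (hd : d ≠ 0) {z : G.Node} (hz : G.nb c z ≠ G.nb d z) :
    ({w | G.component {c | c ≠ 0} w = G.component {c | c ≠ 0} z} : Finset G.Node) =
      {z, G.nb c z, G.nb d z, G.nb c (G.nb d z)} := by
  symm
  apply Finset.eq_of_subset_of_card_le
  · have hc' : ∀ z, G.component {c | c ≠ 0} (G.nb c z) = G.component {c | c ≠ 0} z :=
      G.component_nb hc
    have hd' : ∀ z, G.component {c | c ≠ 0} (G.nb d z) = G.component {c | c ≠ 0} z :=
      G.component_nb hd
    intro w hw
    simp only [Finset.mem_insert, Finset.mem_singleton] at hw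
    rcases hw with rfl | rfl | rfl | rfl <;> simp [hc', hd']
  · rw [G.card_square hz, ← ncard_component]
    exact (h _).le

/-- If `c` and `d` differ at `z`, the node `d (c z)` is one of the four nodes of the bubble, and
only `c (d z)` is compatible with injectivity and absence of fixed points. If all three colors
agreed at `z`, the bubble would have two nodes. -/
theorem IsQuartic.isLocallyQuartic {G : ColoredGraph.{u}} (h : G.IsQuartic) :
    G.IsLocallyQuartic := by
  classical
  have key : ∀ c d k : Fin 4, c ≠ 0 → d ≠ 0 → k ≠ 0 → ∀ z, G.nb c z ≠ G.nb d z →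
      ∀ w, G.component {c | c ≠ 0} w = G.component {c | c ≠ 0} z →
      w = z ∨ w = G.nb c z ∨ w = G.nb d z ∨ w = G.nb c (G.nb d z) := by
    intro c d k hc hd hk z hz w hw
    have := h.filter_eq hc hd hz
    simpa using (Finset.ext_iff.mp this w).mp (by simpa using hw)
  refine ⟨fun c d hc hd z => ?_, fun z => ?_, fun c d k hc hd hk z hz => ?_⟩
  · by_cases e : G.nb c z = G.nb d z
    · rw [← e, G.nb_nb, e, G.nb_nb]
    · rcases key c d c hc hd hc z e (G.nb d (G.nb c z)) (by
        rw [G.component_nb (show d ∈ {c | c ≠ 0} from hd),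
          G.component_nb (show c ∈ {c | c ≠ 0} from hc)]) with h1 | h1 | h1 | h1
      · exact absurd ((G.nb_eq_comm d).mp h1) e
      · exact absurd h1 (G.nb_ne d _)
      · exact absurd (G.nb_injective d h1) (G.nb_ne c z)
      · exact h1.symm
  · by_contra! hcon
    have h1 := h (G.component _ z)
    unfold valency at h1
    rw [ncard_component, G.filter_component_eq z {z, G.nb 1 z} (by simp),
      Finset.card_pair (G.nb_ne 1 z).symm] at h1
    · omega
    · intro c hc w hw
      simp only [Finset.mem_insert, Finset.mem_singleton] at hw ⊢
      rcases hw with rfl | rfl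
      · exact .inr (hcon c 1 hc (by decide))
      · left; rw [hcon 1 c (by decide) hc, G.nb_nb]
    · intro w hw
      simp only [Finset.mem_insert, Finset.mem_singleton] at hw
      rcases hw with rfl | rfl
      · rfl
      · exact G.component_nb (by simp) _
  · rcases key c d k hc hd hk z hz (G.nb k z) (G.component_nb hk z) with h1 | h1
    · exact absurd h1 (G.nb_ne k z)
    · exact h1

theorem IsLocallyQuartic.nb_mem_square {G : ColoredGraph.{u}} (h : G.IsLocallyQuartic)
    {c d : Fin 4} (hc : c ≠ 0) (hd : d ≠ 0) {z : G.Node} (hz : G.nb c z ≠ G.nb d z)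
    {k : Fin 4} (hk : k ≠ 0) {w : G.Node}
    (hw : w = z ∨ w = G.nb c z ∨ w = G.nb d z ∨ w = G.nb c (G.nb d z)) :
    G.nb k w = z ∨ G.nb k w = G.nb c z ∨ G.nb k w = G.nb d z ∨ G.nb k w = G.nb c (G.nb d z) := by
  have hk' := h.mem c d k hc hd hk z hz
  have h1 := h.comm k c hk hc
  have h2 := h.comm k d hk hd
  have h3 := h.comm c d hc hd
  rcases hw with rfl | rfl | rfl | rfl
  · tauto
  · rw [h1]
    rcases hk' with e | e | e <;> simp [e, G.nb_nb]
  · rw [h2]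
    rcases hk' with e | e | e <;> simp [e, G.nb_nb, h3]
  · rw [h1, h2]
    rcases hk' with e | e | e <;> simp [e, G.nb_nb, h3]

theorem IsLocallyQuartic.isQuartic {G : ColoredGraph.{u}} (h : G.IsLocallyQuartic) :
    G.IsQuartic := by
  classical
  intro b
  induction b using Quot.ind with | _ z
  obtain ⟨c, d, hc, hd, hz⟩ := h.exists_ne z
  refine Eq.trans ?_ (G.card_square hz)
  have := G.ncard_component (S := {c | c ≠ 0}) z
  rw [G.filter_component_eq z {z, G.nb c z, G.nb d z, G.nb c (G.nb d z)} (by simp)] at this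
  · exact this
  · intro k hk w hw
    simp only [Finset.mem_insert, Finset.mem_singleton] at hw ⊢
    exact h.nb_mem_square hc hd hz hk hw
  · have hc' : ∀ z, G.component {c | c ≠ 0} (G.nb c z) = G.component {c | c ≠ 0} z :=
      G.component_nb hc
    have hd' : ∀ z, G.component {c | c ≠ 0} (G.nb d z) = G.component {c | c ≠ 0} z :=
      G.component_nb hd
    intro w hw
    simp only [Finset.mem_insert, Finset.mem_singleton] at hw
    rcases hw with rfl | rfl | rfl | rfl <;> simp [hc', hd']

/-! ### The degree in terms of two-colored components -/

/-- The number of pairs of parallel bubble edges, counted at the nodes. -/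
noncomputable def parSum (G : ColoredGraph.{u}) : ℕ :=
  G.numPar 1 2 + G.numPar 1 3 + G.numPar 2 3

theorem numFaces_eq (G : ColoredGraph.{u}) :
    G.numFaces = G.numComp {0, 1} + G.numComp {0, 2} + G.numComp {0, 3} := by
  simp only [numFaces, Fin.sum_univ_three]
  rfl

/-- Each component of the two remaining colors lies in exactly one bubble, so the local counts add
up to a global one. -/
theorem sum_bubbleComponents (G : ColoredGraph.{u}) [Fintype G.Bubble] (ℓ : Fin 3) :
    ∑ b : G.Bubble, G.bubbleComponents b ℓ = G.numComp {c | c ≠ 0 ∧ c ≠ ℓ.succ} := by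
  classical
  have : Fintype (G.Component {c | c ≠ 0 ∧ c ≠ ℓ.succ}) := Fintype.ofFinite _
  let φ : G.Component {c | c ≠ 0 ∧ c ≠ ℓ.succ} → G.Bubble :=
    Quot.lift (G.component _) (by
      rintro a b ⟨c, hc, rfl⟩; exact (G.component_nb hc.1 a).symm)
  rw [numComp, Nat.card_eq_fintype_card, ← Finset.card_univ,
    Finset.card_eq_sum_card_fiberwise (f := φ) (t := Finset.univ) (by simp)]
  refine Finset.sum_congr rfl fun b _ => ?_
  rw [bubbleComponents, ← Set.ncard_coe_finset]
  congr 1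
  ext k
  simp only [Set.mem_ofPred_eq, Finset.coe_filter, Finset.mem_univ, true_and]
  constructor
  · rintro ⟨x, rfl, hx⟩
    exact hx
  · induction k using Quot.ind with | _ x
    intro hx
    exact ⟨x, rfl, hx⟩

/-- With L = N/2 lines and B = N/4 bubbles, the term 3L/2 = 3B cancels the constant parts of `3/2 -
rho`, and only the two-colored components survive. -/
theorem degree_eq_numComp {G : ColoredGraph.{u}} (h : G.IsQuartic) :
    G.degree = 3 + ((G.numComp {2, 3} : ℚ) + G.numComp {1, 3} + G.numComp {1, 2}) / 2
      - G.numFaces := by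
  classical
  have : Fintype G.Bubble := Fintype.ofFinite _
  have hL : 2 * G.numLines = Nat.card G.Node := G.two_mul_numComp_singleton 0
  have hB : Nat.card G.Node = 4 * Nat.card G.Bubble := by
    have := G.sum_eq_mul_numComp {c | c ≠ 0} (fun _ => 1) 4 (fun x => by
      rw [Finset.sum_const, smul_eq_mul, mul_one, ← ncard_component]
      exact h (G.component _ x))
    rwa [Finset.sum_const, smul_eq_mul, mul_one, Finset.card_univ,
      ← Nat.card_eq_fintype_card] at this
  have e0 : {c : Fin 4 | c ≠ 0 ∧ c ≠ (0 : Fin 3).succ} = {2, 3} := by ext c; revert c; decide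
  have e1 : {c : Fin 4 | c ≠ 0 ∧ c ≠ (1 : Fin 3).succ} = {1, 3} := by ext c; revert c; decide
  have e2 : {c : Fin 4 | c ≠ 0 ∧ c ≠ (2 : Fin 3).succ} = {1, 2} := by ext c; revert c; decide
  have s0 := G.sum_bubbleComponents 0
  have s1 := G.sum_bubbleComponents 1
  have s2 := G.sum_bubbleComponents 2
  rw [e0] at s0; rw [e1] at s1; rw [e2] at s2
  rw [degree, finsum_eq_sum_of_fintype, Finset.sum_sub_distrib, ← s0, ← s1, ← s2]
  simp only [rho, Fin.sum_univ_three, ← Finset.mul_sum, Finset.sum_add_distrib,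
    Finset.sum_sub_distrib, Finset.sum_const, Finset.card_univ, nsmul_eq_mul,
    ← Nat.card_eq_fintype_card]
  have hL' : 2 * (G.numLines : ℚ) = Nat.card G.Node := by exact_mod_cast hL
  have hB' : (Nat.card G.Node : ℚ) = 4 * Nat.card G.Bubble := by exact_mod_cast hB
  rw [Nat.card_eq_fintype_card (α := Fin 3), Fintype.card_fin]
  push_cast
  linarith

/-- The form in which surgeries are compared: only the nodes, the parallel bubble edges and the
faces have to be followed. -/
theorem degree_eq {G : ColoredGraph.{u}} (h : G.IsQuartic) :
    G.degree = 3 + (3 * (Nat.card G.Node : ℚ) + G.parSum) / 8 - G.numFaces := by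
  have hc := h.isLocallyQuartic.comm
  have h0 := G.four_mul_numComp_pair 2 3 (hc 2 3 (by decide) (by decide))
  have h1 := G.four_mul_numComp_pair 1 3 (hc 1 3 (by decide) (by decide))
  have h2 := G.four_mul_numComp_pair 1 2 (hc 1 2 (by decide) (by decide))
  have h0' : 4 * (G.numComp {2, 3} : ℚ) = Nat.card G.Node + G.numPar 2 3 := by exact_mod_cast h0
  have h1' : 4 * (G.numComp {1, 3} : ℚ) = Nat.card G.Node + G.numPar 1 3 := by exact_mod_cast h1
  have h2' : 4 * (G.numComp {1, 2} : ℚ) = Nat.card G.Node + G.numPar 1 2 := by exact_mod_cast h2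
  rw [degree_eq_numComp h, parSum]
  push_cast
  linarith

/-- Together with positivity, half-integrality leaves 0 + 1/2 as the only splitting of 1/2. -/
theorem exists_degree_eq_half {G : ColoredGraph.{u}} (h : G.IsQuartic) :
    ∃ m : ℤ, G.degree = m / 2 :=
  ⟨6 + (G.numComp {2, 3} + G.numComp {1, 3} + G.numComp {1, 2}) - 2 * G.numFaces, by
    rw [degree_eq_numComp h]; push_cast; ring⟩

/-! ### Isomorphisms -/

theorem Isomorphic.refl (G : ColoredGraph.{u}) : G.Isomorphic G := ⟨Equiv.refl _, fun _ _ => rfl⟩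

theorem Isomorphic.symm {G : ColoredGraph.{u}} {H : ColoredGraph.{v}} (h : G.Isomorphic H) :
    H.Isomorphic G := by
  obtain ⟨e, he⟩ := h
  exact ⟨e.symm, fun c x => by rw [Equiv.symm_apply_eq, he, Equiv.apply_symm_apply]⟩

theorem Isomorphic.trans {G : ColoredGraph.{u}} {H : ColoredGraph.{v}} {K : ColoredGraph.{w}}
    (h : G.Isomorphic H) (h' : H.Isomorphic K) : G.Isomorphic K := by
  obtain ⟨e, he⟩ := h
  obtain ⟨f, hf⟩ := h'
  exact ⟨e.trans f, fun c x => by simp [he, hf]⟩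

section
variable {G : ColoredGraph.{u}} {H : ColoredGraph.{v}}

theorem Isomorphic.card_eq (h : G.Isomorphic H) : Nat.card G.Node = Nat.card H.Node :=
  Nat.card_congr h.choose

theorem Isomorphic.numComp_eq (h : G.Isomorphic H) (S : Set (Fin 4)) :
    G.numComp S = H.numComp S := by
  obtain ⟨e, he⟩ := h
  refine Nat.card_congr (Quot.congr e fun a b => ?_)
  simp only [← he, e.apply_eq_iff_eq]

theorem Isomorphic.numPar_eq (h : G.Isomorphic H) (c d : Fin 4) :
    G.numPar c d = H.numPar c d := by
  obtain ⟨e, he⟩ := h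
  refine Nat.card_congr (e.subtypeEquiv fun a => ?_)
  simp only [← he, e.apply_eq_iff_eq]

theorem Isomorphic.connected (h : G.Isomorphic H) (hG : G.Connected) : H.Connected :=
  (h.numComp_eq Set.univ).symm.trans hG

theorem Isomorphic.isQuartic (h : G.Isomorphic H) (hG : G.IsQuartic) : H.IsQuartic := by
  obtain ⟨hc, hn, hm⟩ := hG.isLocallyQuartic
  obtain ⟨e, he⟩ := h.symm
  refine IsLocallyQuartic.isQuartic ⟨fun c d h1 h2 z => ?_, fun z => ?_,
    fun c d k h1 h2 h3 z hz => ?_⟩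
  · apply e.injective
    simp only [he, hc c d h1 h2]
  · obtain ⟨c, d, h1, h2, h3⟩ := hn (e z)
    exact ⟨c, d, h1, h2, fun h4 => h3 (by rw [← he, h4, he])⟩
  · have := hm c d k h1 h2 h3 (e z) (by rwa [← he, ← he, e.injective.ne_iff])
    simpa only [← he, e.apply_eq_iff_eq] using this

theorem Isomorphic.degree_eq (h : G.Isomorphic H) (hG : G.IsQuartic) : G.degree = H.degree := by
  rw [ColoredGraph.degree_eq hG, ColoredGraph.degree_eq (h.isQuartic hG), parSum, parSum,
    numFaces_eq, numFaces_eq]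
  simp only [h.card_eq, h.numComp_eq, h.numPar_eq]

theorem Isomorphic.isNLO (h : G.Isomorphic H) (hG : G.IsNLO) : H.IsNLO :=
  ⟨h.isQuartic hG.1, h.connected hG.2.1, (h.degree_eq hG.1).symm.trans hG.2.2⟩

end

theorem IsMelonic.of_isomorphic {G H : ColoredGraph.{u}} (h : G.Isomorphic H)
    (hG : G.IsMelonic) : H.IsMelonic := by
  cases hG with
  | baseI e => exact .baseI (h.symm.trans e)
  | baseII ℓ e => exact .baseII ℓ (h.symm.trans e)
  | stepI hG x k e => exact .stepI hG x k (h.symm.trans e)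
  | stepII hG ℓ x k e => exact .stepII hG ℓ x k (h.symm.trans e)

/-! ### Parity -/

theorem even_card_of_closed (G : ColoredGraph.{u}) (c : Fin 4) (A : Finset G.Node)
    (hA : ∀ z ∈ A, G.nb c z ∈ A) : Even A.card := by
  have h : ∑ _z ∈ A, (1 : ZMod 2) = 0 :=
    Finset.sum_involution (fun z _ => G.nb c z) (fun _ _ => by decide)
      (fun z _ _ => G.nb_ne c z) (fun z hz => hA z hz) (fun z _ => G.nb_nb c z)
  rw [Finset.sum_const, nsmul_eq_mul, mul_one] at h
  exact (ZMod.natCast_eq_zero_iff_even).mp h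

/-- A set of nodes that is closed under a color `d ≠ 0`, and closed under the color `0` except
possibly at the ends of one line, contains both ends of this line or none. -/
theorem nb_zero_mem_of_closed (G : ColoredGraph.{u}) {d : Fin 4} {x : G.Node}
    {A : Set G.Node} (hA : ∀ z ∈ A, G.nb d z ∈ A)
    (h0 : ∀ z ∈ A, z ≠ x → z ≠ G.nb 0 x → G.nb 0 z ∈ A) (hx : x ∈ A) : G.nb 0 x ∈ A := by
  classical
  by_contra hx'
  -- Color `d` pairs off the nodes of `A`, and color `0` would pair off those of `A` without `x`:
  -- two consecutive numbers cannot both be even.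
  have h1 := G.even_card_of_closed d A.toFinset (by simpa using hA)
  have h2 := G.even_card_of_closed 0 (A.toFinset.erase x) (by
    intro z hz
    simp only [Finset.mem_erase, Set.mem_toFinset] at hz ⊢
    refine ⟨fun e => hx' ?_, h0 z hz.2 hz.1 fun e => hx' (e ▸ hz.2)⟩
    rw [← e, G.nb_nb]; exact hz.2)
  rw [Finset.card_erase_of_mem (by simpa using hx)] at h2
  have h3 : 0 < A.toFinset.card := Finset.card_pos.mpr ⟨x, by simpa using hx⟩
  rw [Nat.even_iff] at h1 h2
  omega

/-! ### Insertions -/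

/-- The nodes of `G` as nodes of an insertion in `G`. -/
def insertInl {G : ColoredGraph.{u}} {x : G.Node} {H : ColoredGraph.{v}} {h : H.Node}
    (z : G.Node) : (G.insert x H h).Node := Sum.inl z

/-- The nodes of `H` as nodes of an insertion of `H`. -/
def insertInr {G : ColoredGraph.{u}} {x : G.Node} {H : ColoredGraph.{v}} {h : H.Node}
    (z : H.Node) : (G.insert x H h).Node := Sum.inr z

section insert
variable (G : ColoredGraph.{u}) (x : G.Node) (H : ColoredGraph.{v}) (h : H.Node)

theorem forall_insert {P : (G.insert x H h).Node → Prop} :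
    (∀ z, P z) ↔ (∀ z, P (insertInl z)) ∧ ∀ z, P (insertInr z) :=
  Sum.forall

theorem insertInl_inj {z w : G.Node} :
    (insertInl z : (G.insert x H h).Node) = insertInl w ↔ z = w :=
  Sum.inl_injective.eq_iff

theorem insertInr_inj {z w : H.Node} :
    (insertInr z : (G.insert x H h).Node) = insertInr w ↔ z = w :=
  Sum.inr_injective.eq_iff

theorem insert_nb_inl {c : Fin 4} (hc : c ≠ 0) (z : G.Node) :
    (G.insert x H h).nb c (insertInl z) = insertInl (G.nb c z) := by
  simp [insert, insertNb, hc, insertInl]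

theorem insert_nb_inr {c : Fin 4} (hc : c ≠ 0) (z : H.Node) :
    (G.insert x H h).nb c (insertInr z) = insertInr (H.nb c z) := by
  simp [insert, insertNb, hc, insertInr]

theorem insert_nb_zero_inl_self :
    (G.insert x H h).nb 0 (insertInl x) = insertInr h := by
  simp [insert, insertNb, insertInl, insertInr]

theorem insert_nb_zero_inl_nb :
    (G.insert x H h).nb 0 (insertInl (G.nb 0 x)) = insertInr (H.nb 0 h) := by
  simp [insert, insertNb, G.nb_ne, insertInl, insertInr]

theorem insert_nb_zero_inl {z : G.Node} (h1 : z ≠ x) (h2 : z ≠ G.nb 0 x) :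
    (G.insert x H h).nb 0 (insertInl z) = insertInl (G.nb 0 z) := by
  simp [insert, insertNb, h1, h2, insertInl]

theorem insert_nb_zero_inr_self :
    (G.insert x H h).nb 0 (insertInr h) = insertInl x := by
  simp [insert, insertNb, insertInl, insertInr]

theorem insert_nb_zero_inr_nb :
    (G.insert x H h).nb 0 (insertInr (H.nb 0 h)) = insertInl (G.nb 0 x) := by
  simp [insert, insertNb, H.nb_ne, insertInl, insertInr]

theorem insert_nb_zero_inr {z : H.Node} (h1 : z ≠ h) (h2 : z ≠ H.nb 0 h) :
    (G.insert x H h).nb 0 (insertInr z) = insertInr (H.nb 0 z) := by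
  simp [insert, insertNb, h1, h2, insertInr]

/-- A criterion for a map from an insertion to be compatible with the colored edges. -/
theorem insert_hom {K : ColoredGraph.{w}} (f : (G.insert x H h).Node → K.Node)
    (h1 : ∀ c, c ≠ 0 → ∀ z, f (insertInl (G.nb c z)) = K.nb c (f (insertInl z)))
    (h2 : ∀ c, c ≠ 0 → ∀ z, f (insertInr (H.nb c z)) = K.nb c (f (insertInr z)))
    (h3 : ∀ z, z ≠ x → z ≠ G.nb 0 x → f (insertInl (G.nb 0 z)) = K.nb 0 (f (insertInl z)))
    (h4 : ∀ z, z ≠ h → z ≠ H.nb 0 h → f (insertInr (H.nb 0 z)) = K.nb 0 (f (insertInr z)))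
    (h5 : f (insertInr h) = K.nb 0 (f (insertInl x)))
    (h6 : f (insertInr (H.nb 0 h)) = K.nb 0 (f (insertInl (G.nb 0 x)))) :
    ∀ c z, f ((G.insert x H h).nb c z) = K.nb c (f z) := by
  intro c
  by_cases hc : c = 0
  · subst hc
    rw [forall_insert]
    constructor
    · intro z
      by_cases e : z = x
      · rw [e, insert_nb_zero_inl_self, h5]
      · by_cases e' : z = G.nb 0 x
        · rw [e', insert_nb_zero_inl_nb, h6]
        · rw [insert_nb_zero_inl _ _ _ _ e e', h3 z e e']
    · intro z
      by_cases e : z = h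
      · rw [e, insert_nb_zero_inr_self, h5, K.nb_nb]
      · by_cases e' : z = H.nb 0 h
        · rw [e', insert_nb_zero_inr_nb, h6, K.nb_nb]
        · rw [insert_nb_zero_inr _ _ _ _ e e', h4 z e e']
  · rw [forall_insert]
    exact ⟨fun z => by rw [insert_nb_inl _ _ _ _ hc, h1 c hc],
      fun z => by rw [insert_nb_inr _ _ _ _ hc, h2 c hc]⟩

theorem card_insert : Nat.card (G.insert x H h).Node = Nat.card G.Node + Nat.card H.Node :=
  Nat.card_sum

theorem numPar_insert {c d : Fin 4} (hc : c ≠ 0) (hd : d ≠ 0) :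
    (G.insert x H h).numPar c d = G.numPar c d + H.numPar c d := by
  rw [numPar, numPar, numPar, ← Nat.card_sum]
  refine Nat.card_congr (Equiv.subtypeSum.trans (Equiv.sumCongr ?_ ?_))
  · refine Equiv.subtypeEquivRight fun z => ?_
    change (G.insert x H h).nb c (insertInl z) = (G.insert x H h).nb d (insertInl z) ↔ _
    rw [insert_nb_inl _ _ _ _ hc, insert_nb_inl _ _ _ _ hd, insertInl_inj]
  · refine Equiv.subtypeEquivRight fun z => ?_
    change (G.insert x H h).nb c (insertInr z) = (G.insert x H h).nb d (insertInr z) ↔ _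
    rw [insert_nb_inr _ _ _ _ hc, insert_nb_inr _ _ _ _ hd, insertInr_inj]

theorem parSum_insert : (G.insert x H h).parSum = G.parSum + H.parSum := by
  have h1 : (1 : Fin 4) ≠ 0 := by decide
  have h2 : (2 : Fin 4) ≠ 0 := by decide
  have h3 : (3 : Fin 4) ≠ 0 := by decide
  simp only [parSum, numPar_insert G x H h h1 h2, numPar_insert G x H h h1 h3,
    numPar_insert G x H h h2 h3]
  ring

variable {G H} in
theorem IsQuartic.insert (hG : G.IsQuartic) (hH : H.IsQuartic) :
    (G.insert x H h).IsQuartic := by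
  obtain ⟨c1, n1, m1⟩ := hG.isLocallyQuartic
  obtain ⟨c2, n2, m2⟩ := hH.isLocallyQuartic
  refine IsLocallyQuartic.isQuartic ⟨?_, ?_, ?_⟩
  · intro c d hc hd
    rw [forall_insert]
    refine ⟨fun z => ?_, fun z => ?_⟩
    · simp only [insert_nb_inl _ _ _ _ hc, insert_nb_inl _ _ _ _ hd, c1 c d hc hd]
    · simp only [insert_nb_inr _ _ _ _ hc, insert_nb_inr _ _ _ _ hd, c2 c d hc hd]
  · rw [forall_insert]
    refine ⟨fun z => ?_, fun z => ?_⟩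
    · obtain ⟨c, d, hc, hd, hz⟩ := n1 z
      refine ⟨c, d, hc, hd, ?_⟩
      rwa [insert_nb_inl _ _ _ _ hc, insert_nb_inl _ _ _ _ hd, Ne, insertInl_inj]
    · obtain ⟨c, d, hc, hd, hz⟩ := n2 z
      refine ⟨c, d, hc, hd, ?_⟩
      rwa [insert_nb_inr _ _ _ _ hc, insert_nb_inr _ _ _ _ hd, Ne, insertInr_inj]
  · intro c d k hc hd hk
    rw [forall_insert]
    refine ⟨fun z hz => ?_, fun z hz => ?_⟩
    · rw [insert_nb_inl _ _ _ _ hc, insert_nb_inl _ _ _ _ hd, Ne, insertInl_inj] at hz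
      simpa only [insert_nb_inl _ _ _ _ hc, insert_nb_inl _ _ _ _ hd, insert_nb_inl _ _ _ _ hk,
        insertInl_inj] using m1 c d k hc hd hk z hz
    · rw [insert_nb_inr _ _ _ _ hc, insert_nb_inr _ _ _ _ hd, Ne, insertInr_inj] at hz
      simpa only [insert_nb_inr _ _ _ _ hc, insert_nb_inr _ _ _ _ hd, insert_nb_inr _ _ _ _ hk,
        insertInr_inj] using m2 c d k hc hd hk z hz

variable {G x H h} in
/-- The restriction to `G` of a set of nodes that is closed in an insertion is closed in `G`. -/
theorem closed_inl {S : Set (Fin 4)} {d : Fin 4} (hd : d ≠ 0) (hdS : d ∈ S)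
    {A : Set (G.insert x H h).Node} (hA : ∀ c ∈ S, ∀ z ∈ A, (G.insert x H h).nb c z ∈ A) :
    ∀ c ∈ S, ∀ z ∈ {z | insertInl z ∈ A}, G.nb c z ∈ {z | insertInl z ∈ A} := by
  have hne : ∀ c ∈ S, c ≠ 0 → ∀ z ∈ {z | insertInl z ∈ A}, G.nb c z ∈ {z | insertInl z ∈ A} :=
    fun c hc hc0 z hz => by
      have := hA c hc _ hz
      rwa [insert_nb_inl _ _ _ _ hc0] at this
  intro c hc z hz
  by_cases hc0 : c = 0
  · subst hc0
    have h0 : ∀ z ∈ {z | insertInl z ∈ A}, z ≠ x → z ≠ G.nb 0 x →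
        G.nb 0 z ∈ {z | insertInl z ∈ A} := fun z hz h1 h2 => by
      have := hA 0 hc _ hz
      rwa [insert_nb_zero_inl _ _ _ _ h1 h2] at this
    -- The cut line of `G` is not a line of the insertion; parity still forces the trace of `A` to
    -- contain both of its ends or none.
    by_cases h1 : z = x
    · subst h1
      exact G.nb_zero_mem_of_closed (hne d hdS hd) h0 hz
    · by_cases h2 : z = G.nb 0 x
      · exact G.nb_zero_mem_of_closed (x := z) (hne d hdS hd)
          (fun w hw h3 h4 => h0 w hw (fun e => h4 (by rw [h2, G.nb_nb, e]))
            (fun e => h3 (e.trans h2.symm))) hz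
      · exact h0 z hz h1 h2
  · exact hne c hc hc0 z hz

/-- The natural bijection between the nodes of the two insertions of two graphs in each other. -/
def insertSwap : (G.insert x H h).Node ≃ (H.insert h G x).Node := Equiv.sumComm _ _

theorem insertSwap_inr (z : H.Node) : insertSwap G x H h (insertInr z) = insertInl z := rfl

theorem insertSwap_nb (c : Fin 4) (z : (G.insert x H h).Node) :
    insertSwap G x H h ((G.insert x H h).nb c z) = (H.insert h G x).nb c (insertSwap G x H h z) :=
  insert_hom G x H h (K := H.insert h G x) (insertSwap G x H h)
    (fun _ hc _ => (insert_nb_inr _ _ _ _ hc _).symm)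
    (fun _ hc _ => (insert_nb_inl _ _ _ _ hc _).symm)
    (fun _ h1 h2 => (insert_nb_zero_inr _ _ _ _ h1 h2).symm)
    (fun _ h1 h2 => (insert_nb_zero_inl _ _ _ _ h1 h2).symm)
    (insert_nb_zero_inr_self _ _ _ _).symm (insert_nb_zero_inr_nb _ _ _ _).symm c z

variable {G x H h} in
theorem closed_inr {S : Set (Fin 4)} {d : Fin 4} (hd : d ≠ 0) (hdS : d ∈ S)
    {A : Set (G.insert x H h).Node} (hA : ∀ c ∈ S, ∀ z ∈ A, (G.insert x H h).nb c z ∈ A) :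
    ∀ c ∈ S, ∀ z ∈ {z | insertInr z ∈ A}, H.nb c z ∈ {z | insertInr z ∈ A} :=
  closed_inl (G := H) (x := h) (H := G) (h := x) (A := insertSwap H h G x ⁻¹' A) hd hdS
    fun c hc z hz => by
      rw [Set.mem_preimage, insertSwap_nb]; exact hA c hc _ hz

variable {G H} in
theorem Connected.insert (hG : G.Connected) (hH : H.Connected) :
    (G.insert x H h).Connected := by
  rw [connected_iff]
  refine ⟨⟨insertInl x⟩, fun A hA hne => ?_⟩
  have f1 : ∀ z, insertInl z ∈ A → ∀ w, insertInl w ∈ A := fun z hz => by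
    have := hG.eq_univ (A := {z | insertInl z ∈ A})
      (fun c => closed_inl (S := Set.univ) (d := 1) (by decide) trivial (fun c _ => hA c) c trivial)
      ⟨z, hz⟩
    exact Set.eq_univ_iff_forall.mp this
  have f2 : ∀ z, insertInr z ∈ A → ∀ w, insertInr w ∈ A := fun z hz => by
    have := hH.eq_univ (A := {z | insertInr z ∈ A})
      (fun c => closed_inr (S := Set.univ) (d := 1) (by decide) trivial (fun c _ => hA c) c trivial)
      ⟨z, hz⟩
    exact Set.eq_univ_iff_forall.mp this
  have g1 : insertInl x ∈ A → insertInr h ∈ A := fun hx => by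
    have := hA 0 _ hx
    rwa [insert_nb_zero_inl_self] at this
  have g2 : insertInr h ∈ A → insertInl x ∈ A := fun hx => by
    have := hA 0 _ hx
    rwa [insert_nb_zero_inr_self] at this
  have key : insertInl x ∈ A := by
    obtain ⟨a, ha⟩ := hne
    revert a
    rw [forall_insert]
    exact ⟨fun z hz => f1 z hz x, fun z hz => g2 (f2 z hz h)⟩
  exact Set.eq_univ_of_forall ((forall_insert G x H h).mpr ⟨f1 x key, f2 h (g1 key)⟩)

/-! ### Faces and degree of an insertion -/

/-- By parity, invariance survives on both pieces with their cut lines restored. Each restriction is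
constant along its own cut line, so the two new lines impose the same single equation. -/
theorem mem_inv_insert {S : Set (Fin 4)} (h0 : 0 ∈ S) {d : Fin 4} (hd : d ≠ 0) (hdS : d ∈ S)
    (f : (G.insert x H h).Node → ZMod 2) :
    f ∈ (G.insert x H h).inv S ↔ ((fun z => f (insertInl z)) ∈ G.inv S ∧
      (fun z => f (insertInr z)) ∈ H.inv S ∧ f (insertInl x) = f (insertInr h)) := by
  constructor
  · intro hf
    have hcl : ∀ t, ∀ c ∈ S, ∀ z ∈ {z | f z = t}, (G.insert x H h).nb c z ∈ {z | f z = t} :=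
      fun t c hc z hz => (hf c hc z).trans hz
    refine ⟨fun c hc z => ?_, fun c hc z => ?_, ?_⟩
    · exact closed_inl hd hdS (hcl (f (insertInl z))) c hc z rfl
    · exact closed_inr hd hdS (hcl (f (insertInr z))) c hc z rfl
    · have := hf 0 h0 (insertInl x)
      rw [insert_nb_zero_inl_self] at this
      exact this.symm
  · rintro ⟨h1, h2, h3⟩ c hc
    by_cases hc0 : c = 0
    · subst hc0
      have h1' : ∀ z, f (insertInl (G.nb 0 z)) = f (insertInl z) := h1 0 h0
      have h2' : ∀ z, f (insertInr (H.nb 0 z)) = f (insertInr z) := h2 0 h0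
      rw [forall_insert]
      refine ⟨fun z => ?_, fun z => ?_⟩
      · by_cases e : z = x
        · rw [e, insert_nb_zero_inl_self, h3]
        · by_cases e' : z = G.nb 0 x
          · rw [e', insert_nb_zero_inl_nb, h1', h2', h3]
          · rw [insert_nb_zero_inl _ _ _ _ e e', h1']
      · by_cases e : z = h
        · rw [e, insert_nb_zero_inr_self, h3]
        · by_cases e' : z = H.nb 0 h
          · rw [e', insert_nb_zero_inr_nb, h1', h2', h3]
          · rw [insert_nb_zero_inr _ _ _ _ e e', h2']
    · rw [forall_insert]
      exact ⟨fun z => by rw [insert_nb_inl _ _ _ _ hc0]; exact h1 c hc z,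
        fun z => by rw [insert_nb_inr _ _ _ _ hc0]; exact h2 c hc z⟩

/-- Invariants of the insertion are the kernel of one nonzero functional on pairs of invariants, the
difference of the values at the two cut lines; this costs exactly one dimension. -/
theorem numComp_insert {S : Set (Fin 4)} (h0 : 0 ∈ S) {d : Fin 4} (hd : d ≠ 0) (hdS : d ∈ S) :
    (G.insert x H h).numComp S + 1 = G.numComp S + H.numComp S := by
  simp only [← finrank_inv]
  let l : (G.inv S × H.inv S) →ₗ[ZMod 2] ZMod 2 :=
    { toFun := fun p => p.1.1 x - p.2.1 h
      map_add' := fun p q => by simp; ring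
      map_smul' := fun a p => by simp; ring }
  have hl : Function.Surjective l := fun t => by
    refine ⟨⟨⟨fun _ => t, fun _ _ _ => rfl⟩, 0⟩, ?_⟩
    simp [l]
  have hmem := mem_inv_insert G x H h h0 hd hdS
  let e : (G.insert x H h).inv S ≃ₗ[ZMod 2] LinearMap.ker l :=
    { toFun := fun f => ⟨⟨⟨_, ((hmem f.1).mp f.2).1⟩, ⟨_, ((hmem f.1).mp f.2).2.1⟩⟩, by
          rw [LinearMap.mem_ker]
          exact sub_eq_zero.mpr ((hmem f.1).mp f.2).2.2⟩
      map_add' := fun f g => rfl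
      map_smul' := fun a f => rfl
      invFun := fun p => ⟨Sum.elim p.1.1.1 p.1.2.1,
        (hmem _).mpr ⟨p.1.1.2, p.1.2.2, sub_eq_zero.mp p.2⟩⟩
      left_inv := fun f => Subtype.ext (funext fun z => by rcases z with z | z <;> rfl)
      right_inv := fun p => rfl }
  rw [e.finrank_eq, ← Module.finrank_prod, ← LinearMap.finrank_range_add_finrank_ker l,
    LinearMap.range_eq_top.mpr hl, finrank_top, Module.finrank_self, add_comm]

variable {G H} in
/-- The degree is additive under insertion. -/
theorem degree_insert (hG : G.IsQuartic) (hH : H.IsQuartic) :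
    (G.insert x H h).degree = G.degree + H.degree := by
  have n1 := numComp_insert G x H h (S := {0, 1}) (d := 1) (by simp) (by decide) (by simp)
  have n2 := numComp_insert G x H h (S := {0, 2}) (d := 2) (by simp) (by decide) (by simp)
  have n3 := numComp_insert G x H h (S := {0, 3}) (d := 3) (by simp) (by decide) (by simp)
  -- One face of each of the three colors is lost, which compensates for the constant 3 occurring in
  -- both degrees.
  have n : (G.insert x H h).numFaces + 3 = G.numFaces + H.numFaces := by
    simp only [numFaces_eq]; omega
  have n' : ((G.insert x H h).numFaces : ℚ) + 3 = G.numFaces + H.numFaces := by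
    exact_mod_cast n
  rw [degree_eq hG, degree_eq hH, degree_eq (hG.insert x h hH), parSum_insert, card_insert]
  push_cast
  linarith

end insert

/-! ### Two-point subgraphs -/

section twoPoint
variable {G : ColoredGraph.{u}} {S : Set G.Node} {x y : G.Node}

theorem IsTwoPoint.swap (h : G.IsTwoPoint S x y) : G.IsTwoPoint S y x :=
  ⟨h.right_mem, h.left_mem, h.ne.symm, h.bubble_mem, fun z hz h1 h2 =>
    ⟨(h.line_mem z hz h2 h1).1, (h.line_mem z hz h2 h1).2.2, (h.line_mem z hz h2 h1).2.1⟩⟩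

theorem IsTwoPoint.nb_zero_left (h : G.IsTwoPoint S x y) (hx : G.nb 0 x ∈ S) : G.nb 0 x = y := by
  by_contra hy
  exact (h.line_mem _ hx (G.nb_ne 0 x) hy).2.1 (G.nb_nb 0 x)

/-- If the line at `x` stays in `S` it must end at `y`, and then no line leaves `S`. -/
theorem IsTwoPoint.eq_univ (hG : G.Connected) (h : G.IsTwoPoint S x y) (hx : G.nb 0 x ∈ S) :
    S = Set.univ := by
  have e := h.nb_zero_left hx
  refine hG.eq_univ (fun c z hz => ?_) ⟨x, h.left_mem⟩
  by_cases hc : c = 0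
  · subst hc
    by_cases h1 : z = x
    · rwa [h1]
    · by_cases h2 : z = y
      · rw [h2, ← e, G.nb_nb]; exact h.left_mem
      · exact (h.line_mem z hz h1 h2).1
  · exact h.bubble_mem c hc z hz

theorem IsTwoPoint.compl (hG : G.Connected) (h : G.IsTwoPoint S x y) (hS : S ≠ Set.univ) :
    G.IsTwoPoint Sᶜ (G.nb 0 x) (G.nb 0 y) where
  left_mem := fun hx => hS (h.eq_univ hG hx)
  right_mem := fun hx => hS (h.swap.eq_univ hG hx)
  ne := fun e => h.ne (G.nb_injective 0 e)
  bubble_mem c hc z hz hz' := hz (by simpa [G.nb_nb] using h.bubble_mem c hc _ hz')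
  line_mem z hz h1 h2 := by
    refine ⟨fun hz' => hz ?_, fun e => hz ?_, fun e => hz ?_⟩
    · have := (h.line_mem (G.nb 0 z) hz' (fun e => h1 (by rw [← e, G.nb_nb]))
        (fun e => h2 (by rw [← e, G.nb_nb]))).1
      rwa [G.nb_nb] at this
    · rw [G.nb_injective 0 e]; exact h.left_mem
    · rw [G.nb_injective 0 e]; exact h.right_mem

/-- The nodes of the closure of a `2`-point subgraph as nodes of `G`. -/
def closureVal (h : G.IsTwoPoint S x y) (z : (G.closure S x y h).Node) : G.Node := Subtype.val z

/-- The nodes of a `2`-point subgraph as nodes of its closure. -/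
def closureMk (h : G.IsTwoPoint S x y) (z : G.Node) (hz : z ∈ S) : (G.closure S x y h).Node :=
  Subtype.mk z hz

theorem closureVal_mk (h : G.IsTwoPoint S x y) (z : G.Node) (hz : z ∈ S) :
    closureVal h (closureMk h z hz) = z := rfl

theorem closureVal_injective (h : G.IsTwoPoint S x y) : Function.Injective (closureVal h) :=
  Subtype.val_injective

theorem closureVal_nb (h : G.IsTwoPoint S x y) {c : Fin 4} (hc : c ≠ 0)
    (z : (G.closure S x y h).Node) :
    closureVal h ((G.closure S x y h).nb c z) = G.nb c (closureVal h z) := by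
  simp [closure, closureNb, hc, closureVal]

theorem closure_nb_zero_left (h : G.IsTwoPoint S x y) :
    (G.closure S x y h).nb 0 (closureMk h x h.left_mem) = closureMk h y h.right_mem := by
  simp [closure, closureNb, closureMk]

theorem closureVal_nb_zero (h : G.IsTwoPoint S x y) (z : (G.closure S x y h).Node)
    (h1 : closureVal h z ≠ x) (h2 : closureVal h z ≠ y) :
    closureVal h ((G.closure S x y h).nb 0 z) = G.nb 0 (closureVal h z) := by
  unfold closureVal at h1 h2
  simp [closure, closureNb, h1, h2, closureVal]

theorem IsQuartic.closure (hG : G.IsQuartic) (h : G.IsTwoPoint S x y) :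
    (G.closure S x y h).IsQuartic := by
  obtain ⟨hc, hn, hm⟩ := hG.isLocallyQuartic
  have inj := closureVal_injective h
  refine IsLocallyQuartic.isQuartic ⟨fun c d h1 h2 z => ?_, fun z => ?_,
    fun c d k h1 h2 h3 z hz => ?_⟩
  · apply inj
    simp only [closureVal_nb h h1, closureVal_nb h h2, hc c d h1 h2]
  · obtain ⟨c, d, h1, h2, h3⟩ := hn (closureVal h z)
    refine ⟨c, d, h1, h2, fun h4 => h3 ?_⟩
    rw [← closureVal_nb h h1, h4, closureVal_nb h h2]
  · have e := hm c d k h1 h2 h3 (closureVal h z) (fun e => hz (inj (by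
      rwa [closureVal_nb h h1, closureVal_nb h h2])))
    simpa only [← closureVal_nb h h1, ← closureVal_nb h h2, ← closureVal_nb h h3,
      inj.eq_iff] using e

/-- A nonempty closed set of the closure that misses `x` also misses `y`, so it is closed in `G`,
which is absurd. Thus a closed set and its complement cannot both be nonempty, as both would contain
`x`. -/
theorem Connected.closure (hG : G.Connected) (h : G.IsTwoPoint S x y) :
    (G.closure S x y h).Connected := by
  have key : ∀ A : Set (G.closure S x y h).Node,
      (∀ c, ∀ z ∈ A, (G.closure S x y h).nb c z ∈ A) → A.Nonempty →
      closureMk h x h.left_mem ∈ A := by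
    intro A hA ⟨a, ha⟩
    by_contra hx
    have hy : closureMk h y h.right_mem ∉ A := fun hy => hx (by
      have := hA 0 _ hy
      rwa [← closure_nb_zero_left h, (G.closure S x y h).nb_nb] at this)
    have hne : ∀ w hw, closureMk h w hw ∉ A → ∀ z ∈ A, closureVal h z ≠ w := by
      rintro w hw hwA z hz rfl
      exact hwA hz
    have := hG.eq_univ (A := closureVal h '' A) (by
      rintro c - ⟨z, hz, rfl⟩
      refine ⟨_, hA c z hz, ?_⟩
      by_cases hc : c = 0
      · subst hc; exact closureVal_nb_zero h z (hne x _ hx z hz) (hne y _ hy z hz)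
      · exact closureVal_nb h hc z) ⟨_, a, ha, rfl⟩
    obtain ⟨z, hz, e⟩ := Set.eq_univ_iff_forall.mp this x
    exact hne x _ hx z hz e
  rw [connected_iff]
  refine ⟨⟨closureMk h x h.left_mem⟩, fun A hA hne => ?_⟩
  by_contra hAu
  refine key Aᶜ (fun c z hz hz' => hz ?_) (Set.nonempty_compl.mpr hAu) (key A hA hne)
  have := hA c _ hz'
  rwa [(G.closure S x y h).nb_nb] at this

/-- A graph with a proper `2`-point subgraph is an insertion. -/
theorem IsTwoPoint.isomorphic_insert (hG : G.Connected) (h : G.IsTwoPoint S x y)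
    (hS : S ≠ Set.univ) :
    G.Isomorphic ((G.closure Sᶜ _ _ (h.compl hG hS)).insert
      (closureMk (h.compl hG hS) _ (h.compl hG hS).left_mem)
      (G.closure S x y h) (closureMk h x h.left_mem)) := by
  classical
  have h' := h.compl hG hS
  apply Isomorphic.symm
  let e : ((G.closure Sᶜ _ _ h').insert (closureMk h' _ h'.left_mem)
      (G.closure S x y h) (closureMk h x h.left_mem)).Node ≃ G.Node :=
    (Equiv.sumComm _ _).trans (Equiv.Set.sumCompl S)
  have hl : ∀ z, e (insertInl z) = closureVal h' z := fun z => rfl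
  have hr : ∀ z, e (insertInr z) = closureVal h z := fun z => rfl
  refine ⟨e, insert_hom _ _ _ _ (K := G) e (fun c hc z => ?_) (fun c hc z => ?_)
    (fun z h1 h2 => ?_) (fun z h1 h2 => ?_) ?_ ?_⟩
  · rw [hl, hl, closureVal_nb h' hc]
  · rw [hr, hr, closureVal_nb h hc]
  · rw [closure_nb_zero_left] at h2
    rw [hl, hl, closureVal_nb_zero h']
    · exact fun e => h1 (closureVal_injective h' e)
    · exact fun e => h2 (closureVal_injective h' e)
  · rw [closure_nb_zero_left] at h2
    rw [hr, hr, closureVal_nb_zero h]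
    · exact fun e => h1 (closureVal_injective h e)
    · exact fun e => h2 (closureVal_injective h e)
  · rw [hl, hr, closureVal_mk, closureVal_mk, G.nb_nb]
  · rw [hl, hr, closure_nb_zero_left, closure_nb_zero_left, closureVal_mk, closureVal_mk, G.nb_nb]

theorem IsTwoPoint.card_closure_lt (h : G.IsTwoPoint S x y) (hS : S ≠ Set.univ) :
    Nat.card (G.closure S x y h).Node < Nat.card G.Node := by
  obtain ⟨a, ha⟩ := (Set.ne_univ_iff_exists_notMem S).mp hS
  exact Finite.card_subtype_lt ha

theorem IsTwoPoint.card_closure_compl_lt (hG : G.Connected) (h : G.IsTwoPoint S x y)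
    (hS : S ≠ Set.univ) :
    Nat.card (G.closure Sᶜ _ _ (h.compl hG hS)).Node < Nat.card G.Node :=
  Finite.card_subtype_lt (x := x) (fun hx => hx h.left_mem)

theorem IsTwoPoint.degree_eq_add (hG : G.Connected) (hq : G.IsQuartic)
    (h : G.IsTwoPoint S x y) (hS : S ≠ Set.univ) :
    G.degree = (G.closure Sᶜ _ _ (h.compl hG hS)).degree + (G.closure S x y h).degree := by
  rw [(h.isomorphic_insert hG hS).degree_eq hq, degree_insert _ _ (hq.closure _) (hq.closure _)]

/-- A `2`-point subgraph whose two legs are the two halves of a cut line has the closure `G`. -/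
theorem IsTwoPoint.isomorphic_of_eq_univ (h : G.IsTwoPoint S x y) (hS : S = Set.univ) :
    G.Isomorphic (G.closure S x y h) := by
  apply Isomorphic.symm
  have e := h.nb_zero_left (by rw [hS]; trivial)
  refine ⟨(Equiv.setCongr hS).trans (Equiv.Set.univ _), fun c z => ?_⟩
  change closureNb G x y c z.1 = G.nb c z.1
  unfold closureNb
  split_ifs with h1 h2
  · rw [h1.1, h1.2, e]
  · rw [h2.1, h2.2, ← e, G.nb_nb]
  · rfl

end twoPoint

/-- A graph is reducible if it has a `2`-point subgraph that does not contain all its nodes. -/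
def IsReducible (G : ColoredGraph.{u}) : Prop :=
  ∃ (S : Set G.Node) (x y : G.Node), G.IsTwoPoint S x y ∧ S ≠ Set.univ

/-! ### The Euler characteristic of a three-colored subgraph -/

section euler
variable (G : ColoredGraph.{u}) (a b c : Fin 4)

/-- Only the constant functions are invariant under the colors `a`, `b`, `c`. -/
def IsConnectedBy : Prop := ∀ A : Set G.Node, (∀ z ∈ A, G.nb a z ∈ A) → (∀ z ∈ A, G.nb b z ∈ A) →
  (∀ z ∈ A, G.nb c z ∈ A) → A.Nonempty → A = Set.univ

/-- Functions on the faces with colors in `{a, b, c}`. -/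
abbrev FaceFun := G.inv {a, b} × G.inv {b, c} × G.inv {c, a}

/-- Functions on the edges with colors in `{a, b, c}`. -/
abbrev EdgeFun := G.inv {a} × G.inv {b} × G.inv {c}

/-- The boundary map from faces to edges, with coefficients in the field with two elements. -/
def faceBoundary : G.FaceFun a b c →ₗ[ZMod 2] G.EdgeFun a b c where
  toFun p :=
    (⟨p.1.1 + p.2.2.1, (G.inv {a}).add_mem (G.inv_anti (by simp) p.1.2)
        (G.inv_anti (by simp) p.2.2.2)⟩,
      ⟨p.1.1 + p.2.1.1, (G.inv {b}).add_mem (G.inv_anti (by simp) p.1.2)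
        (G.inv_anti (by simp) p.2.1.2)⟩,
      ⟨p.2.1.1 + p.2.2.1, (G.inv {c}).add_mem (G.inv_anti (by simp) p.2.1.2)
        (G.inv_anti (by simp) p.2.2.2)⟩)
  map_add' p q := by
    refine Prod.ext ?_ (Prod.ext ?_ ?_) <;> apply Subtype.ext <;> simp <;> abel
  map_smul' t p := by
    refine Prod.ext ?_ (Prod.ext ?_ ?_) <;> apply Subtype.ext <;> simp

/-- The boundary map from edges to nodes, with coefficients in the field with two elements. -/
def edgeBoundary : G.EdgeFun a b c →ₗ[ZMod 2] (G.Node → ZMod 2) where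
  toFun p := p.1.1 + p.2.1.1 + p.2.2.1
  map_add' p q := by simp; abel
  map_smul' t p := by simp

theorem range_faceBoundary_le :
    LinearMap.range (G.faceBoundary a b c) ≤ LinearMap.ker (G.edgeBoundary a b c) := by
  rintro - ⟨p, rfl⟩
  rw [LinearMap.mem_ker]
  funext z
  have h2 : ∀ s t r : ZMod 2, s + r + (s + t) + (t + r) = 0 := by decide
  exact h2 _ _ _

-- In a kernel element the two faces at each edge carry the same value, so its three components are
-- one function, invariant under all three colors and hence constant.
variable {a b c} in
theorem finrank_ker_faceBoundary_le (h : G.IsConnectedBy a b c) :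
    Module.finrank (ZMod 2) (LinearMap.ker (G.faceBoundary a b c)) ≤ 1 := by
  rcases isEmpty_or_nonempty G.Node with hG | ⟨⟨x⟩⟩
  · have : Subsingleton (LinearMap.ker (G.faceBoundary a b c)) := by
      refine ⟨fun p q => Subtype.ext (Prod.ext ?_ (Prod.ext ?_ ?_))⟩ <;>
      exact Subtype.ext (funext fun z => (hG.false z).elim)
    rw [Module.finrank_zero_of_subsingleton]; exact zero_le_one
  · have hinj : Function.Injective
        ({ toFun := fun p => p.1.1.1 x
           map_add' := fun p q => rfl
           map_smul' := fun t p => rfl } :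
          LinearMap.ker (G.faceBoundary a b c) →ₗ[ZMod 2] ZMod 2) := by
      rw [← LinearMap.ker_eq_bot, LinearMap.ker_eq_bot']
      rintro ⟨⟨⟨f, hf⟩, ⟨g, hg⟩, ⟨k, hk⟩⟩, hp⟩ (h0 : f x = 0)
      rw [LinearMap.mem_ker] at hp
      have e1 : f + k = 0 := congrArg (fun q : G.EdgeFun a b c => q.1.1) hp
      have e2 : f + g = 0 := congrArg (fun q : G.EdgeFun a b c => q.2.1.1) hp
      have hneg : ∀ s t : ZMod 2, s + t = 0 → t = s := by decide
      have hk' : k = f := funext fun z => hneg _ _ (congrFun e1 z)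
      have hg' : g = f := funext fun z => hneg _ _ (congrFun e2 z)
      subst hk' hg'
      have hu := h {z | g z = 0} (fun z hz => (hf a (by simp) z).trans hz)
        (fun z hz => (hf b (by simp) z).trans hz) (fun z hz => (hg c (by simp) z).trans hz) ⟨x, h0⟩
      have hk0 : g = 0 := funext fun z => (Set.eq_univ_iff_forall.mp hu z)
      subst hk0
      rfl
    simpa using LinearMap.finrank_le_finrank_of_injective hinj

open Classical in
/-- The indicator function of the edge of color `d` at `z`. -/
noncomputable def edgeInd (d : Fin 4) (z : G.Node) : G.inv {d} :=
  ⟨fun w => if w = z ∨ w = G.nb d z then 1 else 0, by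
    rintro e rfl w
    have : (G.nb e w = z ∨ G.nb e w = G.nb e z) ↔ (w = z ∨ w = G.nb e z) := by
      rw [G.nb_eq_comm, (G.nb_injective e).eq_iff, or_comm]
    simp only [this]⟩

open Classical in
theorem edgeInd_eq (d : Fin 4) (z : G.Node) :
    (G.edgeInd d z).1 = Pi.single z 1 + Pi.single (G.nb d z) 1 := by
  funext w
  have := G.nb_ne d z
  simp only [edgeInd, Pi.add_apply, Pi.single_apply]
  by_cases h1 : w = z
  · subst h1; simp [this.symm]
  · simp [h1]

-- The boundary of an edge is the sum of its two ends. Modulo the boundaries, all nodes are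
-- therefore equal by connectedness, and one node generates the quotient.
variable {a b c} in
theorem le_finrank_range_edgeBoundary (h : G.IsConnectedBy a b c) :
    Nat.card G.Node ≤ Module.finrank (ZMod 2) (LinearMap.range (G.edgeBoundary a b c)) + 1 := by
  classical
  rcases isEmpty_or_nonempty G.Node with hG | ⟨⟨x⟩⟩
  · simp
  set R := LinearMap.range (G.edgeBoundary a b c) with hR
  have ha : ∀ z, Pi.single z 1 + Pi.single (G.nb a z) 1 ∈ R := fun z =>
    ⟨(G.edgeInd a z, 0, 0), by simp [edgeBoundary, edgeInd_eq]⟩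
  have hb : ∀ z, Pi.single z 1 + Pi.single (G.nb b z) 1 ∈ R := fun z =>
    ⟨(0, G.edgeInd b z, 0), by simp [edgeBoundary, edgeInd_eq]⟩
  have hc : ∀ z, Pi.single z 1 + Pi.single (G.nb c z) 1 ∈ R := fun z =>
    ⟨(0, 0, G.edgeInd c z), by simp [edgeBoundary, edgeInd_eq]⟩
  set T := R ⊔ Submodule.span (ZMod 2) {(Pi.single x 1 : G.Node → ZMod 2)} with hT
  have step : ∀ d, (∀ z, Pi.single z 1 + Pi.single (G.nb d z) 1 ∈ R) →
      ∀ z ∈ {z | (Pi.single z 1 : G.Node → ZMod 2) ∈ T}, G.nb d z ∈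
        {z | (Pi.single z 1 : G.Node → ZMod 2) ∈ T} := fun d hd z hz => by
    have h1 := T.sub_mem (Submodule.mem_sup_left (hd z)) hz
    simpa using h1
  have hu := h {z | (Pi.single z 1 : G.Node → ZMod 2) ∈ T} (step a ha) (step b hb) (step c hc)
    ⟨x, Submodule.mem_sup_right (Submodule.mem_span_singleton_self _)⟩
  have htop : T = ⊤ := by
    rw [eq_top_iff]
    intro f _
    rw [← Finset.univ_sum_single f]
    refine T.sum_mem fun z _ => ?_
    have hz : (Pi.single z 1 : G.Node → ZMod 2) ∈ T := Set.eq_univ_iff_forall.mp hu z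
    have := T.smul_mem (f z) hz
    rwa [← Pi.single_smul, smul_eq_mul, mul_one] at this
  have h1 := Submodule.finrank_add_le_finrank_add_finrank R
    (Submodule.span (ZMod 2) {(Pi.single x 1 : G.Node → ZMod 2)})
  rw [← hT, htop, finrank_top, Module.finrank_fintype_fun_eq_card,
    ← Nat.card_eq_fintype_card] at h1
  rwa [finrank_span_singleton (by simp)] at h1

/-- A set of nodes containing one end of each edge of color `d`. -/
theorem exists_transversal (d : Fin 4) : ∃ T : Finset G.Node, ∀ z, G.nb d z ∈ T ↔ z ∉ T := by
  classical
  let e := Fintype.equivFin G.Node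
  -- The end with the smaller index in an arbitrary enumeration is chosen.
  refine ⟨Finset.univ.filter fun z => e z < e (G.nb d z), fun z => ?_⟩
  have := e.injective.ne (G.nb_ne d z)
  simp only [Finset.mem_filter, Finset.mem_univ, true_and, G.nb_nb, not_lt]
  exact ⟨le_of_lt, fun h => lt_of_le_of_ne h this⟩

/-- A set of representatives of the edges of color `d`. -/
noncomputable def edgeRep (d : Fin 4) : Finset G.Node := (G.exists_transversal d).choose

theorem nb_mem_edgeRep {d : Fin 4} {z : G.Node} : G.nb d z ∈ G.edgeRep d ↔ z ∉ G.edgeRep d :=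
  (G.exists_transversal d).choose_spec z

theorem two_mul_card_filter_edgeRep {d : Fin 4} {f : G.Node → ZMod 2}
    (hf : ∀ z, f (G.nb d z) = f z) :
    2 * ((G.edgeRep d).filter (f · = 1)).card = (Finset.univ.filter (f · = 1)).card := by
  classical
  have h1 : (Finset.univ.filter (f · = 1)) = (G.edgeRep d).filter (f · = 1) ∪
      ((G.edgeRep d).filter (f · = 1)).image (G.nb d) := by
    ext z
    simp only [Finset.mem_filter, Finset.mem_univ, true_and, Finset.mem_union, Finset.mem_image]
    constructor
    · intro hz
      by_cases h : z ∈ G.edgeRep d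
      · exact .inl ⟨h, hz⟩
      · exact .inr ⟨G.nb d z, ⟨G.nb_mem_edgeRep.mpr h, (hf z).trans hz⟩, G.nb_nb d z⟩
    · rintro (h | ⟨w, h, rfl⟩)
      · exact h.2
      · exact (hf w).trans h.2
  rw [h1, Finset.card_union_of_disjoint, Finset.card_image_of_injective _ (G.nb_injective d),
    two_mul]
  rw [Finset.disjoint_left]
  rintro z hz hz'
  simp only [Finset.mem_filter, Finset.mem_image] at hz hz'
  obtain ⟨w, hw, rfl⟩ := hz'
  exact G.nb_mem_edgeRep.mp hz.1 hw.1

theorem sum_edgeRep_eq (d : Fin 4) (f : G.Node → ZMod 2) :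
    ∑ z ∈ G.edgeRep d, f z = (((G.edgeRep d).filter (f · = 1)).card : ZMod 2) := by
  rw [Finset.card_filter, Nat.cast_sum]
  refine Finset.sum_congr rfl fun z _ => ?_
  have : ∀ t : ZMod 2, t = ((if t = 1 then 1 else 0 : ℕ) : ZMod 2) := by decide
  exact this _

/-- An invariant function has the same sum over the edges of two colors: faces have even length. -/
theorem sum_edgeRep_eq_sum_edgeRep {d e : Fin 4} {f : G.Node → ZMod 2} (hf : f ∈ G.inv {d, e}) :
    ∑ z ∈ G.edgeRep d, f z = ∑ z ∈ G.edgeRep e, f z := by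
  -- Both sides count edges with value 1, and either number is half the number of nodes with value
  -- 1.
  have h1 := G.two_mul_card_filter_edgeRep (hf d (by simp))
  have h2 := G.two_mul_card_filter_edgeRep (hf e (by simp))
  rw [sum_edgeRep_eq, sum_edgeRep_eq]
  congr 1
  omega

/-- The number of edges modulo two. -/
noncomputable def edgeCount : G.EdgeFun a b c →ₗ[ZMod 2] ZMod 2 where
  toFun p := ∑ z ∈ G.edgeRep a, p.1.1 z + ∑ z ∈ G.edgeRep b, p.2.1.1 z +
    ∑ z ∈ G.edgeRep c, p.2.2.1 z
  map_add' p q := by simp [Finset.sum_add_distrib]; ring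
  map_smul' t p := by simp [Finset.mul_sum, mul_add]

/-- The boundary of a face has equally many edges of its two colors, so each contribution occurs
twice and vanishes modulo two. -/
theorem range_faceBoundary_le_ker_edgeCount :
    LinearMap.range (G.faceBoundary a b c) ≤ LinearMap.ker (G.edgeCount a b c) := by
  rintro - ⟨⟨⟨f, hf⟩, ⟨g, hg⟩, ⟨k, hk⟩⟩, rfl⟩
  rw [LinearMap.mem_ker]
  simp only [edgeCount, faceBoundary, LinearMap.coe_mk, AddHom.coe_mk, Pi.add_apply,
    Finset.sum_add_distrib]
  rw [G.sum_edgeRep_eq_sum_edgeRep hf, G.sum_edgeRep_eq_sum_edgeRep hg,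
    G.sum_edgeRep_eq_sum_edgeRep hk]
  have : ∀ s t r : ZMod 2, s + t + (s + r) + (r + t) = 0 := by decide
  exact this _ _ _

theorem sum_edgeInd (d : Fin 4) (z : G.Node) : ∑ w ∈ G.edgeRep d, (G.edgeInd d z).1 w = 1 := by
  classical
  rw [edgeInd_eq]
  simp only [Pi.add_apply, Finset.sum_add_distrib, Finset.sum_pi_single', G.nb_mem_edgeRep]
  by_cases h : z ∈ G.edgeRep d <;> simp [h]

-- The face boundary has rank at least the number of faces minus 1. With 3N/2 edges and an edge
-- boundary of rank at least N - 1, the cycles have dimension at most N/2 + 1.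
variable {a b c} in
theorem finrank_boundary (h : G.IsConnectedBy a b c) :
    (G.numComp {a, b} + G.numComp {b, c} + G.numComp {c, a} ≤
      Module.finrank (ZMod 2) (LinearMap.range (G.faceBoundary a b c)) + 1) ∧
    2 * Module.finrank (ZMod 2) (LinearMap.ker (G.edgeBoundary a b c)) ≤ Nat.card G.Node + 2 := by
  have h1 := G.finrank_ker_faceBoundary_le h
  have h2 := G.le_finrank_range_edgeBoundary h
  have h3 := LinearMap.finrank_range_add_finrank_ker (G.faceBoundary a b c)
  have h4 := LinearMap.finrank_range_add_finrank_ker (G.edgeBoundary a b c)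
  simp only [Module.finrank_prod, finrank_inv] at h3 h4
  have ha := G.two_mul_numComp_singleton a
  have hb := G.two_mul_numComp_singleton b
  have hc := G.two_mul_numComp_singleton c
  omega

variable {a b c} in
/-- The Euler characteristic of a connected surface is at most two. -/
theorem two_mul_numComp_le (h : G.IsConnectedBy a b c) :
    2 * (G.numComp {a, b} + G.numComp {b, c} + G.numComp {c, a}) ≤ Nat.card G.Node + 4 := by
  have h1 := G.finrank_boundary h
  have h2 := Submodule.finrank_mono (G.range_faceBoundary_le a b c)
  omega

variable {a b c} in
/-- A connected planar three-colored graph is bipartite. -/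
theorem exists_bipartition (h : G.IsConnectedBy a b c)
    (he : 2 * (G.numComp {a, b} + G.numComp {b, c} + G.numComp {c, a}) = Nat.card G.Node + 4) :
    ∃ ε : G.Node → ZMod 2, (∀ z, ε (G.nb a z) = ε z + 1) ∧ (∀ z, ε (G.nb b z) = ε z + 1) ∧
      ∀ z, ε (G.nb c z) = ε z + 1 := by
  classical
  have h1 := G.finrank_boundary h
  have hle := G.range_faceBoundary_le a b c
  -- Equality in the Euler bound means vanishing first homology: every cycle is a sum of face
  -- boundaries.
  have heq := Submodule.eq_of_le_of_finrank_le hle (by omega)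
  -- Faces have even length, so the parity of the number of edges vanishes on cycles and factors
  -- through the edge boundary. The resulting functional on nodes has sum 1 over the two ends of
  -- each edge.
  have hmem : G.edgeCount a b c ∈ LinearMap.range (G.edgeBoundary a b c).dualMap := by
    rw [LinearMap.range_dualMap_eq_dualAnnihilator_ker, Submodule.mem_dualAnnihilator]
    intro p hp
    rw [← heq] at hp
    exact G.range_faceBoundary_le_ker_edgeCount a b c hp
  obtain ⟨ψ, hψ⟩ := hmem
  have hψ' : ∀ p, ψ (G.edgeBoundary a b c p) = G.edgeCount a b c p := fun p =>
    LinearMap.congr_fun hψ p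
  have hs : ∀ s t : ZMod 2, s + t = 1 → t = s + 1 := by decide
  refine ⟨fun z => ψ (Pi.single z 1), fun z => hs _ _ ?_, fun z => hs _ _ ?_,
    fun z => hs _ _ ?_⟩
  · have e1 : G.edgeBoundary a b c (G.edgeInd a z, 0, 0) = Pi.single z 1 + Pi.single (G.nb a z) 1 := by
      simp [edgeBoundary, edgeInd_eq]
    have e2 : G.edgeCount a b c (G.edgeInd a z, 0, 0) = 1 := by simp [edgeCount, sum_edgeInd]
    rw [← map_add, ← e1, hψ', e2]
  · have e1 : G.edgeBoundary a b c (0, G.edgeInd b z, 0) = Pi.single z 1 + Pi.single (G.nb b z) 1 := by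
      simp [edgeBoundary, edgeInd_eq]
    have e2 : G.edgeCount a b c (0, G.edgeInd b z, 0) = 1 := by simp [edgeCount, sum_edgeInd]
    rw [← map_add, ← e1, hψ', e2]
  · have e1 : G.edgeBoundary a b c (0, 0, G.edgeInd c z) = Pi.single z 1 + Pi.single (G.nb c z) 1 := by
      simp [edgeBoundary, edgeInd_eq]
    have e2 : G.edgeCount a b c (0, 0, G.edgeInd c z) = 1 := by simp [edgeCount, sum_edgeInd]
    rw [← map_add, ← e1, hψ', e2]

end euler

/-! ### Bypassing a set of nodes -/

/-- The condition under which the nodes in `R` can be removed, two half-edges of color `c` that end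
at the nodes `r` and `s r` of `R` being joined. -/
structure IsBypass (G : ColoredGraph.{u}) (R : Set G.Node) (s : Fin 4) : Prop where
  nb_mem : ∀ r ∈ R, G.nb s r ∈ R
  nb_notMem : ∀ r ∈ R, ∀ c, G.nb c r ∉ R → G.nb c (G.nb s r) ∉ R

section bypass
variable {G : ColoredGraph.{u}} {R : Set G.Node} {s : Fin 4}

open Classical in
/-- The color-`c` neighbor after removal of `R`. -/
noncomputable def bypassNb (G : ColoredGraph.{u}) (R : Set G.Node) (s c : Fin 4) (z : G.Node) :
    G.Node :=
  if G.nb c z ∈ R then G.nb c (G.nb s (G.nb c z)) else G.nb c z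

theorem IsBypass.bypassNb_notMem (h : G.IsBypass R s) (c : Fin 4) {z : G.Node} (hz : z ∉ R) :
    bypassNb G R s c z ∉ R := by
  unfold bypassNb
  split_ifs with h1
  · exact h.nb_notMem _ h1 c (by rwa [G.nb_nb])
  · exact h1

theorem IsBypass.bypassNb_bypassNb (h : G.IsBypass R s) (c : Fin 4) {z : G.Node} (hz : z ∉ R) :
    bypassNb G R s c (bypassNb G R s c z) = z := by
  by_cases h1 : G.nb c z ∈ R
  · simp [bypassNb, h1, G.nb_nb, h.nb_mem _ h1]
  · simp [bypassNb, h1, G.nb_nb, hz]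

theorem bypassNb_ne (c : Fin 4) (z : G.Node) : bypassNb G R s c z ≠ z := by
  unfold bypassNb
  split_ifs with h1
  · intro e
    exact G.nb_ne s _ ((G.nb_eq_comm c).mp e)
  · exact G.nb_ne c z

/-- The graph obtained from `G` by removal of the nodes in `R`, where the half-edges of color `c`
that end at the nodes `r` and `s r` of `R` are joined. -/
noncomputable def bypass (G : ColoredGraph.{u}) (R : Set G.Node) (s : Fin 4)
    (h : G.IsBypass R s) : ColoredGraph.{u} where
  Node := {z // z ∉ R}
  finite_node := inferInstance
  nb c z := ⟨bypassNb G R s c z, h.bypassNb_notMem c z.2⟩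
  nb_nb c z := Subtype.ext (h.bypassNb_bypassNb c z.2)
  nb_ne c z := fun e => bypassNb_ne c z.1 (congrArg Subtype.val e)

/-- The remaining nodes as nodes of `G`. -/
def bypassVal (h : G.IsBypass R s) (z : (G.bypass R s h).Node) : G.Node := Subtype.val z

/-- The nodes of `G` outside of `R` as nodes of the graph in which `R` is bypassed. -/
def bypassMk (h : G.IsBypass R s) (z : G.Node) (hz : z ∉ R) : (G.bypass R s h).Node :=
  Subtype.mk z hz

theorem bypassVal_mk (h : G.IsBypass R s) (z : G.Node) (hz : z ∉ R) :
    bypassVal h (bypassMk h z hz) = z := rfl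

theorem bypassVal_notMem (h : G.IsBypass R s) (z : (G.bypass R s h).Node) : bypassVal h z ∉ R :=
  Subtype.prop z

theorem bypassVal_injective (h : G.IsBypass R s) : Function.Injective (bypassVal h) :=
  Subtype.val_injective

theorem bypassVal_nb (h : G.IsBypass R s) {c : Fin 4} {z : (G.bypass R s h).Node}
    (hz : G.nb c (bypassVal h z) ∉ R) :
    bypassVal h ((G.bypass R s h).nb c z) = G.nb c (bypassVal h z) := by
  unfold bypassVal at hz
  simp [bypass, bypassNb, bypassVal, hz]

theorem bypassVal_nb_of_mem (h : G.IsBypass R s) {c : Fin 4} {z : (G.bypass R s h).Node}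
    (hz : G.nb c (bypassVal h z) ∈ R) :
    bypassVal h ((G.bypass R s h).nb c z) = G.nb c (G.nb s (G.nb c (bypassVal h z))) := by
  unfold bypassVal at hz
  simp [bypass, bypassNb, bypassVal, hz]

theorem card_bypass (h : G.IsBypass R s) :
    Nat.card (G.bypass R s h).Node + R.ncard = Nat.card G.Node := by
  rw [← Set.ncard_add_ncard_compl R, add_comm]
  rfl

/-- Functions are restricted to the remaining nodes. By `h1` they are still invariant along the
rejoined edges, and by `h2` nothing is lost. The freedom to take a smaller `U` allows for faces that
disappear or are reconnected. -/
theorem finrank_le_bypass (h : G.IsBypass R s) {S : Set (Fin 4)}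
    (U : Submodule (ZMod 2) (G.Node → ZMod 2)) (hU : U ≤ G.inv S)
    (h1 : ∀ f ∈ U, ∀ r ∈ R, f (G.nb s r) = f r)
    (h2 : ∀ f ∈ U, (∀ z ∉ R, f z = 0) → ∀ r ∈ R, f r = 0) :
    Module.finrank (ZMod 2) U ≤ (G.bypass R s h).numComp S := by
  rw [← finrank_inv]
  let φ : U →ₗ[ZMod 2] (G.bypass R s h).inv S :=
    { toFun := fun f => ⟨fun z => f.1 (bypassVal h z), fun c hc z => by
        have hf : ∀ z, f.1 (G.nb c z) = f.1 z := hU f.2 c hc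
        dsimp only
        by_cases hz : G.nb c (bypassVal h z) ∈ R
        · rw [bypassVal_nb_of_mem h hz, hf, h1 f.1 f.2 _ hz, hf]
        · rw [bypassVal_nb h hz, hf]⟩
      map_add' := fun f g => rfl
      map_smul' := fun a f => rfl }
  apply LinearMap.finrank_le_finrank_of_injective (f := φ)
  rw [← LinearMap.ker_eq_bot, LinearMap.ker_eq_bot']
  intro f hf
  have h0 : ∀ z ∉ R, f.1 z = 0 := fun z hz =>
    congrFun (congrArg Subtype.val hf) (bypassMk h z hz)
  refine Subtype.ext (funext fun z => ?_)
  by_cases hz : z ∈ R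
  · exact h2 f.1 f.2 h0 z hz
  · exact h0 z hz

theorem numComp_le_bypass (h : G.IsBypass R s) {S : Set (Fin 4)}
    (h1 : ∀ f ∈ G.inv S, ∀ r ∈ R, f (G.nb s r) = f r)
    (h2 : ∀ f ∈ G.inv S, (∀ z ∉ R, f z = 0) → ∀ r ∈ R, f r = 0) :
    G.numComp S ≤ (G.bypass R s h).numComp S := by
  rw [← G.finrank_inv]
  exact finrank_le_bypass h (G.inv S) le_rfl h1 h2

/-- Imposing one linear condition costs at most one dimension. -/
theorem numComp_le_bypass_add_one (h : G.IsBypass R s) {S : Set (Fin 4)}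
    (l : (G.Node → ZMod 2) →ₗ[ZMod 2] ZMod 2)
    (h1 : ∀ f ∈ G.inv S, l f = 0 → ∀ r ∈ R, f (G.nb s r) = f r)
    (h2 : ∀ f ∈ G.inv S, l f = 0 → (∀ z ∉ R, f z = 0) → ∀ r ∈ R, f r = 0) :
    G.numComp S ≤ (G.bypass R s h).numComp S + 1 := by
  have e1 := finrank_le_bypass h (S := S) (G.inv S ⊓ LinearMap.ker l) inf_le_left
    (fun f hf => h1 f hf.1 hf.2) (fun f hf => h2 f hf.1 hf.2)
  have e2 := LinearMap.finrank_range_add_finrank_ker l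
  have e3 := Submodule.finrank_sup_add_finrank_inf_eq (G.inv S) (LinearMap.ker l)
  have e4 := Submodule.finrank_le (G.inv S ⊔ LinearMap.ker l)
  have e5 := Submodule.finrank_le (LinearMap.range l)
  rw [Module.finrank_self] at e5
  rw [finrank_inv] at e3
  omega

open Classical in
theorem numPar_bypass (h : G.IsBypass R s) {c d : Fin 4} (hc : ∀ z ∉ R, G.nb c z ∉ R)
    (hd : ∀ z ∉ R, G.nb d z ∉ R) :
    (G.bypass R s h).numPar c d + {r ∈ R | G.nb c r = G.nb d r}.ncard = G.numPar c d := by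
  have e : (G.bypass R s h).numPar c d = {r | r ∉ R ∧ G.nb c r = G.nb d r}.ncard := by
    rw [numPar, ← Nat.card_coe_set_eq]
    refine Nat.card_congr ((Equiv.subtypeSubtypeEquivSubtypeInter (fun z => z ∉ R)
      (fun z => G.nb c z = G.nb d z)).symm.trans
        (Equiv.subtypeEquivRight fun z => ?_)).symm
    change G.nb c (bypassVal h z) = G.nb d (bypassVal h z) ↔ _
    rw [← bypassVal_nb h (hc _ (bypassVal_notMem h z)),
      ← bypassVal_nb h (hd _ (bypassVal_notMem h z)), (bypassVal_injective h).eq_iff]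
  rw [e, numPar, ← Set.ncard_union_eq]
  · rw [← Nat.card_coe_set_eq]
    congr 2
    ext z
    simp only [Set.mem_union, Set.mem_ofPred_eq]
    tauto
  · rw [Set.disjoint_left]
    exact fun z hz hz' => hz.1 hz'.1

end bypass

/-! ### Triples of bubble colors -/

/-- The three bubble colors in some order. -/
def IsColorTriple (i j k : Fin 4) : Prop :=
  i ≠ 0 ∧ j ≠ 0 ∧ k ≠ 0 ∧ i ≠ j ∧ i ≠ k ∧ j ≠ k

instance (i j k : Fin 4) : Decidable (IsColorTriple i j k) :=
  inferInstanceAs (Decidable (_ ∧ _))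

theorem IsColorTriple.cases : ∀ {i j k : Fin 4}, IsColorTriple i j k → ∀ c : Fin 4,
    c = 0 ∨ c = i ∨ c = j ∨ c = k := by decide

theorem exists_isColorTriple : ∀ {i j : Fin 4}, i ≠ 0 → j ≠ 0 → i ≠ j →
    ∃ k, IsColorTriple i j k := by decide

theorem IsColorTriple.eq : ∀ {i j k : Fin 4}, IsColorTriple i j k →
    (i = 1 ∧ j = 2 ∧ k = 3) ∨ (i = 1 ∧ j = 3 ∧ k = 2) ∨ (i = 2 ∧ j = 1 ∧ k = 3) ∨
    (i = 2 ∧ j = 3 ∧ k = 1) ∨ (i = 3 ∧ j = 1 ∧ k = 2) ∨ (i = 3 ∧ j = 2 ∧ k = 1) := by decide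

theorem IsColorTriple.numFaces_eq {i j k : Fin 4} (h : IsColorTriple i j k)
    (G : ColoredGraph.{u}) :
    G.numFaces = G.numComp {0, i} + G.numComp {0, j} + G.numComp {0, k} := by
  rw [ColoredGraph.numFaces_eq]
  rcases h.eq with ⟨rfl, rfl, rfl⟩ | ⟨rfl, rfl, rfl⟩ | ⟨rfl, rfl, rfl⟩ | ⟨rfl, rfl, rfl⟩ |
    ⟨rfl, rfl, rfl⟩ | ⟨rfl, rfl, rfl⟩ <;> ring

theorem IsColorTriple.parSum_eq {i j k : Fin 4} (h : IsColorTriple i j k)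
    (G : ColoredGraph.{u}) :
    G.parSum = G.numPar i j + G.numPar i k + G.numPar j k := by
  have h1 := G.numPar_comm 1 2
  have h2 := G.numPar_comm 1 3
  have h3 := G.numPar_comm 2 3
  rw [parSum]
  rcases h.eq with ⟨rfl, rfl, rfl⟩ | ⟨rfl, rfl, rfl⟩ | ⟨rfl, rfl, rfl⟩ | ⟨rfl, rfl, rfl⟩ |
    ⟨rfl, rfl, rfl⟩ | ⟨rfl, rfl, rfl⟩ <;> omega

/-! ### Bubbles in irreducible graphs -/

/-- The set of the four nodes `z`, `c z`, `d z`, `c (d z)`. -/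
def square (G : ColoredGraph.{u}) (c d : Fin 4) (z : G.Node) : Set G.Node :=
  {w | w = z ∨ w = G.nb c z ∨ w = G.nb d z ∨ w = G.nb c (G.nb d z)}

theorem ncard_square {G : ColoredGraph.{u}} {c d : Fin 4} {z : G.Node}
    (h : G.nb c z ≠ G.nb d z) : (G.square c d z).ncard = 4 := by
  classical
  rw [← G.card_square h, ← Set.ncard_coe_finset]
  congr 1
  ext w
  simp [square]

/-- In an irreducible graph, either all the lines at a bubble join it to other bubbles, or
the graph has only one bubble. -/
theorem lines_at_bubble {G : ColoredGraph.{u}} (hG : G.Connected) (hr : ¬ G.IsReducible)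
    (R : Finset G.Node) (hR : R.card = 4) (hb : ∀ c, c ≠ 0 → ∀ z ∈ R, G.nb c z ∈ R) :
    (∀ z ∈ R, G.nb 0 z ∉ R) ∨ (R : Set G.Node) = Set.univ := by
  classical
  by_contra! hcon
  obtain ⟨⟨r, hrR, hr0⟩, hne⟩ := hcon
  have hsub : ({r, G.nb 0 r} : Finset G.Node) ⊆ R := by
    intro w hw
    simp only [Finset.mem_insert, Finset.mem_singleton] at hw
    rcases hw with rfl | rfl <;> assumption
  have hcard : (R \ {r, G.nb 0 r}).card = 2 := by
    rw [Finset.card_sdiff_of_subset hsub, hR, Finset.card_pair (G.nb_ne 0 r).symm]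
  obtain ⟨p, q, hpq, hT⟩ := Finset.card_eq_two.mp hcard
  have hcases : ∀ w, w ∈ R ↔ (w = r ∨ w = G.nb 0 r) ∨ (w = p ∨ w = q) := by
    intro w
    have h1 := Finset.ext_iff.mp hT w
    have h2 := @hsub w
    simp only [Finset.mem_sdiff, Finset.mem_insert, Finset.mem_singleton] at h1 h2
    tauto
  have hp := (Finset.ext_iff.mp hT p).mpr (by simp)
  have hq := (Finset.ext_iff.mp hT q).mpr (by simp)
  simp only [Finset.mem_sdiff, Finset.mem_insert, Finset.mem_singleton, not_or] at hp hq
  have hout : ∀ {a b : G.Node}, (∀ w, w ∈ R ↔ (w = r ∨ w = G.nb 0 r) ∨ (w = a ∨ w = b)) →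
      a ≠ r → a ≠ G.nb 0 r → G.nb 0 a ∈ R → G.nb 0 a = b := by
    intro a b hw h1 h2 ha
    rcases (hw _).mp ha with (e | e) | (e | e)
    · exact absurd ((G.nb_eq_comm 0).mp e) h2
    · exact absurd (G.nb_injective 0 e) h1
    · exact absurd e (G.nb_ne 0 a)
    · exact e
  have hswap : ∀ w, w ∈ R ↔ (w = r ∨ w = G.nb 0 r) ∨ (w = q ∨ w = p) := fun w => by
    rw [hcases, or_comm (a := w = p)]
  -- One line has both ends in the bubble. The other two nodes are either joined to each other, and
  -- the bubble is the whole graph, or are the legs of a proper 2-point subgraph.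
  by_cases hp0 : G.nb 0 p ∈ R
  · have e := hout hcases hp.2.1 hp.2.2 hp0
    refine hne (hG.eq_univ (fun c z hz => ?_) ⟨r, hrR⟩)
    by_cases hc : c = 0
    · subst hc
      rcases (hcases z).mp hz with (rfl | rfl) | (rfl | rfl)
      · exact hr0
      · rwa [G.nb_nb]
      · exact hp0
      · rw [← e, G.nb_nb]; exact hp.1
    · exact hb c hc z hz
  · have hq0 : G.nb 0 q ∉ R := fun h => hp0 (by
      rw [← hout hswap hq.2.1 hq.2.2 h, G.nb_nb]; exact hq.1)
    refine hr ⟨R, p, q, ⟨hp.1, hq.1, hpq, hb, fun z hz h1 h2 => ?_⟩, hne⟩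
    rcases (hcases z).mp hz with (rfl | rfl) | (rfl | rfl)
    · exact ⟨hr0, fun e => hp.2.2 e.symm, fun e => hq.2.2 e.symm⟩
    · rw [G.nb_nb]
      exact ⟨hrR, fun e => hp.2.1 e.symm, fun e => hq.2.1 e.symm⟩
    · exact absurd rfl h1
    · exact absurd rfl h2

/-! ### Graphs with a single bubble -/

section four
variable {G : ColoredGraph.{u}}

theorem comm_of_card_eq_four (h4 : Nat.card G.Node = 4) (c d : Fin 4) (z : G.Node) :
    G.nb c (G.nb d z) = G.nb d (G.nb c z) := by
  classical
  by_cases e : G.nb c z = G.nb d z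
  · rw [← e, G.nb_nb, e, G.nb_nb]
  · have hu : ({z, G.nb c z, G.nb d z, G.nb c (G.nb d z)} : Finset G.Node) = Finset.univ := by
      rw [← Finset.card_eq_iff_eq_univ, G.card_square e, ← Nat.card_eq_fintype_card, h4]
    have := Finset.mem_univ (G.nb d (G.nb c z))
    rw [← hu] at this
    simp only [Finset.mem_insert, Finset.mem_singleton] at this
    rcases this with h1 | h1 | h1 | h1
    · exact absurd ((G.nb_eq_comm d).mp h1) e
    · exact absurd h1 (G.nb_ne d _)
    · exact absurd (G.nb_injective d h1) (G.nb_ne c z)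
    · exact h1.symm

theorem numPar_le (c d : Fin 4) : G.numPar c d ≤ Nat.card G.Node :=
  Finite.card_subtype_le _

theorem numPar_pos {c d : Fin 4} {z : G.Node} (h : G.nb c z = G.nb d z) : 0 < G.numPar c d := by
  have : Nonempty {z : G.Node // G.nb c z = G.nb d z} := ⟨⟨z, h⟩⟩
  exact Nat.card_pos

theorem eq_of_numPar_eq_card {c d : Fin 4} (h : G.numPar c d = Nat.card G.Node) (z : G.Node) :
    G.nb c z = G.nb d z := by
  by_contra hz
  exact (Finite.card_subtype_lt (p := fun z => G.nb c z = G.nb d z) hz).ne h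

/-- Two perfect matchings of four nodes coincide or have no common edge. -/
theorem numComp_pair_of_card_eq_four (h4 : Nat.card G.Node = 4) (c d : Fin 4) :
    (G.numComp {c, d} = 1 ∧ G.numPar c d = 0 ∧ ∀ z, G.nb c z ≠ G.nb d z) ∨
      (G.numComp {c, d} = 2 ∧ G.numPar c d = 4 ∧ ∀ z, G.nb c z = G.nb d z) := by
  have h1 := G.four_mul_numComp_pair c d (comm_of_card_eq_four h4 c d)
  have h2 := G.numPar_le c d
  rw [h4] at h1 h2
  by_cases h3 : G.numPar c d = 0
  · refine .inl ⟨by omega, h3, fun z hz => ?_⟩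
    have := numPar_pos hz
    omega
  · have h5 : G.numPar c d = 4 := by omega
    exact .inr ⟨by omega, h5, eq_of_numPar_eq_card (h5.trans h4.symm)⟩

/-- The graphs made of one pillow. -/
theorem degree_pillow {i j k : Fin 4} (ht : IsColorTriple i j k) (hq : G.IsQuartic)
    (h4 : Nat.card G.Node = 4) {x : G.Node} (hx : G.nb i x = G.nb j x) :
    0 ≤ G.degree ∧ (G.degree < 1 → ∀ z, G.nb 0 z = G.nb i z) := by
  have hk : G.nb k x ≠ G.nb i x := by
    intro hk
    obtain ⟨c, d, hc, hd, hne⟩ := hq.isLocallyQuartic.exists_ne x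
    have : ∀ c, c ≠ 0 → G.nb c x = G.nb i x := fun c hc => by
      rcases ht.cases c with rfl | rfl | rfl | rfl
      · exact absurd rfl hc
      · rfl
      · exact hx.symm
      · exact hk
    exact hne ((this c hc).trans (this d hd).symm)
  -- Here 3 + (12 + 4)/8 = 5, so the degree is 5 - F. Lines parallel to the double edges give F = 5;
  -- every other choice gives at most 4 faces.
  rw [degree_eq hq, ht.parSum_eq, ht.numFaces_eq, h4]
  obtain ⟨-, p1, q1⟩ := (numComp_pair_of_card_eq_four h4 i j).resolve_left fun h => h.2.2 x hx
  obtain ⟨-, p2, q2⟩ := (numComp_pair_of_card_eq_four h4 i k).resolve_right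
    fun h => hk (h.2.2 x).symm
  obtain ⟨-, p3, q3⟩ := (numComp_pair_of_card_eq_four h4 j k).resolve_right
    fun h => hk ((h.2.2 x).symm.trans hx.symm)
  rw [p1, p2, p3]
  rcases numComp_pair_of_card_eq_four h4 0 i with ⟨n1, -, r1⟩ | ⟨n1, -, r1⟩ <;>
  rcases numComp_pair_of_card_eq_four h4 0 j with ⟨n2, -, r2⟩ | ⟨n2, -, r2⟩ <;>
  rcases numComp_pair_of_card_eq_four h4 0 k with ⟨n3, -, r3⟩ | ⟨n3, -, r3⟩ <;>
  rw [n1, n2, n3]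
  · norm_num
  · norm_num
  · exact absurd ((r2 x).trans hx.symm) (r1 x)
  · exact absurd ((r2 x).trans hx.symm) (r1 x)
  · norm_num
  · exact absurd ((r3 x).symm.trans (r1 x)) hk
  · norm_num; exact r1
  · exact absurd ((r3 x).symm.trans (r1 x)) hk

end four

/-! ### Removal of a pillow -/

theorem IsQuartic.square_closed {G : ColoredGraph.{u}} (hq : G.IsQuartic) {i k : Fin 4}
    (hi : i ≠ 0) (hk : k ≠ 0) {x : G.Node} (hx : G.nb i x ≠ G.nb k x) :
    ∀ c, c ≠ 0 → ∀ z ∈ G.square i k x, G.nb c z ∈ G.square i k x :=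
  fun _ hc _ hz => hq.isLocallyQuartic.nb_mem_square hi hk hx hc hz

theorem IsQuartic.square_closed_compl {G : ColoredGraph.{u}} (hq : G.IsQuartic) {i k : Fin 4}
    (hi : i ≠ 0) (hk : k ≠ 0) {x : G.Node} (hx : G.nb i x ≠ G.nb k x) :
    ∀ c, c ≠ 0 → ∀ z ∉ G.square i k x, G.nb c z ∉ G.square i k x :=
  fun c hc z hz h => hz (by
    simpa [G.nb_nb] using hq.square_closed hi hk hx c hc _ h)

/-- In an irreducible graph, a pillow all of whose lines go to other bubbles can be removed,
and the degree decreases at least by one. -/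
theorem exists_remove_pillow {G : ColoredGraph.{u}} (hG : G.Connected) (hq : G.IsQuartic)
    (hr : ¬ G.IsReducible) {i j k : Fin 4} (ht : IsColorTriple i j k) {x : G.Node}
    (hx : G.nb i x = G.nb j x) (hk : G.nb i x ≠ G.nb k x)
    (hout : ∀ z ∈ G.square i k x, G.nb 0 z ∉ G.square i k x) :
    ∃ G' : ColoredGraph.{u}, G'.Connected ∧ G'.IsQuartic ∧ Nat.card G'.Node < Nat.card G.Node ∧
      G'.degree + 1 ≤ G.degree := by
  obtain ⟨hcomm, hene, hmem⟩ := hq.isLocallyQuartic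
  have hi := ht.1
  have hj := ht.2.1
  have hk0 := ht.2.2.1
  set R := G.square i k x with hR
  have hcl := hq.square_closed hi hk0 hk
  have hcl' := hq.square_closed_compl hi hk0 hk
  rw [← hR] at hcl hcl'
  have x1 : x ∈ R := .inl rfl
  have x2 : G.nb i x ∈ R := .inr (.inl rfl)
  have x3 : G.nb k x ∈ R := .inr (.inr (.inl rfl))
  have x4 : G.nb i (G.nb k x) ∈ R := .inr (.inr (.inr rfl))
  have hij : ∀ r ∈ R, G.nb j r = G.nb i r := by
    rintro r (rfl | rfl | rfl | rfl)
    · exact hx.symm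
    · rw [G.nb_nb, hx, G.nb_nb]
    · rw [hcomm j k hj hk0, ← hx, hcomm i k hi hk0]
    · rw [G.nb_nb, hcomm i k hi hk0, hcomm j k hj hk0, hx, G.nb_nb]
  have hik : ∀ r ∈ R, G.nb i r ≠ G.nb k r := by
    rintro r (rfl | rfl | rfl | rfl)
    · exact hk
    · rw [G.nb_nb]
      intro e
      exact hk ((G.nb_eq_comm k).mp e.symm)
    · rw [G.nb_nb]
      intro e
      exact hk ((G.nb_eq_comm i).mp e).symm
    · rw [G.nb_nb, ← hcomm i k hi hk0, G.nb_nb]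
      intro e
      exact hk e.symm
  -- The pillow is cut out along its double edges: the lines at `r` and at `nb i r` are joined.
  have hB : G.IsBypass R i := by
    refine ⟨fun r hr => hcl i hi r hr, fun r hr c hc => ?_⟩
    by_cases hc0 : c = 0
    · subst hc0
      exact hout _ (hcl i hi r hr)
    · exact absurd (hcl c hc0 r hr) hc
  have hval : ∀ c, c ≠ 0 → ∀ z, bypassVal hB ((G.bypass R i hB).nb c z) = G.nb c (bypassVal hB z) :=
    fun c hc z => bypassVal_nb hB (hcl' c hc _ (bypassVal_notMem hB z))
  have inj := bypassVal_injective hB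
  have hq' : (G.bypass R i hB).IsQuartic := by
    refine IsLocallyQuartic.isQuartic ⟨fun c d h1 h2 z => ?_, fun z => ?_,
      fun c d k h1 h2 h3 z hz => ?_⟩
    · apply inj
      simp only [hval c h1, hval d h2, hcomm c d h1 h2]
    · obtain ⟨c, d, h1, h2, h3⟩ := hene (bypassVal hB z)
      refine ⟨c, d, h1, h2, fun h4 => h3 ?_⟩
      rw [← hval c h1, h4, hval d h2]
    · have e := hmem c d k h1 h2 h3 (bypassVal hB z) (fun e => hz (inj (by
        rwa [hval c h1, hval d h2])))
      simpa only [← hval c h1, ← hval d h2, ← hval k h3, inj.eq_iff] using e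
  refine ⟨G.bypass R i hB, ?_, hq', ?_, ?_⟩
  -- If the removal disconnects the graph, the part reached from `x` is attached to the pillow only
  -- by the lines at `x` and `nb i x`; it is then a proper 2-point subgraph of `G`.
  · by_contra hnc
    rw [connected_iff] at hnc
    have hx0 : G.nb 0 x ∉ R := hout x x1
    have hline : ∀ r (hr : r ∈ R),
        (G.bypass R i hB).component Set.univ (bypassMk hB (G.nb 0 r) (hout r hr)) =
          (G.bypass R i hB).component Set.univ
            (bypassMk hB (G.nb 0 (G.nb i r)) (hout _ (hcl i hi r hr))) := by
      intro r hr
      rw [← (G.bypass R i hB).component_nb (Set.mem_univ 0) (bypassMk hB (G.nb 0 r) (hout r hr))]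
      congr 1
      apply inj
      rw [bypassVal_nb_of_mem hB (by rw [bypassVal_mk, G.nb_nb]; exact hr), bypassVal_mk,
        bypassVal_mk, G.nb_nb]
    push Not at hnc
    obtain ⟨B, hBcl, hBne, hBu⟩ := hnc ⟨bypassMk hB _ hx0⟩
    have hBcl' : ∀ c, ∀ z ∈ Bᶜ, (G.bypass R i hB).nb c z ∈ Bᶜ := fun c z hz hz' => hz (by
      have := hBcl c _ hz'
      rwa [(G.bypass R i hB).nb_nb] at this)
    obtain ⟨A, hA, hxA, hAu⟩ : ∃ A : Set (G.bypass R i hB).Node,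
        (∀ c, ∀ z ∈ A, (G.bypass R i hB).nb c z ∈ A) ∧
        bypassMk hB _ hx0 ∈ A ∧ A ≠ Set.univ := by
      by_cases hxB : bypassMk hB _ hx0 ∈ B
      · exact ⟨B, hBcl, hxB, hBu⟩
      · refine ⟨Bᶜ, hBcl', hxB, fun e => ?_⟩
        rw [Set.compl_univ_iff] at e
        exact hBne.ne_empty e
    have hbyp : ∀ r (hr : r ∈ R), bypassMk hB (G.nb 0 r) (hout r hr) ∈ A →
        bypassMk hB (G.nb 0 (G.nb i r)) (hout _ (hcl i hi r hr)) ∈ A := by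
      intro r hr h
      exact (G.bypass R i hB).mem_of_component_eq (S := Set.univ) (fun c _ => hA c)
        (hline r hr).symm h
    have m2 := hbyp x x1 hxA
    -- Otherwise `A` meets all four lines of the pillow, and `A` together with `R` is closed in `G`,
    -- hence everything.
    have m3 : bypassMk hB (G.nb 0 (G.nb k x)) (hout _ x3) ∉ A := by
      intro m3
      have m4 := hbyp _ x3 m3
      apply hAu
      have := hG.eq_univ (A := R ∪ bypassVal hB '' A) (by
        rintro c z (hz | ⟨w, hw, rfl⟩)
        · by_cases hc : c = 0
          · subst hc
            right
            rcases hz with rfl | rfl | rfl | rfl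
            · exact ⟨_, hxA, rfl⟩
            · exact ⟨_, m2, rfl⟩
            · exact ⟨_, m3, rfl⟩
            · exact ⟨_, m4, rfl⟩
          · exact .inl (hcl c hc z hz)
        · by_cases hz : G.nb c (bypassVal hB w) ∈ R
          · exact .inl hz
          · exact .inr ⟨_, hA c w hw, bypassVal_nb hB hz⟩) ⟨x, .inl x1⟩
      refine Set.eq_univ_of_forall fun w => ?_
      rcases Set.eq_univ_iff_forall.mp this (bypassVal hB w) with hw | ⟨w', hw, e⟩
      · exact absurd hw (bypassVal_notMem hB w)
      · rwa [← inj e]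
    have m4 : bypassMk hB (G.nb 0 (G.nb i (G.nb k x))) (hout _ x4) ∉ A := by
      intro m4
      apply m3
      have := hbyp _ x4 m4
      simpa only [G.nb_nb] using this
    refine hr ⟨bypassVal hB '' A, G.nb 0 x, G.nb 0 (G.nb i x), ⟨⟨_, hxA, rfl⟩, ⟨_, m2, rfl⟩,
      fun e => G.nb_ne i x (G.nb_injective 0 e).symm, ?_, ?_⟩, ?_⟩
    · rintro c hc - ⟨w, hw, rfl⟩
      exact ⟨_, hA c w hw, hval c hc w⟩
    · rintro - ⟨w, hw, rfl⟩ n1 n2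
      have hR0 : G.nb 0 (bypassVal hB w) ∉ R := by
        have hsub : ∀ r (hr : r ∈ R), bypassMk hB (G.nb 0 r) (hout r hr) ∉ A →
            G.nb 0 (bypassVal hB w) ≠ r := by
          rintro r hr hA' rfl
          apply hA'
          convert hw
          apply inj
          rw [bypassVal_mk, G.nb_nb]
        rintro (e | e | e | e)
        · exact n1 ((G.nb_eq_comm 0).mp e)
        · exact n2 ((G.nb_eq_comm 0).mp e)
        · exact hsub _ x3 m3 e
        · exact hsub _ x4 m4 e
      refine ⟨⟨_, hA 0 w hw, bypassVal_nb hB hR0⟩, fun e => ?_, fun e => ?_⟩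
      · exact bypassVal_notMem hB w (by rw [G.nb_injective 0 e]; exact x1)
      · exact bypassVal_notMem hB w (by rw [G.nb_injective 0 e]; exact x2)
    · intro e
      obtain ⟨w, -, hw⟩ := Set.eq_univ_iff_forall.mp e x
      exact bypassVal_notMem hB w (by rw [hw]; exact x1)
  · have := card_bypass hB
    have ncard4 : R.ncard = 4 := ncard_square hk
    omega
  · have c1 := card_bypass hB
    have ncard4 : R.ncard = 4 := ncard_square hk
    have p1 := numPar_bypass hB (hcl' i hi) (hcl' j hj)
    have p2 := numPar_bypass hB (hcl' i hi) (hcl' k hk0)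
    have p3 := numPar_bypass hB (hcl' j hj) (hcl' k hk0)
    have e1 : {r ∈ R | G.nb i r = G.nb j r} = R := by
      ext r; exact ⟨fun h => h.1, fun h => ⟨h, (hij r h).symm⟩⟩
    have e2 : {r ∈ R | G.nb i r = G.nb k r} = ∅ := by
      ext r
      simp only [Set.mem_ofPred_eq, Set.mem_empty_iff_false, iff_false, not_and]
      exact hik r
    have e3 : {r ∈ R | G.nb j r = G.nb k r} = ∅ := by
      ext r
      simp only [Set.mem_ofPred_eq, Set.mem_empty_iff_false, iff_false, not_and]
      intro h
      rw [hij r h]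
      exact hik r h
    rw [e1, ncard4] at p1
    rw [e2, Set.ncard_empty] at p2
    rw [e3, Set.ncard_empty] at p3
    have hzero : ∀ f : G.Node → ZMod 2, (∀ z, f (G.nb 0 z) = f z) → (∀ z ∉ R, f z = 0) →
        ∀ r ∈ R, f r = 0 := fun f hf h0 r hr => by
      rw [← hf]; exact h0 _ (hout r hr)
    have f1 : G.numComp {0, i} ≤ (G.bypass R i hB).numComp {0, i} :=
      numComp_le_bypass hB (fun f hf r _ => hf i (by simp) r)
        (fun f hf h0 => hzero f (hf 0 (by simp)) h0)
    have f2 : G.numComp {0, j} ≤ (G.bypass R i hB).numComp {0, j} :=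
      numComp_le_bypass hB (fun f hf r hr => by rw [← hij r hr]; exact hf j (by simp) r)
        (fun f hf h0 => hzero f (hf 0 (by simp)) h0)
    -- The edges of color `k` join the two double edges, so equal values at `x` and `nb i x` make
    -- the function constant on the pillow: one condition, hence at most one face lost.
    have f3 : G.numComp {0, k} ≤ (G.bypass R i hB).numComp {0, k} + 1 := by
      refine numComp_le_bypass_add_one hB
        (LinearMap.proj (R := ZMod 2) (φ := fun _ => ZMod 2) x - LinearMap.proj (G.nb i x)) ?_
        (fun f hf _ h0 => hzero f (hf 0 (by simp)) h0)
      intro f hf hl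
      have hl' : f x = f (G.nb i x) := sub_eq_zero.mp hl
      have hfk : ∀ z, f (G.nb k z) = f z := hf k (by simp)
      rintro r (rfl | rfl | rfl | rfl)
      · exact hl'.symm
      · rw [G.nb_nb, hl']
      · rw [hcomm i k hi hk0, hfk, hfk, hl']
      · rw [G.nb_nb, hcomm i k hi hk0, hfk, hfk, hl']
    have hF : (G.numFaces : ℚ) ≤ (G.bypass R i hB).numFaces + 1 := by
      have : G.numFaces ≤ (G.bypass R i hB).numFaces + 1 := by
        rw [ht.numFaces_eq, ht.numFaces_eq]; omega
      exact_mod_cast this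
    have hN : (Nat.card G.Node : ℚ) = Nat.card (G.bypass R i hB).Node + 4 := by
      rw [← c1, ncard4]; push_cast; rfl
    have hP : (G.parSum : ℚ) = (G.bypass R i hB).parSum + 4 := by
      have : G.parSum = (G.bypass R i hB).parSum + 4 := by
        rw [ht.parSum_eq, ht.parSum_eq]; omega
      exact_mod_cast this
    -- The term (3N + P)/8 drops by (12 + 4)/8 = 2, while F drops by at most 1.
    rw [degree_eq hq, degree_eq hq', hN, hP]
    linarith

/-- An irreducible graph with a pillow has degree at least one, or consists of this pillow. -/
theorem pillow_dichotomy {G : ColoredGraph.{u}} (hG : G.Connected) (hq : G.IsQuartic)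
    (hr : ¬ G.IsReducible) {i j : Fin 4} (hi : i ≠ 0) (hj : j ≠ 0) (hij : i ≠ j) {x : G.Node}
    (hx : G.nb i x = G.nb j x) :
    (∃ G' : ColoredGraph.{u}, G'.Connected ∧ G'.IsQuartic ∧ Nat.card G'.Node < Nat.card G.Node ∧
      G'.degree + 1 ≤ G.degree) ∨ Nat.card G.Node = 4 := by
  classical
  obtain ⟨k, ht⟩ := exists_isColorTriple hi hj hij
  have hk : G.nb i x ≠ G.nb k x := by
    intro hk
    obtain ⟨c, d, hc, hd, hne⟩ := hq.isLocallyQuartic.exists_ne x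
    have : ∀ c, c ≠ 0 → G.nb c x = G.nb i x := fun c hc => by
      rcases ht.cases c with rfl | rfl | rfl | rfl
      · exact absurd rfl hc
      · rfl
      · exact hx.symm
      · exact hk.symm
    exact hne ((this c hc).trans (this d hd).symm)
  have hmem : ∀ z, z ∈ ({x, G.nb i x, G.nb k x, G.nb i (G.nb k x)} : Finset G.Node) ↔
      z ∈ G.square i k x := fun z => by simp [square]
  rcases lines_at_bubble hG hr {x, G.nb i x, G.nb k x, G.nb i (G.nb k x)} (G.card_square hk)
    (fun c hc z hz => by
      rw [hmem] at hz ⊢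
      exact hq.square_closed hi ht.2.2.1 hk c hc z hz) with h | h
  · left
    refine exists_remove_pillow hG hq hr ht hx hk fun z hz => ?_
    rw [← hmem] at hz ⊢
    exact h z hz
  · right
    rw [← ncard_square hk, ← Set.ncard_univ, ← h]
    congr 1
    ext z
    exact hmem z

/-! ### Graphs whose bubbles are tetrahedra -/

/-- All the bubbles are tetrahedra. -/
def AllTetra (G : ColoredGraph.{u}) : Prop :=
  ∀ c d : Fin 4, c ≠ 0 → d ≠ 0 → c ≠ d → ∀ z, G.nb c z ≠ G.nb d z

section tetra
variable {G : ColoredGraph.{u}} {i j k : Fin 4}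

/-- The three matchings of a tetrahedron act as the involutions of the Klein four-group. -/
theorem AllTetra.nb_nb_eq (h : G.AllTetra) (hq : G.IsQuartic) (ht : IsColorTriple i j k)
    (z : G.Node) : G.nb i (G.nb j z) = G.nb k z := by
  obtain ⟨hi, hj, hk, hij, hik, hjk⟩ := ht
  rcases hq.isLocallyQuartic.mem i j k hi hj hk z (h i j hi hj hij z) with e | e | e
  · exact absurd e.symm (h i k hi hk hik z)
  · exact absurd e.symm (h j k hj hk hjk z)
  · exact e.symm

theorem AllTetra.numPar_eq_zero (h : G.AllTetra) {c d : Fin 4} (hc : c ≠ 0) (hd : d ≠ 0)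
    (hcd : c ≠ d) : G.numPar c d = 0 := by
  have : IsEmpty {z : G.Node // G.nb c z = G.nb d z} := ⟨fun z => h c d hc hd hcd z.1 z.2⟩
  exact Nat.card_of_isEmpty

theorem AllTetra.parSum_eq_zero (h : G.AllTetra) : G.parSum = 0 := by
  rw [parSum, h.numPar_eq_zero (by decide) (by decide) (by decide),
    h.numPar_eq_zero (by decide) (by decide) (by decide),
    h.numPar_eq_zero (by decide) (by decide) (by decide)]

/-- Color `k` is the composite of `i` and `j`, so dropping it does not disconnect: jackets are
connected. -/
theorem AllTetra.isConnectedBy (h : G.AllTetra) (hG : G.Connected) (hq : G.IsQuartic)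
    (ht : IsColorTriple i j k) : G.IsConnectedBy 0 i j := by
  intro A h0 hi hj hne
  refine hG.eq_univ (fun c z hz => ?_) hne
  rcases ht.cases c with rfl | rfl | rfl | rfl
  · exact h0 z hz
  · exact hi z hz
  · exact hj z hz
  · rw [← h.nb_nb_eq hq ht]
    exact hi _ (hj z hz)

theorem AllTetra.numComp_pair (h : G.AllTetra) (hq : G.IsQuartic) (ht : IsColorTriple i j k) :
    4 * G.numComp {i, j} = Nat.card G.Node := by
  have := G.four_mul_numComp_pair i j (hq.isLocallyQuartic.comm i j ht.1 ht.2.1)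
  rwa [h.numPar_eq_zero ht.1 ht.2.1 ht.2.2.2.1, add_zero] at this

/-- Euler bound for the jacket with colors `0`, `i`, `j`, in which each tetrahedron gives one face
of colors `i`, `j`. -/
theorem AllTetra.numComp_add_le (h : G.AllTetra) (hG : G.Connected) (hq : G.IsQuartic)
    (ht : IsColorTriple i j k) : 4 * (G.numComp {0, i} + G.numComp {0, j}) ≤ Nat.card G.Node + 8 := by
  have h1 := G.two_mul_numComp_le (h.isConnectedBy hG hq ht)
  have h2 := h.numComp_pair hq ht
  rw [Set.pair_comm j 0] at h1
  omega

theorem AllTetra.exists_bipartition (h : G.AllTetra) (hG : G.Connected) (hq : G.IsQuartic)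
    (ht : IsColorTriple i j k)
    (he : 4 * (G.numComp {0, i} + G.numComp {0, j}) = Nat.card G.Node + 8) :
    ∃ ε : G.Node → ZMod 2, (∀ z, ε (G.nb 0 z) = ε z + 1) ∧ (∀ z, ε (G.nb i z) = ε z + 1) ∧
      ∀ z, ε (G.nb j z) = ε z + 1 := by
  refine G.exists_bipartition (h.isConnectedBy hG hq ht) ?_
  have h2 := h.numComp_pair hq ht
  rw [Set.pair_comm j 0]
  omega

theorem AllTetra.degree_eq (h : G.AllTetra) (hq : G.IsQuartic) :
    G.degree = 3 + 3 * (Nat.card G.Node : ℚ) / 8 - G.numFaces := by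
  rw [ColoredGraph.degree_eq hq, h.parSum_eq_zero]
  simp

/-- Every face belongs to two of the three jackets, so adding the three Euler bounds gives 8F ≤ 3N +
24. -/
theorem AllTetra.degree_nonneg (h : G.AllTetra) (hG : G.Connected) (hq : G.IsQuartic) :
    0 ≤ G.degree := by
  have h1 := h.numComp_add_le hG hq (i := 1) (j := 2) (k := 3) (by decide)
  have h2 := h.numComp_add_le hG hq (i := 1) (j := 3) (k := 2) (by decide)
  have h3 := h.numComp_add_le hG hq (i := 2) (j := 3) (k := 1) (by decide)
  have h4 : 8 * G.numFaces ≤ 3 * Nat.card G.Node + 24 := by rw [numFaces_eq]; omega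
  have h5 : 8 * (G.numFaces : ℚ) ≤ 3 * Nat.card G.Node + 24 := by exact_mod_cast h4
  rw [h.degree_eq hq]
  linarith

/-- If some function is invariant under the lines and alternates along the edges of color `d`, and
no face of color `d` has exactly two lines, then each face of color `d` has four lines at least. -/
theorem eight_mul_numComp_le {d : Fin 4} (τ : G.Node → ZMod 2) (h0 : ∀ z, τ (G.nb 0 z) = τ z)
    (hd : ∀ z, τ (G.nb d z) = τ z + 1) (hne : ∀ z, G.nb 0 (G.nb d z) ≠ G.nb d (G.nb 0 z)) :
    8 * G.numComp {0, d} ≤ Nat.card G.Node := by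
  classical
  have hs : ∀ t : ZMod 2, t + 1 + 1 = t ∧ t + 1 ≠ t := by decide
  refine G.mul_numComp_le _ _ fun x => ?_
  have c0 : ∀ z, G.component {0, d} (G.nb 0 z) = G.component {0, d} z := G.component_nb (by simp)
  have cd : ∀ z, G.component {0, d} (G.nb d z) = G.component {0, d} z := G.component_nb (by simp)
  set C : Finset G.Node := {z | G.component {0, d} z = G.component {0, d} x} with hC
  have memC : ∀ z, z ∈ C ↔ G.component {0, d} z = G.component {0, d} x := fun z => by simp [hC]
  set C0 := C.filter (fun z => τ z = τ x) with hC0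
  have memC0 : ∀ z, z ∈ C0 ↔ z ∈ C ∧ τ z = τ x := fun z => by simp [hC0]
  -- One level set of `τ` on the face consists of whole lines. Three distinct nodes in it force a
  -- fourth, and color `d` maps it to the other level set, which gives eight nodes.
  have hev : Even C0.card := G.even_card_of_closed 0 C0 fun z hz => by
    rw [memC0, memC] at hz ⊢
    rwa [c0, h0]
  have hsub : ({x, G.nb 0 x, G.nb d (G.nb 0 (G.nb d x))} : Finset G.Node) ⊆ C0 := by
    intro z hz
    simp only [Finset.mem_insert, Finset.mem_singleton] at hz
    rw [memC0, memC]
    rcases hz with rfl | rfl | rfl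
    · exact ⟨rfl, rfl⟩
    · exact ⟨c0 x, h0 x⟩
    · exact ⟨by rw [cd, c0, cd], by rw [hd, h0, hd, (hs _).1]⟩
  have h3 : ({x, G.nb 0 x, G.nb d (G.nb 0 (G.nb d x))} : Finset G.Node).card = 3 := by
    rw [Finset.card_eq_three]
    refine ⟨_, _, _, (G.nb_ne 0 x).symm, fun e => ?_, fun e => ?_, rfl⟩
    · exact G.nb_ne 0 (G.nb d x) ((G.nb_eq_comm d).mp e.symm)
    · exact hne x ((G.nb_eq_comm d).mp e.symm)
  have h4 := Finset.card_le_card hsub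
  have hdisj : Disjoint C0 (C0.image (G.nb d)) := by
    rw [Finset.disjoint_left]
    intro z hz hz'
    obtain ⟨w, hw, rfl⟩ := Finset.mem_image.mp hz'
    rw [memC0] at hz hw
    rw [hd, hw.2] at hz
    exact (hs _).2 hz.2
  have hunion : C0 ∪ C0.image (G.nb d) ⊆ C := by
    intro z hz
    rcases Finset.mem_union.mp hz with hz | hz
    · exact ((memC0 z).mp hz).1
    · obtain ⟨w, hw, rfl⟩ := Finset.mem_image.mp hz
      rw [memC, cd]
      exact (memC w).mp ((memC0 w).mp hw).1
  have h5 := Finset.card_le_card hunion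
  rw [Finset.card_union_of_disjoint hdisj,
    Finset.card_image_of_injective _ (G.nb_injective d)] at h5
  rw [Nat.even_iff] at hev
  omega

/-- The jackets with colors `0`, `i`, `j` and `0`, `i`, `k` are spheres, hence bipartite. As `k` is
the composite of `i` and `j`, the sum of the two bipartitions is constant along lines and alternates
along `j` and `k`, which excludes faces of these colors with a single line. Were there no face with
two lines, those of colors `j` and `k` would have at least four each, against `h3`. -/
theorem AllTetra.exists_short_face_aux (h : G.AllTetra) (hG : G.Connected) (hq : G.IsQuartic)
    (ht : IsColorTriple i j k)
    (h1 : 4 * (G.numComp {0, i} + G.numComp {0, j}) = Nat.card G.Node + 8)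
    (h2 : 4 * (G.numComp {0, i} + G.numComp {0, k}) = Nat.card G.Node + 8)
    (h3 : Nat.card G.Node + 4 ≤ 4 * (G.numComp {0, j} + G.numComp {0, k})) :
    ∃ d : Fin 4, d ≠ 0 ∧ ∃ z, G.nb 0 (G.nb d z) = G.nb d (G.nb 0 z) ∧ G.nb 0 z ≠ G.nb d z := by
  have ht2 : IsColorTriple i k j := ⟨ht.1, ht.2.2.1, ht.2.1, ht.2.2.2.2.1, ht.2.2.2.1,
    ht.2.2.2.2.2.symm⟩
  obtain ⟨ε, e0, ei, ej⟩ := h.exists_bipartition hG hq ht h1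
  obtain ⟨δ, d0, di, dk⟩ := h.exists_bipartition hG hq ht2 h2
  have s1 : ∀ s t : ZMod 2, s + 1 + (t + 1) = s + t := by decide
  have s2 : ∀ s t : ZMod 2, s + 1 + (t + 1 + 1) = s + t + 1 := by decide
  have s3 : ∀ s t : ZMod 2, s + 1 + 1 + (t + 1) = s + t + 1 := by decide
  have s4 : ∀ s : ZMod 2, s + 1 ≠ s := by decide
  have t0 : ∀ z, ε (G.nb 0 z) + δ (G.nb 0 z) = ε z + δ z := fun z => by rw [e0, d0, s1]
  have tj : ∀ z, ε (G.nb j z) + δ (G.nb j z) = ε z + δ z + 1 := fun z => by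
    rw [ej, ← h.nb_nb_eq hq ht2, di, dk, s2]
  have tk : ∀ z, ε (G.nb k z) + δ (G.nb k z) = ε z + δ z + 1 := fun z => by
    rw [dk, ← h.nb_nb_eq hq ht, ei, ej, s3]
  by_contra! hcon
  have key : ∀ d, d ≠ 0 → (∀ z, ε (G.nb d z) + δ (G.nb d z) = ε z + δ z + 1) →
      8 * G.numComp {0, d} ≤ Nat.card G.Node := fun d hd0 hd =>
    eight_mul_numComp_le (fun z => ε z + δ z) t0 hd fun z e => by
      have h5 := t0 z
      rw [hcon d hd0 z e, hd] at h5
      exact s4 _ h5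
  have k1 := key j ht.2.1 tj
  have k2 := key k ht.2.2.1 tk
  omega

/-- A graph made of tetrahedra and of small degree has a face with exactly two lines. -/
theorem AllTetra.exists_short_face (h : G.AllTetra) (hG : G.Connected) (hq : G.IsQuartic)
    (hd : G.degree < 1) :
    ∃ d : Fin 4, d ≠ 0 ∧ ∃ z, G.nb 0 (G.nb d z) = G.nb d (G.nb 0 z) ∧ G.nb 0 z ≠ G.nb d z := by
  have h1 := h.numComp_add_le hG hq (i := 1) (j := 2) (k := 3) (by decide)
  have h2 := h.numComp_add_le hG hq (i := 1) (j := 3) (k := 2) (by decide)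
  have h3 := h.numComp_add_le hG hq (i := 2) (j := 3) (k := 1) (by decide)
  have hn := h.numComp_pair hq (i := 1) (j := 2) (k := 3) (by decide)
  rw [h.degree_eq hq] at hd
  have h5 : 3 * (Nat.card G.Node : ℚ) + 16 < 8 * G.numFaces := by linarith
  have h4 : 3 * Nat.card G.Node + 16 < 8 * G.numFaces := by exact_mod_cast h5
  rw [numFaces_eq] at h4
  -- As 4 divides N, each jacket bound fails to be sharp by a multiple of 4, and the total defect is
  -- below 8. So two jackets are spheres; the color they share plays the role of `i`, and the third
  -- has defect at most 4.
  by_cases c1 : 4 * (G.numComp {0, 1} + G.numComp {0, 2}) = Nat.card G.Node + 8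
  · by_cases c2 : 4 * (G.numComp {0, 1} + G.numComp {0, 3}) = Nat.card G.Node + 8
    · exact h.exists_short_face_aux hG hq (i := 1) (j := 2) (k := 3) (by decide) c1 c2 (by omega)
    · exact h.exists_short_face_aux hG hq (i := 2) (j := 1) (k := 3) (by decide) (by omega)
        (by omega) (by omega)
  · exact h.exists_short_face_aux hG hq (i := 3) (j := 1) (k := 2) (by decide) (by omega)
      (by omega) (by omega)

end tetra

/-! ### Positivity of the degree -/

theorem exists_pillow_of_not_allTetra {G : ColoredGraph.{u}} (h : ¬ G.AllTetra) :
    ∃ i j : Fin 4, i ≠ 0 ∧ j ≠ 0 ∧ i ≠ j ∧ ∃ x, G.nb i x = G.nb j x := by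
  unfold AllTetra at h
  push Not at h
  obtain ⟨i, j, hi, hj, hij, x, hx⟩ := h
  exact ⟨i, j, hi, hj, hij, x, hx⟩

/-- Induction on the number of nodes: a reducible graph splits with additive degree, tetrahedra are
handled by the jackets, and a pillow is either removable, which lowers the degree, or the whole
graph. -/
theorem degree_nonneg {G : ColoredGraph.{u}} (hG : G.Connected) (hq : G.IsQuartic) :
    0 ≤ G.degree := by
  induction hn : Nat.card G.Node using Nat.strong_induction_on generalizing G with
  | _ n ih =>
    subst hn
    by_cases hr : G.IsReducible
    · obtain ⟨S, x, y, h, hS⟩ := hr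
      rw [h.degree_eq_add hG hq hS]
      exact add_nonneg (ih _ (h.card_closure_compl_lt hG hS) (hG.closure _) (hq.closure _) rfl)
        (ih _ (h.card_closure_lt hS) (hG.closure _) (hq.closure _) rfl)
    · by_cases ht : G.AllTetra
      · exact ht.degree_nonneg hG hq
      · obtain ⟨i, j, hi, hj, hij, x, hx⟩ := exists_pillow_of_not_allTetra ht
        rcases pillow_dichotomy hG hq hr hi hj hij hx with ⟨G', h1, h2, h3, h4⟩ | h4
        · have := ih _ h3 h1 h2 rfl
          linarith
        · obtain ⟨k, ht⟩ := exists_isColorTriple hi hj hij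
          exact (degree_pillow ht hq h4 hx).1

/-- An irreducible graph of small degree with a pillow is an elementary melonic graph. -/
theorem pillow_of_degree_lt_one {G : ColoredGraph.{u}} (hG : G.Connected) (hq : G.IsQuartic)
    (hr : ¬ G.IsReducible) {i j : Fin 4} (hi : i ≠ 0) (hj : j ≠ 0) (hij : i ≠ j) {x : G.Node}
    (hx : G.nb i x = G.nb j x) (hd : G.degree < 1) :
    Nat.card G.Node = 4 ∧ ∀ z, G.nb 0 z = G.nb i z := by
  rcases pillow_dichotomy hG hq hr hi hj hij hx with ⟨G', h1, h2, h3, h4⟩ | h4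
  -- Removing the pillow would leave a graph of negative degree.
  · have := degree_nonneg h1 h2
    linarith
  · obtain ⟨k, ht⟩ := exists_isColorTriple hi hj hij
    exact ⟨h4, (degree_pillow ht hq h4 hx).2 hd⟩

/-! ### Replacement of two tetrahedra by a pillow -/

section dipole
variable {G : ColoredGraph.{u}}

/-- The set `square 0 l z` is a face with two lines joining two distinct tetrahedra. It is removed,
and the edges of colors `i` and `j` ending on it are joined across its lines. On the four remaining
nodes of the tetrahedra, `i` and `j` become parallel and `l` is unchanged: they form a pillow. -/
theorem exists_replace_tetra {i j l : Fin 4} (hG : G.Connected) (hq : G.IsQuartic)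
    (hr : ¬ G.IsReducible) (hT : G.AllTetra) (ht : IsColorTriple i j l) {z : G.Node}
    (hz : G.nb 0 (G.nb l z) = G.nb l (G.nb 0 z)) (hzl : G.nb 0 z ≠ G.nb l z)
    (hout : ∀ c, c ≠ 0 → c ≠ l → G.nb 0 z ≠ G.nb c z ∧ G.nb l (G.nb 0 z) ≠ G.nb c z) :
    ∃ h : G.IsBypass (G.square 0 l z) 0, (G.bypass _ 0 h).Connected ∧ (G.bypass _ 0 h).IsQuartic ∧
      ¬ (G.bypass _ 0 h).IsReducible ∧ (G.bypass _ 0 h).degree ≤ G.degree ∧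
      ∀ r ∈ G.square 0 l z, G.nb i r ∉ G.square 0 l z := by
  obtain ⟨hcomm, hene, hmem⟩ := hq.isLocallyQuartic
  have hi := ht.1
  have hj := ht.2.1
  have hl := ht.2.2.1
  have hij := ht.2.2.2.1
  have hil := ht.2.2.2.2.1
  have hjl := ht.2.2.2.2.2
  set D := G.square 0 l z with hD
  have memD : ∀ w, w ∈ D ↔ w = z ∨ w = G.nb 0 z ∨ w = G.nb l z ∨ w = G.nb 0 (G.nb l z) :=
    fun w => Iff.rfl
  have z1 : z ∈ D := .inl rfl
  have h0l : ∀ r ∈ D, G.nb 0 (G.nb l r) = G.nb l (G.nb 0 r) := by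
    rintro r (rfl | rfl | rfl | rfl)
    · exact hz
    · rw [← hz, G.nb_nb, G.nb_nb]
    · rw [hz, G.nb_nb, G.nb_nb]
    · rw [G.nb_nb, hz, G.nb_nb]
      rw [G.nb_nb 0 z, G.nb_nb l z]
  have hne : ∀ r ∈ D, G.nb 0 r ≠ G.nb l r := by
    rintro r (rfl | rfl | rfl | rfl) e
    · exact hzl e
    · rw [G.nb_nb] at e; exact hzl ((G.nb_eq_comm l).mp e.symm)
    · rw [G.nb_nb, hz] at e; exact hzl ((G.nb_eq_comm l).mp e)
    · rw [G.nb_nb, hz, G.nb_nb] at e; exact hzl e.symm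
  have cl0 : ∀ r ∈ D, G.nb 0 r ∈ D := by
    rintro r (rfl | rfl | rfl | rfl) <;> rw [memD] <;> simp [G.nb_nb]
  have cll : ∀ r ∈ D, G.nb l r ∈ D := by
    rintro r (rfl | rfl | rfl | rfl) <;> rw [memD] <;> simp [G.nb_nb, hz]
  have cl0' : ∀ r ∉ D, G.nb 0 r ∉ D := fun r hr h => hr (by
    have := cl0 _ h
    rwa [G.nb_nb] at this)
  have cll' : ∀ r ∉ D, G.nb l r ∉ D := fun r hr h => hr (by
    have := cll _ h
    rwa [G.nb_nb] at this)
  -- By `hout`, `z` and `nb 0 z` lie in distinct tetrahedra, so the two other colors lead out of the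
  -- face.
  have hsep : ∀ c, c ≠ 0 → c ≠ l → ∀ r ∈ D, G.nb c r ∉ D := by
    intro c hc hcl r hrD
    obtain ⟨o1, o2⟩ := hout c hc hcl
    have n0 : G.nb l z ≠ G.nb c z := hT l c hl hc hcl.symm z
    have hcz : G.nb c z ∉ D := by
      rintro (e | e | e | e)
      · exact G.nb_ne c z e
      · exact o1 e.symm
      · exact n0 e.symm
      · exact o2 (e.trans hz).symm
    have hc0z : G.nb c (G.nb 0 z) ∉ D := by
      have n1 := hT c l hc hl hcl (G.nb 0 z)
      rintro (e | e | e | e)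
      · exact o1 ((G.nb_eq_comm c).mp e)
      · exact G.nb_ne c _ e
      · rw [G.nb_eq_comm c, hcomm c l hc hl] at e
        exact o2 (by rw [e, G.nb_nb])
      · rw [hz] at e
        exact n1 e
    rcases hrD with rfl | rfl | rfl | rfl
    · exact hcz
    · exact hc0z
    · rw [hcomm c l hc hl]
      exact cll' _ hcz
    · rw [hz, hcomm c l hc hl]
      exact cll' _ hc0z
  have hB : G.IsBypass D 0 := by
    refine ⟨cl0, fun r hr c hc => ?_⟩
    have c0 : c ≠ 0 := fun e => hc (by rw [e]; exact cl0 r hr)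
    have c1 : c ≠ l := fun e => hc (by rw [e]; exact cll r hr)
    exact hsep c c0 c1 _ (cl0 r hr)
  have inj := bypassVal_injective hB
  set B := G.bypass D 0 hB with hBdef
  have hiff : ∀ w, G.nb i w ∈ D ↔ G.nb j w ∈ D := by
    have key : ∀ a b, IsColorTriple a b l → ∀ w, G.nb a w ∈ D → G.nb b w ∈ D := by
      intro a b hab w hw
      have hbal : IsColorTriple l a b := ⟨hab.2.2.1, hab.1, hab.2.1, hab.2.2.2.2.1.symm,
        hab.2.2.2.2.2.symm, hab.2.2.2.1⟩
      rw [← hT.nb_nb_eq hq hbal]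
      exact cll _ hw
    exact fun w => ⟨key i j ht w, key j i ⟨hj, hi, hl, hij.symm, hjl, hil⟩ w⟩
  have v0 : ∀ w, bypassVal hB (B.nb 0 w) = G.nb 0 (bypassVal hB w) :=
    fun w => bypassVal_nb hB (cl0' _ (bypassVal_notMem hB w))
  have vl : ∀ w, bypassVal hB (B.nb l w) = G.nb l (bypassVal hB w) :=
    fun w => bypassVal_nb hB (cll' _ (bypassVal_notMem hB w))
  -- away from the new pillow
  have va : ∀ w, G.nb i (bypassVal hB w) ∉ D → ∀ c, bypassVal hB (B.nb c w) =
      G.nb c (bypassVal hB w) := by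
    intro w hw c
    rcases ht.cases c with rfl | rfl | rfl | rfl
    · exact v0 w
    · exact bypassVal_nb hB hw
    · exact bypassVal_nb hB fun h => hw ((hiff _).mpr h)
    · exact vl w
  -- at the new pillow
  have vi : ∀ w, G.nb i (bypassVal hB w) ∈ D → bypassVal hB (B.nb i w) =
      G.nb i (G.nb 0 (G.nb i (bypassVal hB w))) := fun w hw => bypassVal_nb_of_mem hB hw
  have hil' : IsColorTriple i l j := ⟨hi, hl, hj, hil, hij, hjl.symm⟩
  -- Color `j` is `i` composed with `l`, and `l` commutes with the lines on `D`; this makes the new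
  -- edges parallel.
  have vj : ∀ w, G.nb i (bypassVal hB w) ∈ D → B.nb j w = B.nb i w := by
    intro w hw
    apply inj
    rw [bypassVal_nb_of_mem hB ((hiff _).mp hw), vi w hw, ← hT.nb_nb_eq hq hil',
      ← hT.nb_nb_eq hq hil', hcomm i l hi hl (bypassVal hB w), h0l _ hw, G.nb_nb]
  have stay : ∀ c, c ≠ 0 → ∀ w, G.nb i (bypassVal hB w) ∉ D →
      G.nb i (bypassVal hB (B.nb c w)) ∉ D := by
    intro c hc w hw
    rw [va w hw c]
    rcases ht.cases c with rfl | rfl | rfl | rfl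
    · exact absurd rfl hc
    · rw [G.nb_nb]; exact bypassVal_notMem hB w
    · rw [hT.nb_nb_eq hq ht]; exact cll' _ (bypassVal_notMem hB w)
    · rw [hcomm i c hi hc]; exact cll' _ hw
  have hPi : ∀ w, G.nb i (bypassVal hB w) ∈ D → G.nb i (bypassVal hB (B.nb i w)) ∈ D := by
    intro w hw
    rw [vi w hw, G.nb_nb]
    exact cl0 _ hw
  have hPl : ∀ w, G.nb i (bypassVal hB w) ∈ D → G.nb i (bypassVal hB (B.nb l w)) ∈ D := by
    intro w hw
    rw [vl w, hcomm i l hi hl]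
    exact cll _ hw
  have hil_comm : ∀ w, G.nb i (bypassVal hB w) ∈ D → B.nb i (B.nb l w) = B.nb l (B.nb i w) := by
    intro w hw
    apply inj
    rw [vi _ (hPl w hw), vl, vl, vi w hw, hcomm i l hi hl, h0l _ hw, hcomm i l hi hl]
  have hcases : ∀ c, c ≠ 0 → ∀ w, G.nb i (bypassVal hB w) ∈ D →
      B.nb c w = B.nb i w ∨ B.nb c w = B.nb l w := by
    intro c hc w hw
    rcases ht.cases c with rfl | rfl | rfl | rfl
    · exact absurd rfl hc
    · exact .inl rfl
    · exact .inl (vj w hw)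
    · exact .inr rfl
  have hne' : ∀ w, G.nb i (bypassVal hB w) ∈ D → B.nb i w ≠ B.nb l w := by
    intro w hw e
    have e' := congrArg (bypassVal hB) e
    rw [vi w hw, vl, G.nb_eq_comm i, hcomm i l hi hl] at e'
    exact hne _ hw e'
  have hq' : B.IsQuartic := by
    refine IsLocallyQuartic.isQuartic ⟨fun c d h1 h2 w => ?_, fun w => ?_,
      fun c d k h1 h2 h3 w hw => ?_⟩
    · by_cases hD' : G.nb i (bypassVal hB w) ∈ D
      · have key : ∀ c, c ≠ 0 → ∀ d, (∀ w, G.nb i (bypassVal hB w) ∈ D → B.nb d w = B.nb i w) ∨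
            d = l → (∀ w, G.nb i (bypassVal hB w) ∈ D → B.nb c w = B.nb i w) ∨ c = l →
            B.nb c (B.nb d w) = B.nb d (B.nb c w) := by
          rintro c - d (hd | rfl) (hc | rfl)
          · rw [hd w hD', hc w hD', hc _ (hPi w hD'), hd _ (hPi w hD')]
          · rw [hd w hD', hd _ (hPl w hD')]
            exact (hil_comm w hD').symm
          · rw [hc w hD', hc _ (hPl w hD')]
            exact hil_comm w hD'
          · rfl
        have kind : ∀ c, c ≠ 0 → (∀ w, G.nb i (bypassVal hB w) ∈ D → B.nb c w = B.nb i w) ∨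
            c = l := by
          intro c hc
          rcases ht.cases c with rfl | rfl | rfl | rfl
          · exact absurd rfl hc
          · exact .inl fun _ _ => rfl
          · exact .inl vj
          · exact .inr rfl
        exact key c h1 d (kind d h2) (kind c h1)
      · apply inj
        rw [va _ (stay d h2 w hD'), va w hD', va _ (stay c h1 w hD'), va w hD', hcomm c d h1 h2]
    · by_cases hD' : G.nb i (bypassVal hB w) ∈ D
      · exact ⟨i, l, hi, hl, hne' w hD'⟩
      · refine ⟨i, l, hi, hl, fun e => hT i l hi hl hil (bypassVal hB w) ?_⟩
        rw [← va w hD', ← va w hD', e]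
    · by_cases hD' : G.nb i (bypassVal hB w) ∈ D
      · rcases hcases c h1 w hD' with e1 | e1 <;> rcases hcases d h2 w hD' with e2 | e2 <;>
        rcases hcases k h3 w hD' with e3 | e3 <;> rw [e1, e2] at hw <;> rw [e1, e2, e3] <;>
        simp at hw ⊢
      · have := hmem c d k h1 h2 h3 (bypassVal hB w) (fun e => hw (inj (by
          rw [va w hD', va w hD', e])))
        rw [← va w hD' k, ← va w hD' c, ← va w hD' d, ← va _ (stay d h2 w hD') c] at this
        simpa only [inj.eq_iff] using this
  have hconn : B.Connected := by
    rw [connected_iff]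
    refine ⟨⟨bypassMk hB (G.nb i z) (hsep i hi hil z z1)⟩, fun A hA hAne => ?_⟩
    -- The nodes of `D` are put back on the side of their neighbors of color `i`.
    have hu := hG.eq_univ (A := bypassVal hB '' A ∪
        {r | r ∈ D ∧ G.nb i r ∈ bypassVal hB '' A}) (by
      rintro c r (⟨w, hw, rfl⟩ | ⟨hrD, w, hw, hwr⟩)
      · by_cases hD' : G.nb c (bypassVal hB w) ∈ D
        · right
          refine ⟨hD', ?_⟩
          rcases ht.cases c with rfl | rfl | rfl | rfl
          · exact absurd hD' (cl0' _ (bypassVal_notMem hB w))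
          · rw [G.nb_nb]; exact ⟨w, hw, rfl⟩
          · rw [hT.nb_nb_eq hq ht]; exact ⟨_, hA l w hw, vl w⟩
          · exact absurd hD' (cll' _ (bypassVal_notMem hB w))
        · exact .inl ⟨_, hA c w hw, bypassVal_nb hB hD'⟩
      · have hr' : G.nb i (bypassVal hB w) = r := by rw [hwr, G.nb_nb]
        have hwD : G.nb i (bypassVal hB w) ∈ D := by rw [hr']; exact hrD
        rcases ht.cases c with rfl | rfl | rfl | rfl
        · exact .inr ⟨cl0 _ hrD, _, hA i w hw, by rw [vi w hwD, hr']⟩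
        · exact .inl ⟨w, hw, hwr⟩
        · refine .inl ⟨_, hA l w hw, ?_⟩
          have hli : IsColorTriple l i c := ⟨hl, hi, hj, hil.symm, hjl.symm, hij⟩
          rw [vl, hwr, hT.nb_nb_eq hq hli]
        · refine .inr ⟨cll _ hrD, _, hA c w hw, ?_⟩
          rw [vl, hwr, hcomm c i hl hi])
      (by obtain ⟨a, ha⟩ := hAne; exact ⟨_, .inl ⟨a, ha, rfl⟩⟩)
    refine Set.eq_univ_of_forall fun w => ?_
    rcases Set.eq_univ_iff_forall.mp hu (bypassVal hB w) with ⟨w', hw', e⟩ | ⟨hw', -⟩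
    · rwa [← inj e]
    · exact absurd hw' (bypassVal_notMem hB w)
  refine ⟨hB, hconn, hq', ?_, ?_, hsep i hi hil⟩
  -- A union of bubbles without `p` avoids the new pillow, and away from it the two graphs agree.
  -- Passing to the complement if necessary, a proper 2-point subgraph of the new graph is one of
  -- `G`.
  · set p : B.Node := bypassMk hB (G.nb i z) (hsep i hi hil z z1) with hp
    have hpS : ∀ (S : Set B.Node), (∀ c, c ≠ 0 → ∀ w ∈ S, B.nb c w ∈ S) → p ∉ S →
        ∀ w ∈ S, G.nb i (bypassVal hB w) ∉ D := by
      intro S hS hpS w hw hwD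
      apply hpS
      have hpz : G.nb i (bypassVal hB p) = z := by rw [hp, bypassVal_mk, G.nb_nb]
      rcases hwD with e | e | e | e
      · rw [show p = w from inj ((G.nb_injective i) (by rw [hpz, e]))]; exact hw
      · have : p = B.nb i w := inj ((G.nb_injective i) (by
          rw [vi w (by rw [e]; exact cl0 _ z1), e, hpz, G.nb_nb, G.nb_nb]))
        rw [this]; exact hS i hi w hw
      · have : p = B.nb l w := inj ((G.nb_injective i) (by
          rw [vl, hcomm i l hi hl, e, hpz, G.nb_nb]))
        rw [this]; exact hS l hl w hw
      · have hlw : G.nb i (bypassVal hB (B.nb l w)) = G.nb 0 z := by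
          rw [vl, hcomm i l hi hl, e, hz, G.nb_nb]
        have : p = B.nb i (B.nb l w) := inj ((G.nb_injective i) (by
          rw [vi (B.nb l w) (by rw [hlw]; exact cl0 _ z1), hlw, hpz, G.nb_nb, G.nb_nb]))
        rw [this]; exact hS i hi _ (hS l hl w hw)
    have key : ∀ (S : Set B.Node) (a b : B.Node), B.IsTwoPoint S a b → p ∉ S → False := by
      intro S a b h hpn
      have hfar := hpS S h.bubble_mem hpn
      refine hr ⟨bypassVal hB '' S, bypassVal hB a, bypassVal hB b,
        ⟨⟨a, h.left_mem, rfl⟩, ⟨b, h.right_mem, rfl⟩, fun e => h.ne (inj e), ?_, ?_⟩, ?_⟩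
      · rintro c hc - ⟨w, hw, rfl⟩
        exact ⟨_, h.bubble_mem c hc w hw, va w (hfar w hw) c⟩
      · rintro - ⟨w, hw, rfl⟩ n1 n2
        obtain ⟨e1, e2, e3⟩ := h.line_mem w hw (fun e => n1 (by rw [e])) (fun e => n2 (by rw [e]))
        rw [← v0]
        exact ⟨⟨_, e1, rfl⟩, fun e => e2 (inj e), fun e => e3 (inj e)⟩
      · intro e
        obtain ⟨w, -, hw⟩ := Set.eq_univ_iff_forall.mp e z
        exact bypassVal_notMem hB w (by rw [hw]; exact z1)
    rintro ⟨S, a, b, h, hS⟩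
    by_cases hpn : p ∈ S
    · exact key _ _ _ (h.compl hconn hS) fun h' => h' hpn
    · exact key S a b h hpn
  · have ncard4 : D.ncard = 4 := ncard_square hzl
    have c1 := card_bypass hB
    rw [ncard4] at c1
    have p1 : B.numPar i j ≤ 4 := by
      have hsub : ∀ w : {w : B.Node // B.nb i w = B.nb j w}, G.nb i (bypassVal hB w.1) ∈ D := by
        intro w
        by_contra hw
        exact hT i j hi hj hij _ (by rw [← va _ hw, ← va _ hw, w.2])
      have : Function.Injective (fun w : {w : B.Node // B.nb i w = B.nb j w} =>
          (⟨G.nb i (bypassVal hB w.1), hsub w⟩ : D)) := by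
        intro w w' e
        exact Subtype.ext (inj (G.nb_injective i (congrArg Subtype.val e)))
      have := Nat.card_le_card_of_injective _ this
      rwa [Nat.card_coe_set_eq, ncard4] at this
    have pl : ∀ c, c ≠ 0 → c ≠ l → B.numPar c l = 0 := by
      intro c hc hcl
      have : IsEmpty {w : B.Node // B.nb c w = B.nb l w} := by
        refine ⟨fun w => ?_⟩
        by_cases hw : G.nb i (bypassVal hB w.1) ∈ D
        · rcases ht.cases c with rfl | rfl | rfl | rfl
          · exact hc rfl
          · exact hne' _ hw w.2
          · exact hne' _ hw ((vj _ hw).symm.trans w.2)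
          · exact hcl rfl
        · exact hT c l hc hl hcl _ (by rw [← va _ hw, ← va _ hw, w.2])
      exact Nat.card_of_isEmpty
    have hP : (B.parSum : ℚ) ≤ 4 := by
      have : B.parSum ≤ 4 := by
        rw [ht.parSum_eq, pl i hi hil, pl j hj hjl]; omega
      exact_mod_cast this
    have f1 : ∀ c, c ≠ 0 → c ≠ l → G.numComp {0, c} ≤ B.numComp {0, c} := by
      intro c hc hcl
      refine numComp_le_bypass hB (fun f hf r _ => hf 0 (by simp) r) (fun f hf h0 r hr => ?_)
      have : f (G.nb c r) = f r := hf c (by simp) r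
      rw [← this]
      exact h0 _ (hsep c hc hcl r hr)
    -- Only the face `D` itself disappears, and an invariant function that vanishes at `z` vanishes
    -- on it.
    have f2 : G.numComp {0, l} ≤ B.numComp {0, l} + 1 := by
      refine numComp_le_bypass_add_one hB (LinearMap.proj (R := ZMod 2) (φ := fun _ => ZMod 2) z)
        (fun f hf _ r _ => hf 0 (by simp) r) ?_
      intro f hf hlz _
      have hz0 : f z = 0 := hlz
      have g0 : ∀ w, f (G.nb 0 w) = f w := hf 0 (by simp)
      have gl : ∀ w, f (G.nb l w) = f w := hf l (by simp)
      rintro r (rfl | rfl | rfl | rfl)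
      · exact hz0
      · rw [g0, hz0]
      · rw [gl, hz0]
      · rw [g0, gl, hz0]
    have hF : (G.numFaces : ℚ) ≤ B.numFaces + 1 := by
      have : G.numFaces ≤ B.numFaces + 1 := by
        have g1 := f1 i hi hil
        have g2 := f1 j hj hjl
        rw [ht.numFaces_eq, ht.numFaces_eq]; omega
      exact_mod_cast this
    have hN : (Nat.card G.Node : ℚ) = Nat.card B.Node + 4 := by
      rw [← c1]; push_cast; rfl
    -- The new (3N + P)/8 is lower by at least (12 - 4)/8 = 1, which offsets the lost face.
    rw [hT.degree_eq hq, degree_eq hq', hN]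
    linarith

/-- The irreducible graphs of small degree made of tetrahedra. -/
theorem tetra_of_degree_lt_one (hG : G.Connected) (hq : G.IsQuartic)
    (hr : ¬ G.IsReducible) (hT : G.AllTetra) (hd : G.degree < 1) :
    (Nat.card G.Node = 4 ∧ ∃ c, c ≠ 0 ∧ ∀ z, G.nb 0 z = G.nb c z) ∨
      (Nat.card G.Node = 8 ∧ ∀ c z, G.nb 0 (G.nb c z) = G.nb c (G.nb 0 z)) := by
  classical
  obtain ⟨l, hl, z, hz, hzl⟩ := hT.exists_short_face hG hq hd
  have htriple : ∀ l : Fin 4, l ≠ 0 → ∃ i j, IsColorTriple i j l := by decide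
  obtain ⟨i, j, ht⟩ := htriple l hl
  have hi := ht.1
  have hj := ht.2.1
  have hij := ht.2.2.2.1
  have hil := ht.2.2.2.2.1
  have hjl := ht.2.2.2.2.2
  have hcomm := hq.isLocallyQuartic.comm
  -- If the line at `z` returns to the same tetrahedron, irreducibility makes this tetrahedron the
  -- whole graph.
  by_cases hin : ∃ c, c ≠ 0 ∧ G.nb 0 z = G.nb c z
  · left
    obtain ⟨c, hc, hcz⟩ := hin
    have hsq : G.nb i z ≠ G.nb l z := hT i l hi hl hil z
    have memR : ∀ w, w ∈ ({z, G.nb i z, G.nb l z, G.nb i (G.nb l z)} : Finset G.Node) ↔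
        w ∈ G.square i l z := fun w => by simp [square]
    have h4 : Nat.card G.Node = 4 := by
      rcases lines_at_bubble hG hr {z, G.nb i z, G.nb l z, G.nb i (G.nb l z)} (G.card_square hsq)
        (fun c hc w hw => by
          rw [memR] at hw ⊢
          exact hq.square_closed hi hl hsq c hc w hw) with h | h
      · refine absurd ?_ (h z (by simp))
        rw [hcz, memR]
        exact hq.square_closed hi hl hsq c hc z (.inl rfl)
      · rw [← ncard_square hsq, ← Set.ncard_univ, ← h]
        congr 1
        ext w
        exact memR w
    refine ⟨h4, c, hc, ?_⟩
    rcases numComp_pair_of_card_eq_four h4 0 c with h | h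
    · exact absurd hcz (h.2.2 z)
    · exact h.2.2
  · right
    push Not at hin
    have hout : ∀ c, c ≠ 0 → c ≠ l → G.nb 0 z ≠ G.nb c z ∧ G.nb l (G.nb 0 z) ≠ G.nb c z := by
      refine fun c hc hcl => ⟨hin c hc, fun e => ?_⟩
      obtain ⟨d, hd⟩ := exists_isColorTriple hl hc hcl.symm
      rw [G.nb_eq_comm l, hT.nb_nb_eq hq hd] at e
      exact hin d hd.2.2.1 e
    obtain ⟨hB, hconn, hq', hr', hdeg, hsep⟩ := exists_replace_tetra hG hq hr hT ht hz hzl hout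
    have ncard4 : (G.square 0 l z).ncard = 4 := ncard_square hzl
    have c1 := card_bypass hB
    have z1 : z ∈ G.square 0 l z := .inl rfl
    have cl0 : ∀ r ∈ G.square 0 l z, G.nb 0 r ∈ G.square 0 l z := hB.nb_mem
    have hijl : ∀ w, G.nb j w = G.nb i (G.nb l w) := fun w =>
      (hT.nb_nb_eq hq ⟨hi, hl, hj, hil, hij, hjl.symm⟩ w).symm
    have cll : ∀ r ∈ G.square 0 l z, G.nb l r ∈ G.square 0 l z := by
      rintro r (rfl | rfl | rfl | rfl)
      · exact .inr (.inr (.inl rfl))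
      · exact .inr (.inr (.inr hz.symm))
      · exact .inl (G.nb_nb l z)
      · exact .inr (.inl (by rw [hz, G.nb_nb]))
    have h0l : ∀ r ∈ G.square 0 l z, G.nb 0 (G.nb l r) = G.nb l (G.nb 0 r) := by
      rintro r (rfl | rfl | rfl | rfl)
      · exact hz
      · rw [← hz, G.nb_nb, G.nb_nb]
      · rw [hz, G.nb_nb, G.nb_nb]
      · rw [G.nb_nb, hz, G.nb_nb]
        rw [G.nb_nb 0 z, G.nb_nb l z]
    have vi : ∀ r (hr : r ∈ G.square 0 l z),
        bypassVal hB ((G.bypass _ 0 hB).nb i (bypassMk hB (G.nb i r) (hsep r hr))) =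
          G.nb i (G.nb 0 r) := by
      intro r hr
      rw [bypassVal_nb_of_mem hB (by rw [bypassVal_mk, G.nb_nb]; exact hr), bypassVal_mk, G.nb_nb]
    have hx : (G.bypass _ 0 hB).nb i (bypassMk hB (G.nb i z) (hsep z z1)) =
        (G.bypass _ 0 hB).nb j (bypassMk hB (G.nb i z) (hsep z z1)) := by
      apply bypassVal_injective hB
      have e : G.nb j (G.nb i z) = G.nb l z := by rw [hijl, hcomm l i hl hi, G.nb_nb]
      rw [vi z z1, bypassVal_nb_of_mem hB (by rw [bypassVal_mk, e]; exact cll z z1),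
        bypassVal_mk, e, hz, hijl, G.nb_nb]
    -- The new graph is a single pillow with lines parallel to its double edges. Read back in `G`,
    -- this says that lines commute with color `i` on the face.
    obtain ⟨h4, hpar⟩ := pillow_of_degree_lt_one hconn hq' hr' hi hj hij hx (hdeg.trans_lt hd)
    have h0i : ∀ r ∈ G.square 0 l z, G.nb 0 (G.nb i r) = G.nb i (G.nb 0 r) := by
      intro r hr
      rw [← vi r hr, ← hpar]
      refine (bypassVal_nb hB (c := 0) (z := bypassMk hB (G.nb i r) (hsep r hr)) ?_).symm
      intro h
      have := cl0 _ h
      rw [bypassVal_mk, G.nb_nb] at this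
      exact hsep r hr this
    have hu := hG.eq_univ (A := {w | w ∈ G.square 0 l z ∨ G.nb i w ∈ G.square 0 l z}) (by
      rintro c w hw
      rw [Set.mem_ofPred_eq] at hw ⊢
      rcases ht.cases c with rfl | rfl | rfl | rfl
      · rcases hw with hw | hw
        · exact .inl (cl0 w hw)
        · right
          have := h0i _ hw
          rw [G.nb_nb] at this
          rw [this, G.nb_nb]
          exact cl0 _ hw
      · rw [G.nb_nb]
        exact hw.symm
      · rw [hijl, G.nb_nb, hcomm i l hi hl]
        rcases hw with hw | hw
        · exact .inr (cll _ hw)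
        · exact .inl (by rw [← hcomm i l hi hl, ← hijl]; exact (by
            rw [hijl, hcomm i l hi hl]; exact cll _ hw))
      · rw [hcomm i c hi hl]
        exact hw.imp (cll _) (cll _)) ⟨z, .inl z1⟩
    have hcase : ∀ w, w ∈ G.square 0 l z ∨ ∃ r ∈ G.square 0 l z, w = G.nb i r := fun w => by
      rcases Set.eq_univ_iff_forall.mp hu w with h | h
      · exact .inl h
      · exact .inr ⟨_, h, (G.nb_nb i w).symm⟩
    have g0i : ∀ w, G.nb 0 (G.nb i w) = G.nb i (G.nb 0 w) := by
      intro w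
      rcases hcase w with h | ⟨r, h, rfl⟩
      · exact h0i w h
      · rw [h0i r h, G.nb_nb, G.nb_nb]
    have g0l : ∀ w, G.nb 0 (G.nb l w) = G.nb l (G.nb 0 w) := by
      intro w
      rcases hcase w with h | ⟨r, h, rfl⟩
      · exact h0l w h
      · rw [hcomm l i hl hi, h0i _ (cll r h), h0l r h, h0i r h, hcomm l i hl hi]
    refine ⟨by omega, fun c w => ?_⟩
    rcases ht.cases c with rfl | rfl | rfl | rfl
    · rfl
    · exact g0i w
    · rw [hijl, hijl, g0i, g0l]
    · exact g0l w

end dipole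

/-! ### The elementary graphs -/

/-- The neighbors in the infinity graph, as a map on pairs. -/
def infinityNb (ℓ : Fin 3) (c : Fin 4) : Bool × Bool → Bool × Bool :=
  Fin.cases (flip ℓ) flip c

/-- The neighbors in the elementary melonic graph of type II, as a map on pairs. -/
def melonIINb (ℓ : Fin 3) (c : Fin 4) : Bool × Bool → Bool × Bool :=
  Fin.cases (flip 1) (fun k => if k = ℓ then flip 0 else flip 1) c

/-- The neighbors in the elementary melonic graph of type I, as a map on triples. -/
def melonINb (c : Fin 4) (x : Bool × Bool × Bool) : Bool × Bool × Bool :=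
  Fin.cases (!x.1, x.2) (fun k => (x.1, flip k x.2)) c

/-- If lines commute with all colors, faces have at most two lines and are counted from parallel
edges. All the elementary graphs are of this kind, so their degrees become finite checks. -/
theorem degree_eq_of_comm {G : ColoredGraph.{u}} (hq : G.IsQuartic)
    (h : ∀ c z, G.nb 0 (G.nb c z) = G.nb c (G.nb 0 z)) :
    G.degree = 3 + (3 * (Nat.card G.Node : ℚ) + (G.numPar 1 2 + G.numPar 1 3 + G.numPar 2 3 : ℕ)) / 8
      - (3 * (Nat.card G.Node : ℚ) + (G.numPar 0 1 + G.numPar 0 2 + G.numPar 0 3 : ℕ)) / 4 := by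
  have h1 := G.four_mul_numComp_pair 0 1 (h 1)
  have h2 := G.four_mul_numComp_pair 0 2 (h 2)
  have h3 := G.four_mul_numComp_pair 0 3 (h 3)
  have h4 : 4 * G.numFaces = 3 * Nat.card G.Node + (G.numPar 0 1 + G.numPar 0 2 + G.numPar 0 3) := by
    rw [numFaces_eq]; omega
  have h5 : 4 * (G.numFaces : ℚ) = 3 * Nat.card G.Node +
      (G.numPar 0 1 + G.numPar 0 2 + G.numPar 0 3 : ℕ) := by exact_mod_cast h4
  rw [degree_eq hq, parSum]
  linarith

theorem infinityGraph_isQuartic (ℓ : Fin 3) : (infinityGraph ℓ).IsQuartic := by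
  have h1 : ∀ (ℓ : Fin 3) (c d : Fin 4) (z : Bool × Bool),
      infinityNb ℓ c (infinityNb ℓ d z) =
        infinityNb ℓ d (infinityNb ℓ c z) := by decide
  have h2 : ∀ (ℓ : Fin 3) (z : Bool × Bool), infinityNb ℓ 1 z ≠ infinityNb ℓ 2 z := by
    decide
  have h3 : ∀ (ℓ : Fin 3) (c d k : Fin 4) (z : Bool × Bool), c ≠ 0 → d ≠ 0 → k ≠ 0 →
      infinityNb ℓ c z ≠ infinityNb ℓ d z →
      infinityNb ℓ k z = infinityNb ℓ c z ∨
      infinityNb ℓ k z = infinityNb ℓ d z ∨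
      infinityNb ℓ k z = infinityNb ℓ c (infinityNb ℓ d z) := by decide
  exact IsLocallyQuartic.isQuartic ⟨fun c d _ _ z => h1 ℓ c d z,
    fun z => ⟨1, 2, by decide, by decide, h2 ℓ z⟩, fun c d k hc hd hk z => h3 ℓ c d k z hc hd hk⟩

theorem infinityGraph_connected (ℓ : Fin 3) : (infinityGraph ℓ).Connected := by
  have h : ∀ (ℓ : Fin 3) (a z : Bool × Bool), z = a ∨ z = infinityNb ℓ 1 a ∨
      z = infinityNb ℓ 2 a ∨ z = infinityNb ℓ 1 (infinityNb ℓ 2 a) := by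
    decide
  rw [connected_iff]
  refine ⟨⟨((false, false) : Bool × Bool)⟩, fun A hA ⟨a, ha⟩ => Set.eq_univ_of_forall fun z => ?_⟩
  rcases h ℓ a z with e | e | e | e
  · exact e ▸ ha
  · exact e ▸ hA 1 a ha
  · exact e ▸ hA 2 a ha
  · exact e ▸ hA 1 _ (hA 2 a ha)

theorem infinityGraph_degree (ℓ : Fin 3) : (infinityGraph ℓ).degree = 1 / 2 := by
  have h1 : ∀ (ℓ : Fin 3) (c d : Fin 4) (z : Bool × Bool),
      infinityNb ℓ c (infinityNb ℓ d z) =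
        infinityNb ℓ d (infinityNb ℓ c z) := by decide
  have h2 : ∀ (ℓ : Fin 3) (c d : Fin 4), (infinityGraph ℓ).numPar c d =
      (Finset.univ.filter fun z : Bool × Bool =>
        infinityNb ℓ c z = infinityNb ℓ d z).card := fun ℓ c d =>
    (Nat.card_eq_fintype_card (α := {z : Bool × Bool //
      infinityNb ℓ c z = infinityNb ℓ d z})).trans (Fintype.card_subtype _)
  have h3 : Nat.card (infinityGraph ℓ).Node = 4 := Nat.card_eq_fintype_card (α := Bool × Bool)
  rw [degree_eq_of_comm (infinityGraph_isQuartic ℓ) (h1 ℓ 0), h3]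
  have h4 : (infinityGraph ℓ).numPar 1 2 + (infinityGraph ℓ).numPar 1 3 +
      (infinityGraph ℓ).numPar 2 3 = 0 := by
    rw [h2, h2, h2]; clear * -; revert ℓ; decide
  have h5 : (infinityGraph ℓ).numPar 0 1 + (infinityGraph ℓ).numPar 0 2 +
      (infinityGraph ℓ).numPar 0 3 = 4 := by
    rw [h2, h2, h2]; clear * -; revert ℓ; decide
  rw [h4, h5]
  norm_num

theorem melonII_isQuartic (ℓ : Fin 3) : (melonII ℓ).IsQuartic := by
  have h1 : ∀ (ℓ : Fin 3) (c d : Fin 4) (z : Bool × Bool),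
      melonIINb ℓ c (melonIINb ℓ d z) = melonIINb ℓ d (melonIINb ℓ c z) := by decide
  have h2 : ∀ (ℓ : Fin 3) (z : Bool × Bool), ∃ c d : Fin 4, c ≠ 0 ∧ d ≠ 0 ∧
      melonIINb ℓ c z ≠ melonIINb ℓ d z := by decide
  have h3 : ∀ (ℓ : Fin 3) (c d k : Fin 4) (z : Bool × Bool), c ≠ 0 → d ≠ 0 → k ≠ 0 →
      melonIINb ℓ c z ≠ melonIINb ℓ d z →
      melonIINb ℓ k z = melonIINb ℓ c z ∨ melonIINb ℓ k z = melonIINb ℓ d z ∨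
      melonIINb ℓ k z = melonIINb ℓ c (melonIINb ℓ d z) := by decide
  exact IsLocallyQuartic.isQuartic ⟨fun c d _ _ z => h1 ℓ c d z, h2 ℓ,
    fun c d k hc hd hk z => h3 ℓ c d k z hc hd hk⟩

theorem melonII_connected (ℓ : Fin 3) : (melonII ℓ).Connected := by
  have h : ∀ (ℓ : Fin 3) (a z : Bool × Bool), z = a ∨ z = melonIINb ℓ 0 a ∨
      z = melonIINb ℓ ℓ.succ a ∨ z = melonIINb ℓ 0 (melonIINb ℓ ℓ.succ a) := by
    decide
  rw [connected_iff]
  refine ⟨⟨((false, false) : Bool × Bool)⟩, fun A hA ⟨a, ha⟩ => Set.eq_univ_of_forall fun z => ?_⟩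
  rcases h ℓ a z with e | e | e | e
  · exact e ▸ ha
  · exact e ▸ hA 0 a ha
  · exact e ▸ hA ℓ.succ a ha
  · exact e ▸ hA 0 _ (hA ℓ.succ a ha)

theorem melonII_degree (ℓ : Fin 3) : (melonII ℓ).degree = 0 := by
  have h1 : ∀ (ℓ : Fin 3) (c d : Fin 4) (z : Bool × Bool),
      melonIINb ℓ c (melonIINb ℓ d z) = melonIINb ℓ d (melonIINb ℓ c z) := by decide
  have h2 : ∀ (ℓ : Fin 3) (c d : Fin 4), (melonII ℓ).numPar c d =
      (Finset.univ.filter fun z : Bool × Bool =>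
        melonIINb ℓ c z = melonIINb ℓ d z).card := fun ℓ c d =>
    (Nat.card_eq_fintype_card (α := {z : Bool × Bool //
      melonIINb ℓ c z = melonIINb ℓ d z})).trans (Fintype.card_subtype _)
  have h3 : Nat.card (melonII ℓ).Node = 4 := Nat.card_eq_fintype_card (α := Bool × Bool)
  rw [degree_eq_of_comm (melonII_isQuartic ℓ) (h1 ℓ 0), h3]
  have h4 : (melonII ℓ).numPar 1 2 + (melonII ℓ).numPar 1 3 + (melonII ℓ).numPar 2 3 = 4 := by
    rw [h2, h2, h2]; clear * -; revert ℓ; decide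
  have h5 : (melonII ℓ).numPar 0 1 + (melonII ℓ).numPar 0 2 + (melonII ℓ).numPar 0 3 = 8 := by
    rw [h2, h2, h2]; clear * -; revert ℓ; decide
  rw [h4, h5]
  norm_num

theorem melonI_isQuartic : melonI.IsQuartic := by
  have h1 : ∀ (c d : Fin 4) (z : Bool × Bool × Bool),
      melonINb c (melonINb d z) = melonINb d (melonINb c z) := by decide
  have h2 : ∀ z : Bool × Bool × Bool, melonINb 1 z ≠ melonINb 2 z := by decide
  have h3 : ∀ (c d k : Fin 4) (z : Bool × Bool × Bool), c ≠ 0 → d ≠ 0 → k ≠ 0 →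
      melonINb c z ≠ melonINb d z → melonINb k z = melonINb c z ∨
      melonINb k z = melonINb d z ∨ melonINb k z = melonINb c (melonINb d z) := by decide
  exact IsLocallyQuartic.isQuartic ⟨fun c d _ _ z => h1 c d z,
    fun z => ⟨1, 2, by decide, by decide, h2 z⟩, fun c d k hc hd hk z => h3 c d k z hc hd hk⟩

theorem melonI_connected : melonI.Connected := by
  have h : ∀ a z : Bool × Bool × Bool, (z = a ∨ z = melonINb 1 a ∨
      z = melonINb 2 a ∨ z = melonINb 1 (melonINb 2 a)) ∨ z = melonINb 0 a ∨
      z = melonINb 0 (melonINb 1 a) ∨ z = melonINb 0 (melonINb 2 a) ∨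
      z = melonINb 0 (melonINb 1 (melonINb 2 a)) := by decide
  rw [connected_iff]
  refine ⟨⟨((false, false, false) : Bool × Bool × Bool)⟩, fun A hA ⟨a, ha⟩ =>
    Set.eq_univ_of_forall fun z => ?_⟩
  rcases h a z with (e | e | e | e) | e | e | e | e
  · exact e ▸ ha
  · exact e ▸ hA 1 a ha
  · exact e ▸ hA 2 a ha
  · exact e ▸ hA 1 _ (hA 2 a ha)
  · exact e ▸ hA 0 a ha
  · exact e ▸ hA 0 _ (hA 1 a ha)
  · exact e ▸ hA 0 _ (hA 2 a ha)
  · exact e ▸ hA 0 _ (hA 1 _ (hA 2 a ha))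

theorem melonI_degree : melonI.degree = 0 := by
  have h1 : ∀ (c : Fin 4) (z : Bool × Bool × Bool),
      melonINb 0 (melonINb c z) = melonINb c (melonINb 0 z) := by decide
  have h2 : ∀ c d : Fin 4, melonI.numPar c d =
      (Finset.univ.filter fun z : Bool × Bool × Bool => melonINb c z = melonINb d z).card :=
    fun c d => (Nat.card_eq_fintype_card (α := {z : Bool × Bool × Bool //
      melonINb c z = melonINb d z})).trans (Fintype.card_subtype _)
  have h3 : Nat.card melonI.Node = 8 := Nat.card_eq_fintype_card (α := Bool × Bool × Bool)
  rw [degree_eq_of_comm melonI_isQuartic h1, h3]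
  have h4 : melonI.numPar 1 2 + melonI.numPar 1 3 + melonI.numPar 2 3 = 0 := by
    rw [h2, h2, h2]; decide
  have h5 : melonI.numPar 0 1 + melonI.numPar 0 2 + melonI.numPar 0 3 = 0 := by
    rw [h2, h2, h2]; decide
  rw [h4, h5]
  norm_num

/-- The color parallel to the lines is an invariant. -/
theorem infinityGraph_injective {ℓ ℓ' : Fin 3}
    (h : (infinityGraph ℓ).Isomorphic (infinityGraph ℓ')) : ℓ = ℓ' := by
  obtain ⟨e, he⟩ := h
  have key : ∀ (ℓ ℓ' : Fin 3) (z : Bool × Bool),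
      infinityNb ℓ' 0 z = infinityNb ℓ' ℓ.succ z → ℓ = ℓ' := by decide
  let z : (infinityGraph ℓ).Node := ((false, false) : Bool × Bool)
  exact key ℓ ℓ' (e z) ((he 0 z).symm.trans (he ℓ.succ z))

/-! ### Recognition of the elementary graphs -/

/-- The image of a color-preserving map is closed, hence everything by connectedness; the bound on
cardinalities makes the map bijective. -/
theorem isomorphic_of_hom {G : ColoredGraph.{u}} {H : ColoredGraph.{v}} (hG : G.Connected)
    (f : H.Node → G.Node) (hf : ∀ c z, f (H.nb c z) = G.nb c (f z)) (z : H.Node)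
    (hc : Nat.card H.Node ≤ Nat.card G.Node) : G.Isomorphic H := by
  have hs : Function.Surjective f := by
    rw [← Set.range_eq_univ]
    exact hG.eq_univ (by rintro c - ⟨w, rfl⟩; exact ⟨_, hf c w⟩) ⟨_, z, rfl⟩
  exact Isomorphic.symm ⟨Equiv.ofBijective f (hs.bijective_of_nat_card_le hc), hf⟩

/-- The nodes of the bubble of `z`. -/
def tetraMap (G : ColoredGraph.{u}) (z : G.Node) (p : Bool × Bool) : G.Node :=
  let y := if p.2 then G.nb 2 z else z
  if p.1 then G.nb 1 y else y

theorem AllTetra.tetraMap_flip {G : ColoredGraph.{u}} (h : G.AllTetra) (hq : G.IsQuartic)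
    (z : G.Node) (k : Fin 3) (p : Bool × Bool) :
    G.tetraMap z (flip k p) = G.nb k.succ (G.tetraMap z p) := by
  have h3 := h.nb_nb_eq hq (i := 1) (j := 2) (k := 3) (by decide)
  have h12 := hq.isLocallyQuartic.comm 1 2 (by decide) (by decide)
  obtain ⟨p, q⟩ := p
  fin_cases k
  · change G.tetraMap z (!p, q) = G.nb 1 (G.tetraMap z (p, q))
    cases p <;> cases q <;> simp [tetraMap, G.nb_nb]
  · change G.tetraMap z (p, !q) = G.nb 2 (G.tetraMap z (p, q))
    cases p <;> cases q <;> simp [tetraMap, G.nb_nb, h12]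
  · change G.tetraMap z (!p, !q) = G.nb 3 (G.tetraMap z (p, q))
    rw [← h3]
    cases p <;> cases q <;> simp [tetraMap, G.nb_nb, h12]

theorem AllTetra.isomorphic_infinityGraph {G : ColoredGraph.{u}} (h : G.AllTetra)
    (hG : G.Connected) (hq : G.IsQuartic) (h4 : Nat.card G.Node = 4) {ℓ : Fin 3}
    (h0 : ∀ z, G.nb 0 z = G.nb ℓ.succ z) : G.Isomorphic (infinityGraph ℓ) := by
  obtain ⟨z⟩ := hG.nonempty
  refine isomorphic_of_hom (H := infinityGraph ℓ) hG (G.tetraMap z) ?_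
    ((false, false) : Bool × Bool) ?_
  · intro c p
    cases c using Fin.cases with
    | zero => exact (h.tetraMap_flip hq z ℓ p).trans (h0 _).symm
    | succ k => exact h.tetraMap_flip hq z k p
  · rw [h4]; exact (Nat.card_eq_fintype_card (α := Bool × Bool)).le

theorem AllTetra.isomorphic_melonI {G : ColoredGraph.{u}} (h : G.AllTetra)
    (hG : G.Connected) (hq : G.IsQuartic) (h8 : Nat.card G.Node = 8)
    (h0 : ∀ c z, G.nb 0 (G.nb c z) = G.nb c (G.nb 0 z)) : G.Isomorphic melonI := by
  obtain ⟨z⟩ := hG.nonempty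
  refine isomorphic_of_hom (H := melonI) hG
    (fun p => if p.1 then G.nb 0 (G.tetraMap z p.2) else G.tetraMap z p.2) ?_
    ((false, false, false) : Bool × Bool × Bool) ?_
  · rintro c ⟨b, p⟩
    cases c using Fin.cases with
    | zero =>
      change (if !b then G.nb 0 (G.tetraMap z p) else G.tetraMap z p) =
        G.nb 0 (if b then G.nb 0 (G.tetraMap z p) else G.tetraMap z p)
      cases b <;> simp [G.nb_nb]
    | succ k =>
      change (if b then G.nb 0 (G.tetraMap z (flip k p)) else G.tetraMap z (flip k p)) = _
      rw [h.tetraMap_flip hq]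
      cases b <;> simp [h0]
  · rw [h8]; exact (Nat.card_eq_fintype_card (α := Bool × Bool × Bool)).le

theorem isomorphic_melonII {G : ColoredGraph.{u}} (hG : G.Connected) (h4 : Nat.card G.Node = 4)
    {ℓ : Fin 3} (h0 : ∀ c, c ≠ ℓ.succ → ∀ z, G.nb c z = G.nb 0 z) :
    G.Isomorphic (melonII ℓ) := by
  obtain ⟨z⟩ := hG.nonempty
  have hcomm := comm_of_card_eq_four h4 0 ℓ.succ
  let f : Bool × Bool → G.Node := fun p =>
    let y := if p.2 then G.nb 0 z else z
    if p.1 then G.nb ℓ.succ y else y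
  have f0 : ∀ p, f (flip 0 p) = G.nb ℓ.succ (f p) := by
    rintro ⟨p, q⟩
    change f (!p, q) = _
    cases p <;> cases q <;> simp [f, G.nb_nb]
  have f1 : ∀ p, f (flip 1 p) = G.nb 0 (f p) := by
    rintro ⟨p, q⟩
    change f (p, !q) = _
    cases p <;> cases q <;> simp [f, G.nb_nb, hcomm]
  refine isomorphic_of_hom (H := melonII ℓ) hG f ?_ ((false, false) : Bool × Bool) ?_
  · intro c p
    cases c using Fin.cases with
    | zero => exact f1 p
    | succ k =>
      change f ((if k = ℓ then flip 0 else flip 1) p) = _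
      by_cases hk : k = ℓ
      · rw [if_pos hk, hk]
        exact f0 p
      · rw [if_neg hk, h0 k.succ fun e => hk (Fin.succ_injective _ e)]
        exact f1 p
  · rw [h4]; exact (Nat.card_eq_fintype_card (α := Bool × Bool)).le

/-- The irreducible graphs of small degree. -/
theorem classification_of_irreducible {G : ColoredGraph.{u}} (hG : G.Connected)
    (hq : G.IsQuartic) (hr : ¬ G.IsReducible) (hd : G.degree < 1) :
    G.Isomorphic melonI ∨ (∃ ℓ, G.Isomorphic (melonII ℓ)) ∨
      ∃ ℓ, G.Isomorphic (infinityGraph ℓ) := by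
  have hsucc : ∀ c : Fin 4, c ≠ 0 → ∃ ℓ : Fin 3, c = ℓ.succ := by decide
  by_cases hT : G.AllTetra
  · rcases tetra_of_degree_lt_one hG hq hr hT hd with ⟨h4, c, hc, h0⟩ | ⟨h8, h0⟩
    · obtain ⟨ℓ, rfl⟩ := hsucc c hc
      exact .inr (.inr ⟨ℓ, hT.isomorphic_infinityGraph hG hq h4 h0⟩)
    · exact .inl (hT.isomorphic_melonI hG hq h8 h0)
  · obtain ⟨i, j, hi, hj, hij, x, hx⟩ := exists_pillow_of_not_allTetra hT
    obtain ⟨h4, h0⟩ := pillow_of_degree_lt_one hG hq hr hi hj hij hx hd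
    obtain ⟨-, h0'⟩ := pillow_of_degree_lt_one hG hq hr hj hi hij.symm hx.symm hd
    obtain ⟨k, ht⟩ := exists_isColorTriple hi hj hij
    obtain ⟨ℓ, hℓ⟩ := hsucc k ht.2.2.1
    refine .inr (.inl ⟨ℓ, isomorphic_melonII hG h4 fun c hc z => ?_⟩)
    rcases ht.cases c with rfl | rfl | rfl | rfl
    · rfl
    · exact (h0 z).symm
    · exact (h0' z).symm
    · exact absurd hℓ hc

/-! ### Iterated insertions -/

section assoc
variable (G : ColoredGraph.{u}) (x : G.Node) (H : ColoredGraph.{v}) (h : H.Node)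

theorem insertInl_ne_insertInr (z : G.Node) (w : H.Node) :
    (insertInl z : (G.insert x H h).Node) ≠ insertInr w := Sum.inl_ne_inr

theorem insert_congr {H' : ColoredGraph.{w}} (e : H.Node ≃ H'.Node)
    (he : ∀ c z, e (H.nb c z) = H'.nb c (e z)) :
    (G.insert x H h).Isomorphic (G.insert x H' (e h)) := by
  let f : (G.insert x H h).Node ≃ (G.insert x H' (e h)).Node :=
    Equiv.sumCongr (Equiv.refl _) e
  have fl : ∀ z, f (insertInl z) = insertInl z := fun z => rfl
  have fr : ∀ z, f (insertInr z) = insertInr (e z) := fun z => rfl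
  refine ⟨f, insert_hom G x H h (K := G.insert x H' (e h)) f (fun c hc z => ?_)
    (fun c hc z => ?_) (fun z h1 h2 => ?_) (fun z h1 h2 => ?_) ?_ ?_⟩
  · rw [fl, fl, insert_nb_inl _ _ _ _ hc]
  · rw [fr, fr, insert_nb_inr _ _ _ _ hc, he]
  · rw [fl, fl, insert_nb_zero_inl _ _ _ _ h1 h2]
  · rw [fr, fr, insert_nb_zero_inr _ _ _ _ (fun q => h1 (e.injective q))
      (fun q => h2 (e.injective (q.trans (he 0 h).symm))), he]
  · rw [fl, fr, insert_nb_zero_inl_self]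
  · rw [fl, fr, insert_nb_zero_inl_nb, he]

/-- A line has two ends. -/
theorem insert_line_symm : ∃ e : (G.insert x H h).Node ≃ (G.insert (G.nb 0 x) H (H.nb 0 h)).Node,
    (∀ c z, e ((G.insert x H h).nb c z) = (G.insert (G.nb 0 x) H (H.nb 0 h)).nb c (e z)) ∧
    (∀ z, e (insertInl z) = insertInl z) ∧ ∀ z, e (insertInr z) = insertInr z := by
  let f : (G.insert x H h).Node ≃ (G.insert (G.nb 0 x) H (H.nb 0 h)).Node := Equiv.refl _
  have fl : ∀ z, f (insertInl z) = insertInl z := fun z => rfl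
  have fr : ∀ z, f (insertInr z) = insertInr z := fun z => rfl
  refine ⟨f, insert_hom G x H h (K := G.insert (G.nb 0 x) H (H.nb 0 h)) f (fun c hc z => ?_)
    (fun c hc z => ?_) (fun z h1 h2 => ?_) (fun z h1 h2 => ?_) ?_ ?_, fl, fr⟩
  · rw [fl, fl, insert_nb_inl _ _ _ _ hc]
  · rw [fr, fr, insert_nb_inr _ _ _ _ hc]
  · rw [fl, fl, insert_nb_zero_inl _ _ _ _ h2 (by rwa [G.nb_nb])]
  · rw [fr, fr, insert_nb_zero_inr _ _ _ _ h2 (by rwa [H.nb_nb])]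
  · have := insert_nb_zero_inl_nb G (G.nb 0 x) H (H.nb 0 h)
    rw [G.nb_nb, H.nb_nb] at this
    rw [fl, fr, this]
  · rw [fl, fr, insert_nb_zero_inl_self]

variable (y : H.Node) (M : ColoredGraph.{w}) (m : M.Node)

/-- The cut line of `H` and the line receiving `M` are different, so the two operations do not
interact. -/
theorem insert_assoc (h1 : h ≠ y) (h2 : h ≠ H.nb 0 y) :
    (G.insert x (H.insert y M m) (insertInl h)).Isomorphic
      ((G.insert x H h).insert (insertInr y) M m) := by
  let f : (G.insert x (H.insert y M m) (insertInl h)).Node ≃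
      ((G.insert x H h).insert (insertInr y) M m).Node := (Equiv.sumAssoc _ _ _).symm
  have fl : ∀ z, f (insertInl z) = insertInl (insertInl z) := fun z => rfl
  have fm : ∀ z, f (insertInr (insertInl z)) = insertInl (insertInr z) := fun z => rfl
  have fr : ∀ z, f (insertInr (insertInr z)) = insertInr z := fun z => rfl
  have hy : (G.insert x H h).nb 0 (insertInr y) = insertInr (H.nb 0 y) :=
    insert_nb_zero_inr _ _ _ _ h1.symm fun e => h2 (by rw [e, H.nb_nb])
  have hh : (H.insert y M m).nb 0 (insertInl h) = insertInl (H.nb 0 h) :=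
    insert_nb_zero_inl _ _ _ _ h1 h2
  have hl : ∀ z, ((G.insert x H h).insert (insertInr y) M m).nb 0 (insertInl (insertInl z)) =
      insertInl ((G.insert x H h).nb 0 (insertInl z)) := fun z =>
    insert_nb_zero_inl _ _ _ _ (insertInl_ne_insertInr _ _ _ _ _ _)
      (by rw [hy]; exact insertInl_ne_insertInr _ _ _ _ _ _)
  refine ⟨f, insert_hom G x _ _ (K := (G.insert x H h).insert (insertInr y) M m) f
    (fun c hc z => ?_) (fun c hc => ?_) (fun z h3 h4 => ?_) ?_ ?_ ?_⟩
  · rw [fl, fl, insert_nb_inl _ _ _ _ hc, insert_nb_inl _ _ _ _ hc]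
  · rw [forall_insert]
    refine ⟨fun z => ?_, fun z => ?_⟩
    · rw [insert_nb_inl _ _ _ _ hc, fm, fm, insert_nb_inl _ _ _ _ hc, insert_nb_inr _ _ _ _ hc]
    · rw [insert_nb_inr _ _ _ _ hc, fr, fr, insert_nb_inr _ _ _ _ hc]
  · rw [fl, fl, hl, insert_nb_zero_inl _ _ _ _ h3 h4]
  · rw [forall_insert, hh]
    refine ⟨fun z h3 h4 => ?_, fun z h3 h4 => ?_⟩
    · rw [Ne, insertInl_inj] at h3 h4
      by_cases e : z = y
      · rw [e, insert_nb_zero_inl_self, fr, fm, insert_nb_zero_inl_self]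
      · by_cases e' : z = H.nb 0 y
        · rw [e', insert_nb_zero_inl_nb, fr, fm, ← hy, insert_nb_zero_inl_nb]
        · rw [insert_nb_zero_inl _ _ _ _ e e', fm, fm, insert_nb_zero_inl,
            insert_nb_zero_inr _ _ _ _ h3 h4]
          · rwa [Ne, insertInr_inj]
          · rwa [hy, Ne, insertInr_inj]
    · by_cases e : z = m
      · rw [e, insert_nb_zero_inr_self, fr, fm, insert_nb_zero_inr_self]
      · by_cases e' : z = M.nb 0 m
        · rw [e', insert_nb_zero_inr_nb, fr, fm, insert_nb_zero_inr_nb, hy]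
        · rw [insert_nb_zero_inr _ _ _ _ e e', fr, fr, insert_nb_zero_inr _ _ _ _ e e']
  · rw [fl, fm, hl, insert_nb_zero_inl_self]
  · rw [fl, hh, fm, hl, insert_nb_zero_inl_nb]

/-- Cutting the new line between `y` and `m` puts `H` and `M` in series on the line of `G`, with `M`
next to `nb 0 x`. -/
theorem insert_assoc_line :
    (G.insert x (H.insert y M m) (insertInl y)).Isomorphic
      ((G.insert x H y).insert (insertInl (G.nb 0 x)) M m) := by
  let f : (G.insert x (H.insert y M m) (insertInl y)).Node ≃
      ((G.insert x H y).insert (insertInl (G.nb 0 x)) M m).Node := (Equiv.sumAssoc _ _ _).symm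
  have fl : ∀ z, f (insertInl z) = insertInl (insertInl z) := fun z => rfl
  have fm : ∀ z, f (insertInr (insertInl z)) = insertInl (insertInr z) := fun z => rfl
  have fr : ∀ z, f (insertInr (insertInr z)) = insertInr z := fun z => rfl
  have hx : (G.insert x H y).nb 0 (insertInl (G.nb 0 x)) = insertInr (H.nb 0 y) :=
    insert_nb_zero_inl_nb _ _ _ _
  have hy : (H.insert y M m).nb 0 (insertInl y) = insertInr m := insert_nb_zero_inl_self _ _ _ _
  have hl : ∀ z, z ≠ G.nb 0 x →
      ((G.insert x H y).insert (insertInl (G.nb 0 x)) M m).nb 0 (insertInl (insertInl z)) =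
      insertInl ((G.insert x H y).nb 0 (insertInl z)) := fun z hz =>
    insert_nb_zero_inl _ _ _ _ (by rwa [Ne, insertInl_inj])
      (by rw [hx]; exact insertInl_ne_insertInr _ _ _ _ _ _)
  refine ⟨f, insert_hom G x _ _ (K := (G.insert x H y).insert (insertInl (G.nb 0 x)) M m) f
    (fun c hc z => ?_) (fun c hc => ?_) (fun z h3 h4 => ?_) ?_ ?_ ?_⟩
  · rw [fl, fl, insert_nb_inl _ _ _ _ hc, insert_nb_inl _ _ _ _ hc]
  · rw [forall_insert]
    refine ⟨fun z => ?_, fun z => ?_⟩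
    · rw [insert_nb_inl _ _ _ _ hc, fm, fm, insert_nb_inl _ _ _ _ hc, insert_nb_inr _ _ _ _ hc]
    · rw [insert_nb_inr _ _ _ _ hc, fr, fr, insert_nb_inr _ _ _ _ hc]
  · rw [fl, fl, hl z h4, insert_nb_zero_inl _ _ _ _ h3 h4]
  · rw [forall_insert, hy]
    refine ⟨fun z h3 _ => ?_, fun z _ h4 => ?_⟩
    · rw [Ne, insertInl_inj] at h3
      by_cases e : z = H.nb 0 y
      · rw [e, insert_nb_zero_inl_nb, fr, fm, ← hx, insert_nb_zero_inl_nb]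
      · rw [insert_nb_zero_inl _ _ _ _ h3 e, fm, fm, insert_nb_zero_inl,
          insert_nb_zero_inr _ _ _ _ h3 e]
        · exact (insertInl_ne_insertInr _ _ _ _ _ _).symm
        · rwa [hx, Ne, insertInr_inj]
    · rw [Ne, insertInr_inj] at h4
      by_cases e : z = M.nb 0 m
      · rw [e, insert_nb_zero_inr_nb, fr, fm, insert_nb_zero_inr_nb, hx]
      · rw [insert_nb_zero_inr _ _ _ _ h4 e, fr, fr, insert_nb_zero_inr _ _ _ _ h4 e]
  · rw [fl, fm, hl x (G.nb_ne 0 x).symm, insert_nb_zero_inl_self]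
  · rw [fl, hy, fr, insert_nb_zero_inl_self]

end assoc

/-! ### Melonic graphs -/

/-- If insertions of `M` and of `H` preserve melonic graphs, then so do insertions of graphs
obtained by inserting `M` in `H`. -/
theorem isMelonic_insert_insert {M : ColoredGraph.{0}}
    (hM : ∀ G : ColoredGraph.{u}, G.IsMelonic → ∀ x m, (G.insert x M m).IsMelonic)
    {H : ColoredGraph.{u}}
    (hH : ∀ G : ColoredGraph.{u}, G.IsMelonic → ∀ x h, (G.insert x H h).IsMelonic)
    (y : H.Node) (m : M.Node) {G : ColoredGraph.{u}} (hG : G.IsMelonic) (x : G.Node)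
    (v : (H.insert y M m).Node) : (G.insert x (H.insert y M m) v).IsMelonic := by
  -- The cut line may be one of the two new lines between `H` and `M` (`key1`, `key2`), or a line of
  -- `H` or `M` alone. Naming lines by their other ends (`key3`) lets new lines be addressed from
  -- the side of `H`.
  have key1 : ∀ (x : G.Node) (y : H.Node) (m : M.Node),
      (G.insert x (H.insert y M m) (insertInl y)).IsMelonic := fun x y m =>
    .of_isomorphic (insert_assoc_line G x H y M m).symm (hM _ (hH G hG _ _) _ _)
  have key2 : ∀ x : G.Node, (G.insert x (H.insert y M m) (insertInl (H.nb 0 y))).IsMelonic :=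
    fun x => by
      obtain ⟨e, he, hl, -⟩ := insert_line_symm H y M m
      have h1 := insert_congr G x (H.insert y M m) (insertInl (H.nb 0 y)) e he
      rw [hl] at h1
      exact .of_isomorphic h1.symm (key1 x (H.nb 0 y) (M.nb 0 m))
  have key3 : (G.insert (G.nb 0 x) (H.insert y M m) ((H.insert y M m).nb 0 v)).IsMelonic →
      (G.insert x (H.insert y M m) v).IsMelonic := fun h => by
    obtain ⟨e, he, -⟩ := insert_line_symm G x (H.insert y M m) v
    exact .of_isomorphic (Isomorphic.symm ⟨e, he⟩) h
  revert v
  rw [forall_insert]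
  refine ⟨fun z key3 => ?_, fun z key3 => ?_⟩
  · by_cases h1 : z = y
    · rw [h1]; exact key1 x y m
    · by_cases h2 : z = H.nb 0 y
      · rw [h2]; exact key2 x
      · exact .of_isomorphic (insert_assoc G x H z y M m h1 h2).symm (hM _ (hH G hG _ _) _ _)
  · by_cases h1 : z = m
    · refine key3 ?_
      rw [h1, insert_nb_zero_inr_self]
      exact key1 _ y m
    · by_cases h2 : z = M.nb 0 m
      · refine key3 ?_
        rw [h2, insert_nb_zero_inr_nb]
        exact key2 _
      -- The cut line lies inside `M`: the roles of `H` and `M` are exchanged.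
      · have h3 := insert_congr G x _ (insertInr z) (insertSwap H y M m) (insertSwap_nb H y M m)
        rw [insertSwap_inr] at h3
        exact .of_isomorphic (h3.trans (insert_assoc G x M z m H y h1 h2)).symm
          (hH _ (hM G hG _ _) _ _)

/-- Melonic graphs are closed under insertion. -/
theorem IsMelonic.insert {G H : ColoredGraph.{u}} (hG : G.IsMelonic) (hH : H.IsMelonic)
    (x : G.Node) (h : H.Node) : (G.insert x H h).IsMelonic := by
  have hI : ∀ G : ColoredGraph.{u}, G.IsMelonic → ∀ x m, (G.insert x melonI m).IsMelonic :=
    fun G hG x m => .stepI hG x m (.refl _)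
  have hII : ∀ ℓ, ∀ G : ColoredGraph.{u}, G.IsMelonic →
      ∀ x m, (G.insert x (melonII ℓ) m).IsMelonic :=
    fun ℓ G hG x m => .stepII hG ℓ x m (.refl _)
  induction hH generalizing G with
  | baseI e =>
    obtain ⟨e, he⟩ := e
    exact .of_isomorphic (insert_congr G x _ h e he).symm (hI G hG x _)
  | baseII ℓ e =>
    obtain ⟨e, he⟩ := e
    exact .of_isomorphic (insert_congr G x _ h e he).symm (hII ℓ G hG x _)
  | stepI _ y m e ih =>
    obtain ⟨e, he⟩ := e
    exact .of_isomorphic (insert_congr G x _ h e he).symm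
      (isMelonic_insert_insert hI (fun G hG x h => ih hG x h) y m hG x _)
  | stepII _ ℓ y m e ih =>
    obtain ⟨e, he⟩ := e
    exact .of_isomorphic (insert_congr G x _ h e he).symm
      (isMelonic_insert_insert (hII ℓ) (fun G hG x h => ih hG x h) y m hG x _)

/-! ### Melonic graphs as the graphs of degree zero -/

/-- The connected graphs of the quartic model of degree `q`. -/
def HasDegree (G : ColoredGraph.{u}) (q : ℚ) : Prop :=
  G.IsQuartic ∧ G.Connected ∧ G.degree = q

theorem HasDegree.of_isomorphic {G : ColoredGraph.{u}} {H : ColoredGraph.{v}} {q : ℚ}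
    (e : G.Isomorphic H) (h : H.HasDegree q) : G.HasDegree q :=
  ⟨e.symm.isQuartic h.1, e.symm.connected h.2.1, (e.symm.degree_eq h.1).symm.trans h.2.2⟩

theorem HasDegree.insert {G : ColoredGraph.{u}} {H : ColoredGraph.{v}} {q r : ℚ}
    (hG : G.HasDegree q) (hH : H.HasDegree r) (x : G.Node) (h : H.Node) :
    (G.insert x H h).HasDegree (q + r) :=
  ⟨hG.1.insert x h hH.1, hG.2.1.insert x h hH.2.1, by
    rw [degree_insert x h hG.1 hH.1, hG.2.2, hH.2.2]⟩

/-- The elementary graphs have degree 0, and the degree is additive. -/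
theorem IsMelonic.hasDegree {G : ColoredGraph.{u}} (hG : G.IsMelonic) : G.HasDegree 0 := by
  have hI : melonI.HasDegree 0 := ⟨melonI_isQuartic, melonI_connected, melonI_degree⟩
  have hII : ∀ ℓ, (melonII ℓ).HasDegree 0 := fun ℓ =>
    ⟨melonII_isQuartic ℓ, melonII_connected ℓ, melonII_degree ℓ⟩
  induction hG with
  | baseI e => exact hI.of_isomorphic e
  | baseII ℓ e => exact (hII ℓ).of_isomorphic e
  | stepI _ x h e ih => exact add_zero (0 : ℚ) ▸ (ih.insert hI x h).of_isomorphic e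
  | stepII _ ℓ x h e ih => exact add_zero (0 : ℚ) ▸ (ih.insert (hII ℓ) x h).of_isomorphic e

theorem infinityGraph_isNLO (ℓ : Fin 3) : (infinityGraph ℓ).IsNLO :=
  ⟨infinityGraph_isQuartic ℓ, infinityGraph_connected ℓ, infinityGraph_degree ℓ⟩

/-- Connected graphs of degree `0` are melonic. -/
theorem isMelonic_of_hasDegree_zero {G : ColoredGraph.{u}} (hG : G.HasDegree 0) :
    G.IsMelonic := by
  induction hn : Nat.card G.Node using Nat.strong_induction_on generalizing G with
  | _ n ih =>
    subst hn
    obtain ⟨hq, hc, hd⟩ := hG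
    by_cases hr : G.IsReducible
    · obtain ⟨S, x, y, h, hS⟩ := hr
      -- Two nonnegative degrees with sum 0 both vanish, so both closures are melonic by induction.
      have h' := h.compl hc hS
      have h1 := degree_nonneg (hc.closure h) (hq.closure h)
      have h2 := degree_nonneg (hc.closure h') (hq.closure h')
      have h3 := h.degree_eq_add hc hq hS
      exact .of_isomorphic (h.isomorphic_insert hc hS).symm (IsMelonic.insert
        (ih _ (h.card_closure_compl_lt hc hS) ⟨hq.closure h', hc.closure h', by linarith⟩ rfl)
        (ih _ (h.card_closure_lt hS) ⟨hq.closure h, hc.closure h, by linarith⟩ rfl) _ _)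
    · rcases classification_of_irreducible hc hq hr (by rw [hd]; norm_num) with e | ⟨ℓ, e⟩ | ⟨ℓ, e⟩
      · exact .baseI e
      · exact .baseII ℓ e
      · have := e.degree_eq hq
        rw [hd, infinityGraph_degree] at this
        norm_num at this

/-! ### Core graphs -/

theorem degree_eq_zero_or_of_add_eq_half {G : ColoredGraph.{u}} {H : ColoredGraph.{v}}
    (hG : G.IsQuartic) (hG' : G.Connected) (hH : H.IsQuartic) (hH' : H.Connected)
    (h : 1 / 2 = G.degree + H.degree) : G.degree = 0 ∨ H.degree = 0 := by
  obtain ⟨m, hm⟩ := exists_degree_eq_half hG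
  obtain ⟨n, hn⟩ := exists_degree_eq_half hH
  have h1 := degree_nonneg hG' hG
  have h2 := degree_nonneg hH' hH
  rw [hm] at h1 h
  rw [hn] at h2 h
  have h1' : 0 ≤ m := by
    have : (0 : ℚ) ≤ m := by linarith
    exact_mod_cast this
  have h2' : 0 ≤ n := by
    have : (0 : ℚ) ≤ n := by linarith
    exact_mod_cast this
  have h3 : m + n = 1 := by
    have : (m : ℚ) + n = 1 := by linarith
    exact_mod_cast this
  have h4 : m = 0 ∨ n = 0 := by omega
  rw [hm, hn]
  rcases h4 with rfl | rfl <;> simp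

/-- A proper 2-point subgraph splits 1/2 into two degrees, one of which is 0; that part or its
complement is then a melonic 2-point subgraph. -/
theorem IsCore.not_isReducible {G : ColoredGraph.{u}} (hG : G.IsNLO) (h : G.IsCore) :
    ¬ G.IsReducible := by
  rintro ⟨S, x, y, h2, hS⟩
  obtain ⟨hq, hc, hd⟩ := hG
  have h' := h2.compl hc hS
  have h3 := h2.degree_eq_add hc hq hS
  rw [hd] at h3
  rcases degree_eq_zero_or_of_add_eq_half (hq.closure h') (hc.closure h') (hq.closure h2)
    (hc.closure h2) h3 with h4 | h4
  · exact h ⟨_, _, _, h', isMelonic_of_hasDegree_zero ⟨hq.closure h', hc.closure h', h4⟩⟩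
  · exact h ⟨_, _, _, h2, isMelonic_of_hasDegree_zero ⟨hq.closure h2, hc.closure h2, h4⟩⟩

theorem IsNLO.exists_isomorphic_infinityGraph {G : ColoredGraph.{u}} (hG : G.IsNLO)
    (h : G.IsCore) : ∃ ℓ, G.Isomorphic (infinityGraph ℓ) := by
  obtain ⟨hq, hc, hd⟩ := hG
  rcases classification_of_irreducible hc hq (h.not_isReducible ⟨hq, hc, hd⟩)
    (by rw [hd]; norm_num) with e | ⟨ℓ, e⟩ | e
  · have := e.degree_eq hq
    rw [hd, melonI_degree] at this
    norm_num at this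
  · have := e.degree_eq hq
    rw [hd, melonII_degree] at this
    norm_num at this
  · exact e

theorem IsNLO.not_isMelonic {G : ColoredGraph.{u}} (hG : G.IsNLO) : ¬ G.IsMelonic := fun h => by
  have := hG.2.2.symm.trans h.hasDegree.2.2
  norm_num at this

/-- A `2`-point subgraph of a graph with a single bubble contains all the nodes. -/
theorem IsTwoPoint.eq_univ_of_isomorphic_infinityGraph {G : ColoredGraph.{u}} {ℓ : Fin 3}
    (e : G.Isomorphic (infinityGraph ℓ)) {S : Set G.Node} {x y : G.Node}
    (h : G.IsTwoPoint S x y) : S = Set.univ := by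
  have hc : G.Connected := e.symm.connected (infinityGraph_connected ℓ)
  obtain ⟨e, he⟩ := e
  have h0 : ∀ z, G.nb 0 z = G.nb ℓ.succ z := fun z => e.injective (by
    rw [he, he]; rfl)
  refine hc.eq_univ (fun c z hz => ?_) ⟨x, h.left_mem⟩
  by_cases hc : c = 0
  · rw [hc, h0]
    exact h.bubble_mem _ (Fin.succ_ne_zero ℓ) z hz
  · exact h.bubble_mem c hc z hz

/-- With a single bubble, a 2-point subgraph closes into the graph itself, whose degree 1/2 is not
that of a melonic graph. -/
theorem isNLO_and_isCore_of_isomorphic {G : ColoredGraph.{u}} {ℓ : Fin 3}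
    (e : G.Isomorphic (infinityGraph ℓ)) : G.IsNLO ∧ G.IsCore := by
  have hG := e.symm.isNLO (infinityGraph_isNLO ℓ)
  refine ⟨hG, ?_⟩
  rintro ⟨S, x, y, h, hm⟩
  exact hG.not_isMelonic (.of_isomorphic
    (h.isomorphic_of_eq_univ (h.eq_univ_of_isomorphic_infinityGraph e)).symm hm)

/-- Cutting out a melonic 2-point subgraph keeps the degree 1/2 and lowers the number of nodes, so
the process ends at a core graph. -/
theorem IsNLO.isMelonicInfinity {G : ColoredGraph.{u}} (hG : G.IsNLO) : G.IsMelonicInfinity := by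
  induction hn : Nat.card G.Node using Nat.strong_induction_on generalizing G with
  | _ n ih =>
    subst hn
    by_cases hcore : G.IsCore
    · obtain ⟨ℓ, e⟩ := hG.exists_isomorphic_infinityGraph hcore
      exact .base ℓ e
    · obtain ⟨S, x, y, h, hm⟩ := not_not.mp hcore
      have hS : S ≠ Set.univ := fun hS =>
        hG.not_isMelonic (.of_isomorphic (h.isomorphic_of_eq_univ hS).symm hm)
      obtain ⟨hq, hc, hd⟩ := hG
      have h' := h.compl hc hS
      have h3 := h.degree_eq_add hc hq hS
      rw [hd, hm.hasDegree.2.2, add_zero] at h3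
      exact .step (ih _ (h.card_closure_compl_lt hc hS)
        ⟨hq.closure h', hc.closure h', h3.symm⟩ rfl) _ hm _ (h.isomorphic_insert hc hS)

theorem IsMelonicInfinity.isNLO {G : ColoredGraph.{u}} (hG : G.IsMelonicInfinity) : G.IsNLO := by
  induction hG with
  | base ℓ e => exact e.symm.isNLO (infinityGraph_isNLO ℓ)
  | @step G G' H _ x hH h e ih =>
    have h1 : G.HasDegree (1 / 2) := ih
    have h2 := (h1.insert hH.hasDegree x h).of_isomorphic e
    rwa [add_zero] at h2

end ColoredGraph

/-! ### The classification -/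

theorem mainTheorem3 :
    (∀ G : ColoredGraph.{u},
      (G.IsNLO ∧ G.IsCore) ↔ ∃ ℓ : Fin 3, G.Isomorphic (ColoredGraph.infinityGraph ℓ)) ∧
    (∀ ℓ ℓ' : Fin 3,
      (ColoredGraph.infinityGraph ℓ).Isomorphic (ColoredGraph.infinityGraph ℓ') → ℓ = ℓ') ∧
    (∀ G : ColoredGraph.{u}, G.IsNLO ↔ G.IsMelonicInfinity) := by
  refine ⟨fun G => ⟨fun h => h.1.exists_isomorphic_infinityGraph h.2, fun ⟨ℓ, e⟩ =>
    ColoredGraph.isNLO_and_isCore_of_isomorphic e⟩,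
    fun ℓ ℓ' h => ColoredGraph.infinityGraph_injective h,
    fun G => ⟨fun h => h.isMelonicInfinity, fun h => h.isNLO⟩⟩
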